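/- **Setting.** Let $\mathcal X\subseteq\mathcal S\times\mathcal A$ be a finite set of state-action pairs such that every state $s\in\mathcal S$ has at least one pair $(s,a)\in\mathcal X$; put $S=|\mathcal S|$. An episodic MDP with horizon $H\ge 1$ assigns to each $x\in\mathcal X$ a transition law $P(x)$ on $\mathcal S$ and a reward law $P_R(x)$ on $[0,1]$. In each episode $k=1,2,\dots$ an initial state $s_{k,1}$ is chosen arbitrarily (possibly adversarially, depending on the past), a deterministic time-dependent policy $\pi_k$ is played for $H$ steps with $x_{k,h}=(s_{k,h},\pi_k(s_{k,h},h))$, and $s_{k,h+1}\sim P(x_{k,h})$. Write $V^{\pi}_1(s)$ for the expected return of $\pi$ from $s$ and $V^\star_1(s)=\max_\pi V^\pi_1(s)$. Let $G$ be a directed graph on $\mathcal X$ without self-loops (the feedback graph). When $x_{k,h}$ is played, one observation $(y,r,s')$ is received for $y=x_{k,h}$ (its next state being $s_{k,h+1}$) and for each $y$ with an edge $x_{k,h}\to y$ in $G$; given everything that happened before the outcome of this step, $r$ has law $P_R(y)$ and $s'$ has law $P(y)$, while observations made in the same step may depend on each other. Let $M$ be the mas-number of $G$: the maximal size of a set of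 vertices whose induced subgraph has no directed cycle. Let $\hat S\le S$ be such that every $P(x)$ has at most $\hat S$ possible successor states, and let $\delta\in(0,1]$. **Algorithm.** For each $x$ keep the number $n(x)$ of observations of $x$, the empirical means $\hat r(x)$, $\widehat{r^2}(x)$ of the observed rewards and of their squares, and the empirical transition frequencies $\hat P(x)$, using all observations (side observations included); initially $n=\hat r=\widehat{r^2}=0$ and $\hat P(x)$ is a fixed point mass. Let $\phi(0)=1$ and, for $n\ge1$, $$\phi(n)=1\wedge\sqrt{\tfrac{0.52}{n}\Big(1.4\ln\ln(e\vee 2n)+\ln\tfrac{5.2\,|\mathcal X|(4\hat S+5H+7)}{\delta}\Big)}.$$ Before each episode $k$ compute, from the current model, $\widetilde V_{H+1}=\underline V_{H+1}=0$ and, for $h=H,\dots,1$ and $x=(s,a)\in\mathcal X$, $$\psi_h(x)=4\Big(\sqrt{\widehat{r^2}(x)-\hat r(x)^2}+\sqrt{\hat P(x)\widetilde V_{h+1}^2-(\hat P(x)\widetilde V_{h+1})^2}\Big)\phi(n(x))+53\hat S H^2\phi(n(x))^2+\tfrac1H\hat P(x)(\widetilde V_{h+1}-\underline V_{h+1}),$$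 $$\widetilde Q_h(x)=0\vee\big(\hat r(x)+\hat P(x)\widetilde V_{h+1}+\psi_h(x)\big)\wedge(H-h+1),\qquad \underline Q_h(x)=0\vee\big(\hat r(x)+\hat P(x)\underline V_{h+1}-\psi_h(x)\big)\wedge(H-h+1),$$ $\pi_k(s,h)\in\operatorname{argmax}_a\widetilde Q_h(s,a)$ (ties broken arbitrarily, without knowledge of the future), $\widetilde V_h(s)=\widetilde Q_h(s,\pi_k(s,h))$ and $\underline V_h(s)=\underline Q_h(s,\pi_k(s,h))$. Denote the results by $\widetilde V_{k,h},\underline V_{k,h}$; the certificate of episode $k$ is $[\underline V_{k,1}(s_{k,1}),\widetilde V_{k,1}(s_{k,1})]$. Then play $\pi_k$ and update the model. **Theorem.** There is an absolute constant $C>0$ such that, for every MDP, feedback graph $G$, $H$, $\hat S$, $\delta$ and choice of initial states as above, with probability at least $1-\delta$ the following hold simultaneously: for all $k$, $\underline V_{k,1}(s_{k,1})\le V^{\pi_k}_1(s_{k,1})\le V^\star_1(s_{k,1})\le\widetilde V_{k,1}(s_{k,1})$; and for all $T$, both the cumulative certificate size $\sum_{k=1}^T(\widetilde V_{k,1}(s_{k,1})-\underline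 V_{k,1}(s_{k,1}))$ and the regret $R(T)=\sum_{k=1}^T(V^\star_1(s_{k,1})-V^{\pi_k}_1(s_{k,1}))$ are at most $$C\Big(\sqrt{MH^2T}\;\ln\tfrac{e|\mathcal X|HT}{\delta}+M\hat SH^2\ln^3\tfrac{e|\mathcal X|HT}{\delta}\Big),$$ that is, $\widetilde O(\sqrt{MH^2T}+M\hat SH^2)$. -/

import Mathlib

open MeasureTheory

noncomputable section

namespace FeedbackRL

universe u v w

variable {S : Type u} {A : Type v}

/-! ### Tabular episodic MDPs

The state-action space is a finite set `X` of pairs `(s, a)`. Time steps within an episode are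
numbered `0, …, H - 1`, episodes are numbered `0, 1, 2, …`. -/

/-- Transition law `P x` and reward law `PR x` (carried by `[0, 1]`) of every pair `x ∈ X`. -/
structure MDP (X : Finset (S × A)) where
  P : X → PMF S
  PR : X → Measure ℝ
  PR_prob : ∀ x, IsProbabilityMeasure (PR x)
  PR_bdd : ∀ x, PR x (Set.Icc 0 1)ᶜ = 0

/-- Deterministic, time-dependent policies; only the steps `h < H` matter. -/
def Policy (X : Finset (S × A)) := ℕ → (s : S) → {a : A // (s, a) ∈ X}

/-- The pair `(s, π(s, h))`. -/
def Policy.pair {X : Finset (S × A)} (π : Policy X) (h : ℕ) (s : S) : X :=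
  ⟨(s, (π h s).1), (π h s).2⟩

/-- Expected immediate reward. -/
def MDP.meanReward {X : Finset (S × A)} (M : MDP X) (x : X) : ℝ := ∫ r, r ∂(M.PR x)

/-- Law of the state at step `h` of an episode started in `s` and played with `π`. -/
def MDP.stateLaw {X : Finset (S × A)} (M : MDP X) (π : Policy X) (s : S) : ℕ → PMF S
  | 0 => PMF.pure s
  | h + 1 => (M.stateLaw π s h).bind fun s' => M.P (π.pair h s')

/-- Expected return of `π` over an episode of length `H` started in `s`. -/
def MDP.value {X : Finset (S × A)} [Fintype S] (M : MDP X) (H : ℕ) (π : Policy X) (s : S) : ℝ :=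
  ∑ h ∈ Finset.range H, ∑ s', (M.stateLaw π s h s').toReal * M.meanReward (π.pair h s')

/-- Optimal expected return from `s`. -/
def MDP.optValue {X : Finset (S × A)} [Fintype S] (M : MDP X) (H : ℕ) (s : S) : ℝ :=
  ⨆ π : Policy X, M.value H π s

/-! ### Feedback graphs -/

/-- `V` induces a subgraph without directed cycles. -/
def IsAcyclicOn {W : Type w} (G : Digraph W) (V : Finset W) : Prop :=
  ∀ v ∈ V, ¬ Relation.TransGen (fun a b => a ∈ V ∧ b ∈ V ∧ G.Adj a b) v v

open Classical in
/-- Size of a maximum acyclic (vertex-induced) subgraph. -/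
def masNumber {W : Type w} [Fintype W] (G : Digraph W) : ℕ :=
  ((Finset.univ : Finset (Finset W)).filter (IsAcyclicOn G)).sup Finset.card

/-- Playing `x` reveals an observation of `y`; self-loops are implicit. -/
def Observes {W : Type w} (G : Digraph W) (x y : W) : Prop := y = x ∨ G.Adj x y

/-! ### Empirical model -/

/-- Number of observations, empirical first and second reward moments, transition frequencies. -/
structure Stats (X : Finset (S × A)) where
  n : X → ℕ
  r : X → ℝ
  r2 : X → ℝ
  P : X → S → ℝ

open Classical in
/-- No observations; the transition estimates are the point mass at a reference state `s₀`. -/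
def Stats.init {X : Finset (S × A)} (s₀ : S) : Stats X where
  n _ := 0
  r _ := 0
  r2 _ := 0
  P _ s := if s = s₀ then 1 else 0

/-- Running average `(n - 1) / n * old + 1 / n * new`, where `n` is the updated count. -/
def runAvg (n : ℕ) (old new : ℝ) : ℝ := ((n : ℝ) - 1) / n * old + 1 / n * new

open Classical in
/-- Update of the model with the observations received when `x` is played: for each observed `y`,
the reward sample `R y` and the successor sample `N y`. -/
def Stats.observe {X : Finset (S × A)} (st : Stats X) (G : Digraph X) (x : X)
    (R : X → ℝ) (N : X → S) : Stats X where
  n y := if Observes G x y then st.n y + 1 else st.n y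
  r y := if Observes G x y then runAvg (st.n y + 1) (st.r y) (R y) else st.r y
  r2 y := if Observes G x y then runAvg (st.n y + 1) (st.r2 y) (R y ^ 2) else st.r2 y
  P y s := if Observes G x y then runAvg (st.n y + 1) (st.P y s) (if s = N y then 1 else 0)
    else st.P y s

/-- Model after the first `h` steps of an episode, started from the model `st`; `x h` is the pair
played at step `h`. -/
def Stats.run {X : Finset (S × A)} (st : Stats X) (G : Digraph X) (x : ℕ → X)
    (R : ℕ → X → ℝ) (N : ℕ → X → S) : ℕ → Stats X
  | 0 => st
  | h + 1 => (st.run G x R N h).observe G (x h) (R h) (N h)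

/-- Model at the start of episode `k`. -/
def statsAt {X : Finset (S × A)} (H : ℕ) (G : Digraph X) (s₀ : S) (x : ℕ → ℕ → X)
    (R : ℕ → ℕ → X → ℝ) (N : ℕ → ℕ → X → S) : ℕ → Stats X
  | 0 => Stats.init s₀
  | k + 1 => (statsAt H G s₀ x R N k).run G (x k) (R k) (N k) H

/-! ### Optimistic planning -/

/-- Width function `φ` of the confidence bounds, with `φ(0) = 1`; `card` is `|X|` and `Shat` the
known bound on the number of successor states. -/
def phi (card H Shat : ℕ) (δ : ℝ) (n : ℕ) : ℝ :=
  if n = 0 then 1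
  else min 1 (Real.sqrt (0.52 / n * (1.4 * Real.log (Real.log (max (Real.exp 1) (2 * n)))
    + Real.log (5.2 * card * (4 * Shat + 5 * H + 7) / δ))))

/-- `P̂(x) f`. -/
def Stats.expect {X : Finset (S × A)} [Fintype S] (st : Stats X) (x : X) (f : S → ℝ) : ℝ :=
  ∑ s, st.P x s * f s

/-- Reward bonus `ψ`; `V.1`, `V.2` are the upper and lower value bounds of the next step. -/
def bonus {X : Finset (S × A)} [Fintype S] (H Shat : ℕ) (δ : ℝ) (st : Stats X)
    (V : (S → ℝ) × (S → ℝ)) (x : X) : ℝ :=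
  4 * (Real.sqrt (st.r2 x - st.r x ^ 2)
      + Real.sqrt (st.expect x (fun s => V.1 s ^ 2) - st.expect x V.1 ^ 2))
    * phi X.card H Shat δ (st.n x)
  + 53 * Shat * H ^ 2 * phi X.card H Shat δ (st.n x) ^ 2
  + 1 / H * st.expect x (fun s => V.1 s - V.2 s)

/-- Upper bound on `Q` with `j` steps to go, clipped to `[0, j]`. -/
def upperQ {X : Finset (S × A)} [Fintype S] (H Shat : ℕ) (δ : ℝ) (st : Stats X) (j : ℕ)
    (V : (S → ℝ) × (S → ℝ)) (x : X) : ℝ :=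
  max 0 (min (st.r x + st.expect x V.1 + bonus H Shat δ st V x) j)

/-- Lower bound on `Q` with `j` steps to go, clipped to `[0, j]`. -/
def lowerQ {X : Finset (S × A)} [Fintype S] (H Shat : ℕ) (δ : ℝ) (st : Stats X) (j : ℕ)
    (V : (S → ℝ) × (S → ℝ)) (x : X) : ℝ :=
  max 0 (min (st.r x + st.expect x V.2 - bonus H Shat δ st V x) j)

/-- Upper and lower value bounds with `j` steps to go (that is, at step `H - j`) along `π`. -/
def valueBounds {X : Finset (S × A)} [Fintype S] (H Shat : ℕ) (δ : ℝ) (st : Stats X)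
    (π : Policy X) : ℕ → (S → ℝ) × (S → ℝ)
  | 0 => (fun _ => 0, fun _ => 0)
  | j + 1 =>
    (fun s => upperQ H Shat δ st (j + 1) (valueBounds H Shat δ st π j) (π.pair (H - (j + 1)) s),
     fun s => lowerQ H Shat δ st (j + 1) (valueBounds H Shat δ st π j) (π.pair (H - (j + 1)) s))

/-- `π` is an output of the planning routine on the model `st`: at every step it picks an action
of maximal upper bound (ties are broken arbitrarily). -/
def IsGreedy {X : Finset (S × A)} [Fintype S] (H Shat : ℕ) (δ : ℝ) (st : Stats X)
    (π : Policy X) : Prop :=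
  ∀ j < H, ∀ (s : S) (a : A) (ha : (s, a) ∈ X),
    upperQ H Shat δ st (j + 1) (valueBounds H Shat δ st π j) ⟨(s, a), ha⟩ ≤
      upperQ H Shat δ st (j + 1) (valueBounds H Shat δ st π j) (π.pair (H - (j + 1)) s)

/-! ### Interaction of the algorithm with the MDP -/

/-- A run of the algorithm on the MDP `M` with feedback graph `G`, on a probability space `(Ω, μ)`.
`𝓕 (k * H + h)` is the information available in episode `k` when the action of step `h` is taken,
before its outcome is seen. The initial state `state k 0` may depend arbitrarily on the past (and
on further randomness). `reward k h y`, `next k h y` is the observation of `y` received at step `h`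
of episode `k`; it is only used, and only restricted, if `y` is observed then. Given the past it has
marginal laws `PR y` and `P y`; simultaneous observations may depend on each other. -/
structure Run {X : Finset (S × A)} [Fintype S] (M : MDP X) (G : Digraph X) (H Shat : ℕ) (δ : ℝ)
    (s₀ : S) {Ω : Type w} [mΩ : MeasurableSpace Ω] (μ : Measure Ω) where
  𝓕 : Filtration ℕ mΩ
  policy : ℕ → Ω → Policy X
  state : ℕ → ℕ → Ω → S
  reward : ℕ → ℕ → X → Ω → ℝ
  next : ℕ → ℕ → X → Ω → S
  policy_meas : ∀ k, ∀ h < H, ∀ (s : S) (a : A),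
    MeasurableSet[𝓕 (k * H)] {ω | (policy k ω h s).1 = a}
  state_meas : ∀ k, ∀ h < H, ∀ s : S, MeasurableSet[𝓕 (k * H + h)] {ω | state k h ω = s}
  reward_meas : ∀ k, ∀ h < H, ∀ y, Measurable[𝓕 (k * H + h + 1)] (reward k h y)
  next_meas : ∀ k, ∀ h < H, ∀ y, ∀ s : S, MeasurableSet[𝓕 (k * H + h + 1)] {ω | next k h y ω = s}
  reward_law : ∀ k, ∀ h < H, ∀ y, ∀ F : Set Ω, MeasurableSet[𝓕 (k * H + h)] F →
    (∀ ω ∈ F, Observes G ((policy k ω).pair h (state k h ω)) y) →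
    ∀ B : Set ℝ, MeasurableSet B → μ (F ∩ reward k h y ⁻¹' B) = μ F * M.PR y B
  next_law : ∀ k, ∀ h < H, ∀ y, ∀ F : Set Ω, MeasurableSet[𝓕 (k * H + h)] F →
    (∀ ω ∈ F, Observes G ((policy k ω).pair h (state k h ω)) y) →
    ∀ s : S, μ (F ∩ {ω | next k h y ω = s}) = μ F * M.P y s
  state_succ : ∀ k h, h + 1 < H → ∀ ω,
    state k (h + 1) ω = next k h ((policy k ω).pair h (state k h ω)) ω
  greedy : ∀ k ω, IsGreedy H Shat δ
    (statsAt H G s₀ (fun i h => (policy i ω).pair h (state i h ω))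
      (fun i h y => reward i h y ω) (fun i h y => next i h y ω) k)
    (policy k ω)

namespace Run

variable {X : Finset (S × A)} [Fintype S] {M : MDP X} {G : Digraph X} {H Shat : ℕ} {δ : ℝ}
  {s₀ : S} {Ω : Type w} [mΩ : MeasurableSpace Ω] {μ : Measure Ω}

/-- Model of the algorithm at the start of episode `k`. -/
def stats (ρ : Run M G H Shat δ s₀ μ) (k : ℕ) (ω : Ω) : Stats X :=
  statsAt H G s₀ (fun i h => (ρ.policy i ω).pair h (ρ.state i h ω))
    (fun i h y => ρ.reward i h y ω) (fun i h y => ρ.next i h y ω) k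

/-- Upper end of the certificate of episode `k`. -/
def upper (ρ : Run M G H Shat δ s₀ μ) (k : ℕ) (ω : Ω) : ℝ :=
  (valueBounds H Shat δ (ρ.stats k ω) (ρ.policy k ω) H).1 (ρ.state k 0 ω)

/-- Lower end of the certificate of episode `k`. -/
def lower (ρ : Run M G H Shat δ s₀ μ) (k : ℕ) (ω : Ω) : ℝ :=
  (valueBounds H Shat δ (ρ.stats k ω) (ρ.policy k ω) H).2 (ρ.state k 0 ω)

/-- Expected return, from the initial state of episode `k`, of the policy played in it. -/
def playedValue (ρ : Run M G H Shat δ s₀ μ) (k : ℕ) (ω : Ω) : ℝ :=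
  M.value H (ρ.policy k ω) (ρ.state k 0 ω)

/-- Optimal expected return from the initial state of episode `k`. -/
def bestValue (ρ : Run M G H Shat δ s₀ μ) (k : ℕ) (ω : Ω) : ℝ :=
  M.optValue H (ρ.state k 0 ω)

/-- Cumulative certificate size of the first `T` episodes. -/
def certSize (ρ : Run M G H Shat δ s₀ μ) (T : ℕ) (ω : Ω) : ℝ :=
  ∑ k ∈ Finset.range T, (ρ.upper k ω - ρ.lower k ω)

/-- Regret of the first `T` episodes. -/
def regret (ρ : Run M G H Shat δ s₀ μ) (T : ℕ) (ω : Ω) : ℝ :=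
  ∑ k ∈ Finset.range T, (ρ.bestValue k ω - ρ.playedValue k ω)

end Run

/-- `√(M H² T) L + M Ŝ H² L³` with `L = ln (e |X| H T / δ)`. -/
def boundRate (mas card H Shat : ℕ) (δ : ℝ) (T : ℕ) : ℝ :=
  Real.sqrt (mas * H ^ 2 * T) * Real.log (Real.exp 1 * card * H * T / δ)
    + mas * Shat * H ^ 2 * Real.log (Real.exp 1 * card * H * T / δ) ^ 3

end FeedbackRL

end

noncomputable section

namespace FeedbackRL

universe u v w

variable {S : Type u} {A : Type v}

section Values

variable {X : Finset (S × A)}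

/-- Transition probabilities as real numbers. -/
def MDP.p (M : MDP X) (x : X) (s : S) : ℝ := (M.P x s).toReal

lemma MDP.p_nonneg (M : MDP X) (x : X) (s : S) : 0 ≤ M.p x s := ENNReal.toReal_nonneg

lemma MDP.meanReward_mem (M : MDP X) (x : X) : M.meanReward x ∈ Set.Icc (0 : ℝ) 1 := by
  have := M.PR_prob x
  have hae : ∀ᵐ r ∂(M.PR x), r ∈ Set.Icc (0 : ℝ) 1 := by
    rw [ae_iff]; exact M.PR_bdd x
  constructor
  · exact integral_nonneg_of_ae (hae.mono fun r hr => hr.1)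
  · have h1 : Integrable (fun r : ℝ => r) (M.PR x) :=
      Integrable.of_bound measurable_id.aestronglyMeasurable 1
        (hae.mono fun r hr => by rw [Real.norm_eq_abs, abs_of_nonneg hr.1]; exact hr.2)
    calc ∫ r, r ∂(M.PR x) ≤ ∫ _, (1 : ℝ) ∂(M.PR x) :=
          integral_mono_ae h1 (integrable_const _) (hae.mono fun r hr => hr.2)
      _ = 1 := by simp

lemma finite_actions (s : S) : Finite {a : A // (s, a) ∈ X} :=
  Finite.of_injective (fun a => (⟨(s, a.1), a.2⟩ : X)) fun a b h => by
    ext; simpa using h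

variable [Fintype S]

/-- Expectation of `f` under the weights `p`. -/
def wavg (p f : S → ℝ) : ℝ := ∑ s, p s * f s

/-- Variance of `f` under the weights `p`. -/
def wvar (p f : S → ℝ) : ℝ := wavg p (fun s => f s ^ 2) - wavg p f ^ 2

lemma sum_pmf_toReal (q : PMF S) : ∑ s, (q s).toReal = 1 := by
  rw [← ENNReal.toReal_sum (fun s _ => q.apply_ne_top s), ← tsum_fintype (L := .unconditional S), q.tsum_coe]; rfl

lemma MDP.p_sum (M : MDP X) (x : X) : ∑ s, M.p x s = 1 := sum_pmf_toReal _

lemma wavg_mono {p f g : S → ℝ} (hp : ∀ s, 0 ≤ p s) (h : ∀ s, f s ≤ g s) : wavg p f ≤ wavg p g :=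
  Finset.sum_le_sum fun s _ => mul_le_mul_of_nonneg_left (h s) (hp s)

lemma wavg_const {p : S → ℝ} (hs : ∑ s, p s = 1) (c : ℝ) : wavg p (fun _ => c) = c := by
  simp [wavg, ← Finset.sum_mul, hs]

lemma wavg_nonneg {p f : S → ℝ} (hp : ∀ s, 0 ≤ p s) (h : ∀ s, 0 ≤ f s) : 0 ≤ wavg p f :=
  Finset.sum_nonneg fun s _ => mul_nonneg (hp s) (h s)

lemma wavg_le {p f : S → ℝ} (hp : ∀ s, 0 ≤ p s) (hs : ∑ s, p s = 1) {B : ℝ} (h : ∀ s, f s ≤ B) :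
    wavg p f ≤ B := (wavg_mono hp h).trans_eq (wavg_const hs B)

lemma wavg_sub (p f g : S → ℝ) : wavg p (fun s => f s - g s) = wavg p f - wavg p g := by
  simp [wavg, mul_sub]

lemma wavg_add (p f g : S → ℝ) : wavg p (fun s => f s + g s) = wavg p f + wavg p g := by
  simp [wavg, mul_add, Finset.sum_add_distrib]

lemma wavg_const_mul (p f : S → ℝ) (c : ℝ) : wavg p (fun s => c * f s) = c * wavg p f := by
  simp only [wavg, Finset.mul_sum]
  exact Finset.sum_congr rfl fun s _ => by ring

/-- Value of `π` with `j` steps to go in an episode of length `H`. -/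
def MDP.polVal (M : MDP X) (H : ℕ) (π : Policy X) : ℕ → S → ℝ
  | 0, _ => 0
  | j + 1, s => M.meanReward (π.pair (H - (j + 1)) s)
      + wavg (M.p (π.pair (H - (j + 1)) s)) (M.polVal H π j)

/-- Optimal value with `j` steps to go. -/
def MDP.starVal (M : MDP X) : ℕ → S → ℝ
  | 0, _ => 0
  | j + 1, s => ⨆ a : {a : A // (s, a) ∈ X},
      (M.meanReward ⟨(s, a.1), a.2⟩ + wavg (M.p ⟨(s, a.1), a.2⟩) (M.starVal j))

lemma MDP.le_starVal_succ (M : MDP X) (j : ℕ) (s : S) (a : A) (ha : (s, a) ∈ X) :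
    M.meanReward ⟨(s, a), ha⟩ + wavg (M.p ⟨(s, a), ha⟩) (M.starVal j) ≤ M.starVal (j + 1) s := by
  have := finite_actions (X := X) s
  exact le_ciSup (f := fun a : {a : A // (s, a) ∈ X} =>
    M.meanReward ⟨(s, a.1), a.2⟩ + wavg (M.p ⟨(s, a.1), a.2⟩) (M.starVal j))
    (Set.finite_range _).bddAbove ⟨a, ha⟩

lemma MDP.starVal_mem (M : MDP X) (π : Policy X) (j : ℕ) :
    ∀ s, 0 ≤ M.starVal j s ∧ M.starVal j s ≤ j := by
  induction j with
  | zero => intro s; simp [MDP.starVal]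
  | succ j ih =>
    intro s
    have : Nonempty {a : A // (s, a) ∈ X} := ⟨π 0 s⟩
    constructor
    · refine le_trans ?_ (M.le_starVal_succ j s _ (π 0 s).2)
      exact add_nonneg (M.meanReward_mem _).1 (wavg_nonneg (M.p_nonneg _) fun s => (ih s).1)
    · refine ciSup_le fun a => ?_
      push_cast
      have := wavg_le (M.p_nonneg ⟨(s, a.1), a.2⟩) (M.p_sum _) (fun s => (ih s).2)
      linarith [(M.meanReward_mem ⟨(s, a.1), a.2⟩).2]

lemma MDP.polVal_mem (M : MDP X) (H : ℕ) (π : Policy X) (j : ℕ) :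
    ∀ s, 0 ≤ M.polVal H π j s ∧ M.polVal H π j s ≤ M.starVal j s := by
  induction j with
  | zero => intro s; simp [MDP.starVal, MDP.polVal]
  | succ j ih =>
    intro s
    constructor
    · exact add_nonneg (M.meanReward_mem _).1 (wavg_nonneg (M.p_nonneg _) fun s => (ih s).1)
    · refine le_trans ?_ (M.le_starVal_succ j s _ (π (H - (j + 1)) s).2)
      exact add_le_add_right (wavg_mono (M.p_nonneg _) fun s => (ih s).2) _

lemma MDP.stateLaw_avg_succ (M : MDP X) (π : Policy X) (s : S) (h : ℕ) (f : S → ℝ) :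
    ∑ s', (M.stateLaw π s (h + 1) s').toReal * f s'
      = ∑ s', (M.stateLaw π s h s').toReal * wavg (M.p (π.pair h s')) f := by
  have h1 : ∀ s', (M.stateLaw π s (h + 1) s').toReal
      = ∑ s'', (M.stateLaw π s h s'').toReal * M.p (π.pair h s'') s' := by
    intro s'
    rw [MDP.stateLaw, PMF.bind_apply, tsum_fintype, ENNReal.toReal_sum]
    · simp [MDP.p]
    · intro a _
      exact ENNReal.mul_ne_top (PMF.apply_ne_top _ _) (PMF.apply_ne_top _ _)
  simp only [h1, wavg, Finset.sum_mul, Finset.mul_sum]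
  rw [Finset.sum_comm]
  exact Finset.sum_congr rfl fun _ _ => Finset.sum_congr rfl fun _ _ => by ring

lemma MDP.value_eq_polVal (M : MDP X) (H : ℕ) (π : Policy X) (s : S) :
    M.value H π s = M.polVal H π H s := by
  have key : ∀ m ≤ H, M.polVal H π H s
      = ∑ h ∈ Finset.range m, ∑ s', (M.stateLaw π s h s').toReal * M.meanReward (π.pair h s')
        + ∑ s', (M.stateLaw π s m s').toReal * M.polVal H π (H - m) s' := by
    intro m
    induction m with
    | zero =>
      classical
      intro _
      simp only [Finset.range_zero, Finset.sum_empty, zero_add, MDP.stateLaw, Nat.sub_zero]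
      rw [Finset.sum_eq_single s]
      · simp
      · intro b _ hb; simp [PMF.pure_apply, hb]
      · simp
    | succ m ih =>
      intro hm
      rw [ih (by omega), Finset.sum_range_succ, add_assoc, M.stateLaw_avg_succ,
        ← Finset.sum_add_distrib]
      congr 1
      refine Finset.sum_congr rfl fun s' _ => ?_
      obtain ⟨j, hj⟩ : ∃ j, H - m = j + 1 := ⟨H - m - 1, by omega⟩
      have hj' : H - (m + 1) = j := by omega
      have hj2 : H - (j + 1) = m := by omega
      rw [hj, hj', MDP.polVal, hj2, mul_add]
  rw [key H le_rfl, MDP.value]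
  simp [MDP.polVal]

lemma MDP.value_le_optValue (M : MDP X) (H : ℕ) (π : Policy X) (s : S) :
    M.value H π s ≤ M.optValue H s :=
  le_ciSup (f := fun π : Policy X => M.value H π s)
    ⟨M.starVal H s, by
      rintro _ ⟨π, rfl⟩
      exact (M.value_eq_polVal H π s).trans_le (M.polVal_mem H π H s).2⟩ π

lemma MDP.optValue_le_starVal (M : MDP X) (H : ℕ) (π : Policy X) (s : S) :
    M.optValue H s ≤ M.starVal H s := by
  have : Nonempty (Policy X) := ⟨π⟩
  exact ciSup_le fun π => (M.value_eq_polVal H π s).trans_le (M.polVal_mem H π H s).2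

end Values

section Graph

variable {W : Type w}

lemma card_le_masNumber [Fintype W] {G : Digraph W} {V : Finset W} (h : IsAcyclicOn G V) :
    V.card ≤ masNumber G := by
  classical
  unfold masNumber
  exact Finset.le_sup (f := Finset.card) (by simpa using h)

lemma isAcyclicOn_empty (G : Digraph W) : IsAcyclicOn G ∅ := by
  intro v hv; simp at hv

/-- Adding a vertex without incoming edges keeps a set acyclic. -/
lemma IsAcyclicOn.insert_source [DecidableEq W] {G : Digraph W} {V : Finset W}
    (h : IsAcyclicOn G V) {y : W} (hy : ∀ z ∈ insert y V, ¬ G.Adj z y) :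
    IsAcyclicOn G (insert y V) := by
  have key : ∀ a b, Relation.TransGen
      (fun a b => a ∈ insert y V ∧ b ∈ insert y V ∧ G.Adj a b) a b → b ≠ y ∧
      (a ≠ y → Relation.TransGen (fun a b => a ∈ V ∧ b ∈ V ∧ G.Adj a b) a b) := by
    intro a b hab
    induction hab with
    | single hab =>
      obtain ⟨ha, hb, hadj⟩ := hab
      have hb' : _ ≠ y := fun e => hy _ ha (e ▸ hadj)
      exact ⟨hb', fun ha' => .single
        ⟨(Finset.mem_insert.1 ha).resolve_left ha', (Finset.mem_insert.1 hb).resolve_left hb', hadj⟩⟩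
    | tail _ hbc ih =>
      obtain ⟨hb, hc, hadj⟩ := hbc
      have hc' : _ ≠ y := fun e => hy _ hb (e ▸ hadj)
      exact ⟨hc', fun ha' => .tail (ih.2 ha')
        ⟨(Finset.mem_insert.1 hb).resolve_left ih.1, (Finset.mem_insert.1 hc).resolve_left hc', hadj⟩⟩
  intro v hv hvv
  have := key v v hvv
  exact h v ((Finset.mem_insert.1 hv).resolve_left this.1) (this.2 this.1)

open Classical in
/-- A finite set of times in which every played vertex was observed fewer than `m` times before
has at most `m` times as many elements as some acyclic set of played vertices. -/
lemma exists_acyclic_card_le (G : Digraph W) (hG : ∀ x, ¬ G.Adj x x) (x : ℕ → W) (m : ℕ)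
    (I : Finset ℕ)
    (hI : ∀ i ∈ I, (I.filter fun j => j < i ∧ Observes G (x j) (x i)).card < m) :
    ∃ V : Finset W, IsAcyclicOn G V ∧ (∀ v ∈ V, ∃ i ∈ I, x i = v) ∧ I.card ≤ m * V.card := by
  induction I using Finset.strongInduction with
  | H I ih =>
    rcases I.eq_empty_or_nonempty with rfl | hne
    · exact ⟨∅, isAcyclicOn_empty G, by simp, by simp⟩
    set l := I.max' hne with hl
    have hlI : l ∈ I := I.max'_mem hne
    set J := I.filter fun j => ¬ Observes G (x j) (x l) with hJ
    have hJI : J ⊂ I := by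
      refine Finset.filter_ssubset.2 ⟨l, hlI, ?_⟩
      simp [Observes]
    obtain ⟨V, hV, hVJ, hcard⟩ := ih J hJI fun i hi => by
      refine lt_of_le_of_lt (Finset.card_le_card ?_) (hI i (hJI.1 hi))
      exact Finset.filter_subset_filter _ hJI.1
    have hVadj : ∀ z ∈ V, ¬ Observes G z (x l) := by
      intro z hz
      obtain ⟨i, hi, rfl⟩ := hVJ z hz
      exact (Finset.mem_filter.1 hi).2
    have hlV : x l ∉ V := fun h => hVadj _ h (Or.inl rfl)
    refine ⟨insert (x l) V, hV.insert_source ?_, ?_, ?_⟩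
    · intro z hz
      rcases Finset.mem_insert.1 hz with rfl | hz
      · exact hG _
      · exact fun h => hVadj z hz (Or.inr h)
    · intro v hv
      rcases Finset.mem_insert.1 hv with rfl | hv
      · exact ⟨l, hlI, rfl⟩
      · obtain ⟨i, hi, h⟩ := hVJ v hv
        exact ⟨i, hJI.1 hi, h⟩
    · rw [Finset.card_insert_of_notMem hlV, mul_add, mul_one]
      have h1 : I.card = J.card + (I.filter fun j => Observes G (x j) (x l)).card := by
        rw [hJ, add_comm, Finset.card_filter_add_card_filter_not]
      have h2 : (I.filter fun j => Observes G (x j) (x l))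
          ⊆ insert l (I.filter fun j => j < l ∧ Observes G (x j) (x l)) := by
        intro j hj
        rw [Finset.mem_filter] at hj
        rcases (I.le_max' j hj.1).lt_or_eq with h | h
        · exact Finset.mem_insert_of_mem (Finset.mem_filter.2 ⟨hj.1, h, hj.2⟩)
        · exact h ▸ Finset.mem_insert_self _ _
      have h3 := (Finset.card_le_card h2).trans (Finset.card_insert_le _ _)
      have h4 := hI l hlI
      omega

open Classical in
/-- Number of observations of `y` in the first `t` plays. -/
def obsCount (G : Digraph W) (x : ℕ → W) (t : ℕ) (y : W) : ℕ :=
  ((Finset.range t).filter fun i => Observes G (x i) y).card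

lemma obsCount_le (G : Digraph W) (x : ℕ → W) (t : ℕ) (y : W) : obsCount G x t y ≤ t := by
  classical
  exact (Finset.card_filter_le _ _).trans_eq (Finset.card_range t)

lemma obsCount_succ_le (G : Digraph W) (x : ℕ → W) (y : W) (t : ℕ) :
    obsCount G x (t + 1) y ≤ obsCount G x t y + 1 := by
  classical
  rw [obsCount, obsCount, Finset.range_add_one, Finset.filter_insert]
  split
  · exact Finset.card_insert_le _ _
  · omega

lemma obsCount_add_le (G : Digraph W) (x : ℕ → W) (y : W) (t h : ℕ) :
    obsCount G x (t + h) y ≤ obsCount G x t y + h := by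
  induction h with
  | zero => simp
  | succ h ih => have := obsCount_succ_le G x y (t + h); rw [← add_assoc]; omega

/-- At most `m * mas(G)` plays concern a vertex with fewer than `m` previous observations. -/
lemma card_obsCount_lt [Fintype W] (G : Digraph W) (hG : ∀ x, ¬ G.Adj x x) (x : ℕ → W) (m t : ℕ) :
    ((Finset.range t).filter fun i => obsCount G x i (x i) < m).card ≤ m * masNumber G := by
  classical
  obtain ⟨V, hV, -, hc⟩ := exists_acyclic_card_le G hG x m
    ((Finset.range t).filter fun i => obsCount G x i (x i) < m) fun i hi => by
      refine lt_of_le_of_lt (Finset.card_le_card ?_) (Finset.mem_filter.1 hi).2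
      intro j hj
      simp only [Finset.mem_filter, Finset.mem_range] at hj ⊢
      exact ⟨hj.2.1, hj.2.2⟩
  exact hc.trans (Nat.mul_le_mul_left _ (card_le_masNumber hV))

lemma inv_succ_eq_sum {n N : ℕ} (h : n ≤ N) :
    (1 : ℝ) / (n + 1) = ∑ m ∈ Finset.range N, (if n < m + 1 then (1 : ℝ) / ((m + 1) * (m + 2)) else 0)
      + 1 / (N + 1) := by
  induction N with
  | zero => simp_all
  | succ N ih =>
    rw [Finset.sum_range_succ]
    rcases h.lt_or_eq with h | rfl
    · rw [ih (by omega), if_pos h]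
      push_cast
      field_simp
      ring
    · rw [Finset.sum_eq_zero]
      · simp
      · intro m hm
        rw [if_neg]
        have := Finset.mem_range.1 hm
        omega

lemma sum_inv_add_two_le_log (N : ℕ) :
    ∑ m ∈ Finset.range N, (1 : ℝ) / (m + 2) ≤ Real.log (N + 1) := by
  induction N with
  | zero => simp
  | succ N ih =>
    rw [Finset.sum_range_succ]
    have h := Real.one_sub_inv_le_log_of_pos (x := ((N : ℝ) + 2) / (N + 1)) (by positivity)
    rw [Real.log_div (by positivity) (by positivity)] at h
    have h2 : (1 : ℝ) - (((N : ℝ) + 2) / (N + 1))⁻¹ = 1 / (N + 2) := by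
      field_simp; ring
    push_cast
    have h3 : (N : ℝ) + 1 + 1 = N + 2 := by ring
    rw [h3]
    linarith

lemma sum_inv_obsCount_le [Fintype W] (G : Digraph W) (hG : ∀ x, ¬ G.Adj x x) (x : ℕ → W) (t : ℕ) :
    ∑ i ∈ Finset.range t, (1 : ℝ) / (obsCount G x i (x i) + 1)
      ≤ masNumber G * Real.log (t + 1) + 1 := by
  have h1 : ∀ i ∈ Finset.range t, (1 : ℝ) / (obsCount G x i (x i) + 1)
      = ∑ m ∈ Finset.range t, (if obsCount G x i (x i) < m + 1 then
          (1 : ℝ) / ((m + 1) * (m + 2)) else 0) + 1 / (t + 1) := by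
    intro i hi
    refine inv_succ_eq_sum ((obsCount_le G x i (x i)).trans ?_)
    exact (Finset.mem_range.1 hi).le
  rw [Finset.sum_congr rfl h1, Finset.sum_add_distrib, Finset.sum_comm]
  refine add_le_add ?_ ?_
  · refine le_trans ?_ (mul_le_mul_of_nonneg_left (sum_inv_add_two_le_log t) (Nat.cast_nonneg _))
    rw [Finset.mul_sum]
    refine Finset.sum_le_sum fun m _ => ?_
    rw [← Finset.sum_filter, Finset.sum_const, nsmul_eq_mul]
    have := card_obsCount_lt G hG x (m + 1) t
    have h2 : (((Finset.range t).filter fun i => obsCount G x i (x i) < m + 1).card : ℝ)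
        ≤ (m + 1) * masNumber G := by exact_mod_cast this
    calc _ ≤ ((m + 1) * masNumber G : ℝ) * (1 / ((m + 1) * (m + 2))) :=
          mul_le_mul_of_nonneg_right h2 (by positivity)
      _ = _ := by field_simp
  · simp only [Finset.sum_const, Finset.card_range, nsmul_eq_mul, mul_one_div]
    rw [div_le_one (by positivity)]
    linarith

lemma one_le_masNumber [Fintype W] (G : Digraph W) (hG : ∀ x, ¬ G.Adj x x) (x : W) : 1 ≤ masNumber G := by
  classical
  refine le_trans (by simp) (card_le_masNumber (V := insert x ∅)
    ((isAcyclicOn_empty G).insert_source ?_))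
  intro z hz
  simp only [insert_empty_eq, Finset.mem_singleton] at hz
  exact hz ▸ hG x

end Graph

section Weights

variable [Fintype S] {p q f g : S → ℝ}

/-- Standard deviation of `f` under the weights `p`. -/
def wsd (p f : S → ℝ) : ℝ := √(wvar p f)

lemma wsd_nonneg : 0 ≤ wsd p f := Real.sqrt_nonneg _

lemma wavg_sq_sub_const (hs : ∑ s, p s = 1) (c : ℝ) :
    wavg p (fun s => (f s - c) ^ 2) = wvar p f + (wavg p f - c) ^ 2 := by
  have : ∀ s, (f s - c) ^ 2 = (f s ^ 2 - (2 * c) * f s) + c ^ 2 := fun s => by ring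
  simp only [this]
  rw [wavg_add, wavg_sub, wavg_const hs, wavg_const_mul, wvar]
  ring

lemma wvar_le_wavg_sq_sub (hs : ∑ s, p s = 1) (c : ℝ) :
    wvar p f ≤ wavg p (fun s => (f s - c) ^ 2) := by
  rw [wavg_sq_sub_const hs]; nlinarith [sq_nonneg (wavg p f - c)]

lemma wvar_eq (hs : ∑ s, p s = 1) :
    wvar p f = wavg p (fun s => (f s - wavg p f) ^ 2) := by
  rw [wavg_sq_sub_const hs]; ring

lemma wvar_nonneg (hp : ∀ s, 0 ≤ p s) (hs : ∑ s, p s = 1) : 0 ≤ wvar p f := by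
  rw [wvar_eq hs]; exact wavg_nonneg hp fun _ => sq_nonneg _

lemma wsd_sq (hp : ∀ s, 0 ≤ p s) (hs : ∑ s, p s = 1) : wsd p f ^ 2 = wvar p f :=
  Real.sq_sqrt (wvar_nonneg hp hs)

lemma wavg_mul_le_sqrt_mul_sqrt (hp : ∀ s, 0 ≤ p s) :
    wavg p (fun s => f s * g s) ≤ √(wavg p fun s => f s ^ 2) * √(wavg p fun s => g s ^ 2) := by
  have := Real.sum_mul_le_sqrt_mul_sqrt Finset.univ (fun s => √(p s) * f s) (fun s => √(p s) * g s)
  simp only [mul_pow, Real.sq_sqrt (hp _)] at this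
  refine le_trans (le_of_eq ?_) this
  refine Finset.sum_congr rfl fun s _ => ?_
  rw [show √(p s) * f s * (√(p s) * g s) = (√(p s) * √(p s)) * (f s * g s) by ring,
    Real.mul_self_sqrt (hp s)]

/-- Triangle inequality in `L²`. -/
lemma sqrt_wavg_add_sq_le (hp : ∀ s, 0 ≤ p s) :
    √(wavg p fun s => (f s + g s) ^ 2)
      ≤ √(wavg p fun s => f s ^ 2) + √(wavg p fun s => g s ^ 2) := by
  have h1 := Real.sq_sqrt (wavg_nonneg hp fun s => sq_nonneg (f s))
  have h2 := Real.sq_sqrt (wavg_nonneg hp fun s => sq_nonneg (g s))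
  have h3 := wavg_mul_le_sqrt_mul_sqrt (f := f) (g := g) hp
  refine Real.sqrt_le_iff.2 ⟨by positivity, ?_⟩
  have h4 : ∀ s, (f s + g s) ^ 2 = (f s ^ 2 + g s ^ 2) + 2 * (f s * g s) := fun s => by ring
  simp only [h4]
  rw [wavg_add, wavg_add, wavg_const_mul]
  nlinarith

lemma wsd_le_wsd_add (hp : ∀ s, 0 ≤ p s) (hs : ∑ s, p s = 1) :
    wsd p f ≤ wsd p g + √(wavg p fun s => (f s - g s) ^ 2) := by
  have h := sqrt_wavg_add_sq_le (p := p) (f := fun s => g s - wavg p g) (g := fun s => f s - g s) hp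
  rw [← wvar_eq hs] at h
  refine le_trans (Real.sqrt_le_sqrt ?_) h
  refine (wvar_le_wavg_sq_sub hs (wavg p g)).trans_eq ?_
  congr 1; ext s; ring

lemma wavg_sq_le (hp : ∀ s, 0 ≤ p s) {B : ℝ} (hf : ∀ s, 0 ≤ f s ∧ f s ≤ B) :
    wavg p (fun s => f s ^ 2) ≤ B * wavg p f := by
  rw [← wavg_const_mul]
  exact wavg_mono hp fun s => by nlinarith [(hf s).1, (hf s).2]

lemma mul_sqrt_le_amgm {t c y H : ℝ} (hc : 0 ≤ c) (hy : 0 ≤ y) (hH : 0 < H) :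
    t * √(c * y) ≤ 1 / H * y + t ^ 2 / 4 * c * H := by
  rw [Real.sqrt_mul hc]
  have h1 := Real.sq_sqrt hc
  have h2 := Real.sq_sqrt hy
  set u := √c
  set v := √y
  rw [← h1, ← h2]
  have : 1 / H * v ^ 2 + t ^ 2 / 4 * u ^ 2 * H - t * (u * v) = (2 * v - t * u * H) ^ 2 / (4 * H) := by
    field_simp; ring
  have : 0 ≤ (2 * v - t * u * H) ^ 2 / (4 * H) := by positivity
  linarith

/-- `q` deviates from `p` by at most `a √w φ + b φ²` on a set of at most `K` states, and agrees with
it elsewhere. -/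
structure DevBound (p q w : S → ℝ) (a b φ : ℝ) (K : ℕ) : Prop where
  nonneg : ∀ s, 0 ≤ w s
  le : ∀ s, |q s - p s| ≤ a * √(w s) * φ + b * φ ^ 2
  card : {s | q s ≠ p s}.ncard ≤ K

lemma DevBound.abs_sub_le {w : S → ℝ} {a b φ B : ℝ} {K : ℕ} (h : DevBound p q w a b φ K)
    (ha : 0 ≤ a) (hb : 0 ≤ b) (hφ : 0 ≤ φ) (hB : 0 ≤ B) (hf : ∀ s, 0 ≤ f s ∧ f s ≤ B) :
    |wavg q f - wavg p f| ≤ a * φ * √(K * wavg w fun s => f s ^ 2) + b * K * B * φ ^ 2 := by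
  classical
  set T : Finset S := Finset.univ.filter fun s => q s ≠ p s with hT
  have hTK : (T.card : ℝ) ≤ K := by
    have := h.card
    rw [Set.ncard_eq_toFinset_card'] at this
    have h2 : T = {s | q s ≠ p s}.toFinset := by ext; simp [hT]
    rw [h2]; exact_mod_cast this
  have h1 : wavg q f - wavg p f = ∑ s ∈ T, (q s - p s) * f s := by
    rw [wavg, wavg, ← Finset.sum_sub_distrib, hT, Finset.sum_filter]
    refine Finset.sum_congr rfl fun s _ => ?_
    by_cases e : q s = p s <;> simp [e, sub_mul]
  have h2 : |wavg q f - wavg p f| ≤ ∑ s ∈ T, (a * φ * (√(w s) * f s) + b * φ ^ 2 * B) := by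
    rw [h1]
    refine (Finset.abs_sum_le_sum_abs _ _).trans (Finset.sum_le_sum fun s _ => ?_)
    rw [abs_mul, abs_of_nonneg (hf s).1]
    have h3 := mul_le_mul_of_nonneg_right (h.le s) (hf s).1
    have h4 : b * φ ^ 2 * f s ≤ b * φ ^ 2 * B :=
      mul_le_mul_of_nonneg_left (hf s).2 (by positivity)
    nlinarith
  rw [Finset.sum_add_distrib, Finset.sum_const, nsmul_eq_mul, ← Finset.mul_sum] at h2
  have h5 : ∑ s ∈ T, √(w s) * f s ≤ √(K * wavg w fun s => f s ^ 2) := by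
    refine Real.le_sqrt_of_sq_le ?_
    refine sq_sum_le_card_mul_sum_sq.trans ?_
    have h6 : ∑ s ∈ T, (√(w s) * f s) ^ 2 ≤ wavg w fun s => f s ^ 2 := by
      simp only [mul_pow, Real.sq_sqrt (h.nonneg _)]
      exact Finset.sum_le_sum_of_subset_of_nonneg (Finset.subset_univ _)
        fun s _ _ => mul_nonneg (h.nonneg s) (sq_nonneg _)
    exact mul_le_mul hTK h6 (Finset.sum_nonneg fun _ _ => sq_nonneg _) (Nat.cast_nonneg _)
  have h7 : a * φ * ∑ s ∈ T, √(w s) * f s ≤ a * φ * √(K * wavg w fun s => f s ^ 2) :=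
    mul_le_mul_of_nonneg_left h5 (by positivity)
  have h8 : (T.card : ℝ) * (b * φ ^ 2 * B) ≤ K * (b * φ ^ 2 * B) :=
    mul_le_mul_of_nonneg_right hTK (by positivity)
  nlinarith

/-- The first-order part of a deviation is absorbed by a small multiple of the expectation. -/
lemma DevBound.abs_sub_le_absorb {w : S → ℝ} {a b φ B H : ℝ} {K : ℕ} (h : DevBound p q w a b φ K)
    (ha : 0 ≤ a) (hb : 0 ≤ b) (hφ : 0 ≤ φ) (hB : 0 ≤ B) (hf : ∀ s, 0 ≤ f s ∧ f s ≤ B)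
    (hH : 0 < H) :
    |wavg q f - wavg p f| ≤ 1 / H * wavg w f + (a ^ 2 / 4 * H + b) * (K * B * φ ^ 2) := by
  have h0 : 0 ≤ wavg w f := wavg_nonneg h.nonneg fun s => (hf s).1
  refine (h.abs_sub_le ha hb hφ hB hf).trans ?_
  have h1 : √(K * wavg w fun s => f s ^ 2) ≤ √((K * B) * wavg w f) := by
    refine Real.sqrt_le_sqrt ?_
    rw [mul_assoc]
    exact mul_le_mul_of_nonneg_left (wavg_sq_le h.nonneg hf) (Nat.cast_nonneg _)
  have h2 := mul_le_mul_of_nonneg_left h1 (mul_nonneg ha hφ)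
  have h3 := mul_sqrt_le_amgm (t := a * φ) (c := K * B) (by positivity) h0 hH
  nlinarith

lemma DevBound.wsd_le {a b c φ B : ℝ} {K : ℕ} (h : DevBound p q p a b φ K)
    (ha : 0 ≤ a) (hb : 0 ≤ b) (hφ : 0 ≤ φ) (hB : 0 ≤ B) (hf : ∀ s, 0 ≤ f s ∧ f s ≤ B)
    (hps : ∑ s, p s = 1) (hqs : ∑ s, q s = 1) (hc : 0 ≤ c) (hca : a ≤ 2 * c) (hcb : b ≤ c ^ 2) :
    wsd q f ≤ wsd p f + c * √K * B * φ := by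
  have hp := h.nonneg
  have hm0 : 0 ≤ wavg p f := wavg_nonneg hp fun s => (hf s).1
  have hmB : wavg p f ≤ B := wavg_le hp hps fun s => (hf s).2
  have hg : ∀ s, 0 ≤ (f s - wavg p f) ^ 2 ∧ (f s - wavg p f) ^ 2 ≤ B ^ 2 := fun s =>
    ⟨sq_nonneg _, sq_le_sq' (by linarith [(hf s).1]) (by linarith [(hf s).2])⟩
  have h1 := h.abs_sub_le ha hb hφ (sq_nonneg B) hg
  rw [← wvar_eq hps] at h1
  have h2 := wvar_le_wavg_sq_sub (p := q) (f := f) hqs (wavg p f)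
  have h3 := wavg_sq_le hp hg
  rw [← wvar_eq hps] at h3
  have hσ := wsd_sq (f := f) hp hps
  have h4 : √(K * wavg p fun s => ((f s - wavg p f) ^ 2) ^ 2) ≤ √K * B * wsd p f := by
    refine Real.sqrt_le_iff.2 ⟨by have := wsd_nonneg (p := p) (f := f); positivity, ?_⟩
    rw [mul_pow, mul_pow, Real.sq_sqrt (Nat.cast_nonneg _), hσ, mul_assoc]
    exact mul_le_mul_of_nonneg_left h3 (Nat.cast_nonneg _)
  have h5 := mul_le_mul_of_nonneg_left h4 (mul_nonneg ha hφ)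
  have hK := Real.sq_sqrt (Nat.cast_nonneg (α := ℝ) K)
  refine Real.sqrt_le_iff.2 ⟨by have := wsd_nonneg (p := p) (f := f); positivity, ?_⟩
  have hσ0 := wsd_nonneg (p := p) (f := f)
  have e1 : wvar q f ≤ wvar p f + a * φ * (√K * B * wsd p f) + b * K * B ^ 2 * φ ^ 2 := by
    have := (abs_le.1 h1).2
    linarith
  have e2 : a * (φ * (√K * B * wsd p f)) ≤ 2 * c * (φ * (√K * B * wsd p f)) :=
    mul_le_mul_of_nonneg_right hca (by positivity)
  have e3 : b * (K * B ^ 2 * φ ^ 2) ≤ c ^ 2 * (K * B ^ 2 * φ ^ 2) :=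
    mul_le_mul_of_nonneg_right hcb (by positivity)
  calc wvar q f ≤ wvar p f + a * φ * (√K * B * wsd p f) + b * K * B ^ 2 * φ ^ 2 := e1
    _ ≤ wsd p f ^ 2 + 2 * c * (φ * (√K * B * wsd p f)) + c ^ 2 * (√K ^ 2 * B ^ 2 * φ ^ 2) := by
        rw [hσ, hK]; linarith
    _ = _ := by ring

/-- If `x² ≤ y² + a x + b`, then `x ≤ y + c` for suitable `c`. -/
lemma le_add_of_sq_le {x y a b c : ℝ} (hx : x ^ 2 ≤ y ^ 2 + a * x + b) (hy : 0 ≤ y)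
    (hac : a ≤ 2 * c) (hb : b ≤ c * (c - a)) : x ≤ y + c := by
  by_contra! hlt
  nlinarith [mul_pos (sub_pos.2 hlt) (sub_pos.2 hlt)]

end Weights

lemma DevBound.symm {p q : S → ℝ} {φ : ℝ} {K : ℕ} (h : DevBound p q p 3.52 8.25 φ K) (hφ : 0 ≤ φ)
    (hq : ∀ s, 0 ≤ q s) : DevBound q p q 3.52 26.4 φ K where
  nonneg := hq
  card := by simpa only [ne_comm] using h.card
  le s := by
    have h1 := h.le s
    have hp := h.nonneg s
    have h2 : √(p s) ≤ √(q s) + 5.14 * φ := by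
      refine le_add_of_sq_le (a := 3.52 * φ) (b := 8.25 * φ ^ 2) ?_ (Real.sqrt_nonneg _)
        (by nlinarith) (by nlinarith)
      rw [Real.sq_sqrt hp, Real.sq_sqrt (hq s)]
      linarith [(abs_le.1 h1).1]
    rw [abs_sub_comm]
    nlinarith

section Planning

variable {X : Finset (S × A)}

/-- Variance of the reward of `x`. -/
def MDP.rewardVar (M : MDP X) (x : X) : ℝ := ∫ r, (r - M.meanReward x) ^ 2 ∂(M.PR x)

lemma MDP.rewardVar_nonneg (M : MDP X) (x : X) : 0 ≤ M.rewardVar x :=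
  integral_nonneg fun _ => sq_nonneg _

variable [Fintype S]

/-- The estimates of the model are within their confidence bounds. -/
structure GoodStats (M : MDP X) (H Shat : ℕ) (δ : ℝ) (st : Stats X) : Prop where
  P_nonneg : ∀ x s, 0 ≤ st.P x s
  P_sum : ∀ x, ∑ s, st.P x s = 1
  r_mem : ∀ x, 0 ≤ st.r x ∧ st.r x ≤ 1
  r2_le : ∀ x, st.r2 x ≤ 1
  dev_P : ∀ x, 1 ≤ st.n x →
    DevBound (M.p x) (st.P x) (M.p x) 3.52 8.25 (phi X.card H Shat δ (st.n x)) Shat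
  dev_r : ∀ x, 1 ≤ st.n x → |st.r x - M.meanReward x| ≤
    3.52 * √(M.rewardVar x) * phi X.card H Shat δ (st.n x) + 8.25 * phi X.card H Shat δ (st.n x) ^ 2
  dev_r2 : ∀ x, 1 ≤ st.n x →
    |(st.r2 x - 2 * M.meanReward x * st.r x + M.meanReward x ^ 2) - M.rewardVar x| ≤
    3.52 * √(M.rewardVar x) * phi X.card H Shat δ (st.n x) + 8.25 * phi X.card H Shat δ (st.n x) ^ 2
  dev_star : ∀ x, 1 ≤ st.n x → ∀ j < H,
    |wavg (st.P x) (M.starVal j) - wavg (M.p x) (M.starVal j)| ≤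
    3.52 * wsd (M.p x) (M.starVal j) * phi X.card H Shat δ (st.n x)
      + 8.25 * j * phi X.card H Shat δ (st.n x) ^ 2

lemma phi_nonneg (c H Shat : ℕ) (δ : ℝ) (n : ℕ) : 0 ≤ phi c H Shat δ n := by
  unfold phi; split
  · exact zero_le_one
  · exact le_min zero_le_one (Real.sqrt_nonneg _)

lemma phi_le_one (c H Shat : ℕ) (δ : ℝ) (n : ℕ) : phi c H Shat δ n ≤ 1 := by
  unfold phi; split
  · exact le_rfl
  · exact min_le_left _ _

lemma phi_zero (c H Shat : ℕ) (δ : ℝ) : phi c H Shat δ 0 = 1 := by simp [phi]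

variable {M : MDP X} {H Shat : ℕ} {δ : ℝ} {st : Stats X}

/-- Empirical Bernstein bound for the rewards. -/
lemma GoodStats.abs_r_sub_le (hg : GoodStats M H Shat δ st) (x : X) (hn : 1 ≤ st.n x) :
    |st.r x - M.meanReward x| ≤ 3.52 * √(st.r2 x - st.r x ^ 2) * phi X.card H Shat δ (st.n x)
      + 39.6 * phi X.card H Shat δ (st.n x) ^ 2 := by
  have h1 := hg.dev_r x hn
  have h2 := hg.dev_r2 x hn
  have hφ := phi_nonneg X.card H Shat δ (st.n x)
  set φ := phi X.card H Shat δ (st.n x)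
  have hv := Real.sq_sqrt (M.rewardVar_nonneg x)
  set σ := √(M.rewardVar x)
  have hle : st.r2 x - st.r x ^ 2 ≤ √(st.r2 x - st.r x ^ 2) ^ 2 := by
    rcases le_total 0 (st.r2 x - st.r x ^ 2) with h | h
    · rw [Real.sq_sqrt h]
    · exact h.trans (sq_nonneg _)
  have hσ0 := Real.sqrt_nonneg (st.r2 x - st.r x ^ 2)
  set σ' := √(st.r2 x - st.r x ^ 2)
  have h3 : (st.r x - M.meanReward x) ^ 2 ≤ |st.r x - M.meanReward x| := by
    rw [← sq_abs]
    have : |st.r x - M.meanReward x| ≤ 1 := abs_le.2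
      ⟨by linarith [(hg.r_mem x).1, (M.meanReward_mem x).2],
        by linarith [(hg.r_mem x).2, (M.meanReward_mem x).1]⟩
    nlinarith [abs_nonneg (st.r x - M.meanReward x)]
  have h4 : σ ≤ σ' + 8.9 * φ := by
    refine le_add_of_sq_le (a := 7.04 * φ) (b := 16.5 * φ ^ 2) ?_ hσ0 (by nlinarith) (by nlinarith)
    have := (abs_le.1 h2).1
    nlinarith
  nlinarith

lemma sqrt_le_self_of_one_le {n : ℕ} (hn : 1 ≤ n) : √(n : ℝ) ≤ n := by
  have h : (1 : ℝ) ≤ n := by exact_mod_cast hn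
  exact Real.sqrt_le_iff.2 ⟨by linarith, by nlinarith⟩

/-- Empirical Bernstein bound for the optimal values. -/
lemma GoodStats.abs_star_sub_le (hg : GoodStats M H Shat δ st) (π : Policy X) (hS : 1 ≤ Shat)
    (x : X) (hn : 1 ≤ st.n x) {j : ℕ} (hj : j < H) :
    |wavg (st.P x) (M.starVal j) - wavg (M.p x) (M.starVal j)| ≤
      3.52 * wsd (st.P x) (M.starVal j) * phi X.card H Shat δ (st.n x)
      + 26.6 * Shat * j * phi X.card H Shat δ (st.n x) ^ 2 := by
  have h1 := hg.dev_star x hn j hj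
  have hφ := phi_nonneg X.card H Shat δ (st.n x)
  have hd := (hg.dev_P x hn).symm hφ (hg.P_nonneg x)
  have h2 := hd.wsd_le (f := M.starVal j) (B := j) (c := 5.2) (by norm_num) (by norm_num) hφ
    (Nat.cast_nonneg _) (M.starVal_mem π j) (hg.P_sum x) (M.p_sum x) (by norm_num)
    (by norm_num) (by norm_num)
  set φ := phi X.card H Shat δ (st.n x)
  have hS' : (1 : ℝ) ≤ Shat := by exact_mod_cast hS
  have h3 : √(Shat : ℝ) * (j * φ) ≤ Shat * (j * φ) :=
    mul_le_mul_of_nonneg_right (sqrt_le_self_of_one_le hS) (by positivity)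
  have h4 : (1 : ℝ) * (j * φ ^ 2) ≤ Shat * (j * φ ^ 2) :=
    mul_le_mul_of_nonneg_right hS' (by positivity)
  have h5 : wsd (M.p x) (M.starVal j) * φ
      ≤ (wsd (st.P x) (M.starVal j) + 5.2 * (Shat * (j * φ))) * φ :=
    mul_le_mul_of_nonneg_right (by nlinarith) hφ
  nlinarith

/-- Upper and lower value bounds `V` with `j` steps to go that are valid for `M` and `f`. -/
structure ValidBounds (M : MDP X) (j : ℕ) (f : S → ℝ) (V : (S → ℝ) × (S → ℝ)) : Prop where
  lower_nonneg : ∀ s, 0 ≤ V.2 s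
  lower_le : ∀ s, V.2 s ≤ f s
  le_star : ∀ s, f s ≤ M.starVal j s
  star_le : ∀ s, M.starVal j s ≤ V.1 s
  upper_le : ∀ s, V.1 s ≤ j

/-- The bonus dominates the estimation error of the optimal values and of `f`. -/
lemma GoodStats.le_bonus (hg : GoodStats M H Shat δ st) (π : Policy X) (hS : 1 ≤ Shat)
    {x : X} (hn : 1 ≤ st.n x) {j : ℕ} (hj : j < H) {f : S → ℝ} {V : (S → ℝ) × (S → ℝ)}
    (hV : ValidBounds M j f V) :
    |st.r x - M.meanReward x| + |wavg (st.P x) (M.starVal j) - wavg (M.p x) (M.starVal j)|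
      + |wavg (st.P x) (fun s => M.starVal j s - f s) - wavg (M.p x) (fun s => M.starVal j s - f s)|
      ≤ bonus H Shat δ st V x := by
  have hφ := phi_nonneg X.card H Shat δ (st.n x)
  have h1 := hg.abs_r_sub_le x hn
  have h2 := hg.abs_star_sub_le π hS x hn hj
  have hd := (hg.dev_P x hn).symm hφ (hg.P_nonneg x)
  have hH0 : (0 : ℝ) < H := by exact_mod_cast (Nat.zero_le j).trans_lt hj
  have hf : ∀ s, 0 ≤ M.starVal j s - f s ∧ M.starVal j s - f s ≤ j := fun s =>
    ⟨by linarith [hV.le_star s], by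
      linarith [hV.lower_nonneg s, hV.lower_le s, (M.starVal_mem π j s).2]⟩
  have h3 := hd.abs_sub_le_absorb (by norm_num) (by norm_num) hφ (Nat.cast_nonneg j) hf hH0
  rw [abs_sub_comm] at h3
  have hu : ∀ s, 0 ≤ V.1 s - M.starVal j s ∧ V.1 s - M.starVal j s ≤ j := fun s =>
    ⟨by linarith [hV.star_le s], by linarith [hV.upper_le s, (M.starVal_mem π j s).1]⟩
  have h4 : wsd (st.P x) (M.starVal j) ≤ wsd (st.P x) V.1
      + √(j * wavg (st.P x) fun s => V.1 s - M.starVal j s) := by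
    refine (wsd_le_wsd_add (g := V.1) (hg.P_nonneg x) (hg.P_sum x)).trans
      (add_le_add le_rfl (Real.sqrt_le_sqrt ?_))
    refine le_trans (le_of_eq ?_) (wavg_sq_le (hg.P_nonneg x) hu)
    congr 1; ext s; ring
  set φ := phi X.card H Shat δ (st.n x) with hφd
  have hu0 : 0 ≤ wavg (st.P x) fun s => V.1 s - M.starVal j s :=
    wavg_nonneg (hg.P_nonneg x) fun s => (hu s).1
  have h5 := mul_sqrt_le_amgm (t := 3.52 * φ) (c := j) (Nat.cast_nonneg _) hu0 hH0
  have h6 := mul_le_mul_of_nonneg_left h4 (show 0 ≤ 3.52 * φ by positivity)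
  have h7 : 1 / (H : ℝ) * wavg (st.P x) (fun s => V.1 s - M.starVal j s)
      + 1 / (H : ℝ) * wavg (st.P x) (fun s => M.starVal j s - f s)
      ≤ 1 / (H : ℝ) * wavg (st.P x) (fun s => V.1 s - V.2 s) := by
    rw [← mul_add, ← wavg_add]
    refine mul_le_mul_of_nonneg_left (wavg_mono (hg.P_nonneg x) fun s => ?_) (by positivity)
    linarith [hV.lower_le s]
  have hjH : (j : ℝ) + 1 ≤ H := by exact_mod_cast hj
  have hS' : (1 : ℝ) ≤ Shat := by exact_mod_cast hS
  have hj0 : (0 : ℝ) ≤ j := Nat.cast_nonneg j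
  have h8 : 39.6 + 53 * (Shat * j : ℝ) + 3.0976 * (j * H) + 3.0976 * (Shat * j * H)
      ≤ 53 * Shat * H ^ 2 := by
    have e1 : (j : ℝ) * H ≤ Shat * (j * H) := le_mul_of_one_le_left (by positivity) hS'
    have e2 : 39.6 + 53 * (j : ℝ) + 6.2 * (j * H) ≤ 53 * H ^ 2 := by nlinarith
    nlinarith
  have h9 := mul_le_mul_of_nonneg_right h8 (sq_nonneg φ)
  have hσ : 0 ≤ √(st.r2 x - st.r x ^ 2) := Real.sqrt_nonneg _
  have hσ2 : 0 ≤ wsd (st.P x) V.1 := wsd_nonneg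
  have hb : bonus H Shat δ st V x = 4 * (√(st.r2 x - st.r x ^ 2) + wsd (st.P x) V.1) * φ
      + 53 * Shat * H ^ 2 * φ ^ 2 + 1 / H * wavg (st.P x) (fun s => V.1 s - V.2 s) := rfl
  rw [hb]
  have h10 := mul_nonneg hσ hφ
  have h11 := mul_nonneg hσ2 hφ
  nlinarith

lemma le_bonus_of_nonneg (hP : ∀ x s, 0 ≤ st.P x s) {V : (S → ℝ) × (S → ℝ)}
    (hV : ∀ s, V.2 s ≤ V.1 s) (x : X) :
    53 * Shat * H ^ 2 * phi X.card H Shat δ (st.n x) ^ 2 ≤ bonus H Shat δ st V x := by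
  have hφ := phi_nonneg X.card H Shat δ (st.n x)
  have h1 : 0 ≤ wavg (st.P x) (fun s => V.1 s - V.2 s) :=
    wavg_nonneg (hP x) fun s => by linarith [hV s]
  have h2 : 0 ≤ 1 / (H : ℝ) * wavg (st.P x) (fun s => V.1 s - V.2 s) := by positivity
  have h3 : 0 ≤ 4 * (√(st.r2 x - st.r x ^ 2)
      + √(st.expect x (fun s => V.1 s ^ 2) - st.expect x V.1 ^ 2)) * phi X.card H Shat δ (st.n x) := by
    positivity
  unfold bonus
  change 0 ≤ 1 / (H : ℝ) * st.expect x (fun s => V.1 s - V.2 s) at h2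
  linarith

lemma valueBounds_mem (π : Policy X) (j : ℕ) (s : S) :
    0 ≤ (valueBounds H Shat δ st π j).1 s ∧ (valueBounds H Shat δ st π j).1 s ≤ j ∧
    0 ≤ (valueBounds H Shat δ st π j).2 s ∧ (valueBounds H Shat δ st π j).2 s ≤ j := by
  cases j with
  | zero => simp [valueBounds]
  | succ j =>
    refine ⟨le_max_left _ _, max_le (by positivity) ?_, le_max_left _ _, max_le (by positivity) ?_⟩
    all_goals exact_mod_cast min_le_right _ _

/-- On a good model the planning routine produces valid bounds. -/
theorem GoodStats.validBounds (hg : GoodStats M H Shat δ st) (hS : 1 ≤ Shat) {π : Policy X}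
    (hπ : IsGreedy H Shat δ st π) (j : ℕ) (hj : j ≤ H) :
    ValidBounds M j (M.polVal H π j) (valueBounds H Shat δ st π j) := by
  induction j with
  | zero => constructor <;> intro s <;> simp [valueBounds, MDP.polVal, MDP.starVal]
  | succ j ih =>
    have hV := ih (by omega)
    have hmem := fun s => valueBounds_mem (H := H) (Shat := Shat) (δ := δ) (st := st) π j s
    have hS' : (1 : ℝ) ≤ Shat := by exact_mod_cast hS
    have hH1 : (j : ℝ) + 1 ≤ H := by exact_mod_cast hj
    have hj0 : (0 : ℝ) ≤ j := Nat.cast_nonneg j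
    set V := valueBounds H Shat δ st π j with hVdef
    have hzero : ∀ x, st.n x = 0 → (j : ℝ) + 1 ≤ bonus H Shat δ st V x := by
      intro x hx
      refine le_trans ?_ (le_bonus_of_nonneg hg.P_nonneg
        (fun s => (hV.lower_le s).trans ((hV.le_star s).trans (hV.star_le s))) x)
      rw [hx, phi_zero]
      have : (H : ℝ) ^ 2 ≤ Shat * H ^ 2 := le_mul_of_one_le_left (by positivity) hS'
      nlinarith
    have hup : ∀ x, M.meanReward x + wavg (M.p x) (M.starVal j) ≤ upperQ H Shat δ st (j + 1) V x := by
      intro x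
      have h1 : M.meanReward x + wavg (M.p x) (M.starVal j) ≤ (j : ℝ) + 1 := by
        have := wavg_le (M.p_nonneg x) (M.p_sum x) fun s => (M.starVal_mem π j s).2
        linarith [(M.meanReward_mem x).2]
      refine le_trans (le_min ?_ ?_) (le_max_right _ _)
      · have h2 : wavg (st.P x) (M.starVal j) ≤ wavg (st.P x) V.1 :=
          wavg_mono (hg.P_nonneg x) hV.star_le
        rcases Nat.eq_zero_or_pos (st.n x) with h0 | h0
        · have := hzero x h0
          have h3 : 0 ≤ wavg (st.P x) V.1 := wavg_nonneg (hg.P_nonneg x) fun s => (hmem s).1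
          have h4 := (hg.r_mem x).1
          change _ ≤ st.r x + wavg (st.P x) V.1 + _
          linarith
        · have := hg.le_bonus π hS h0 (by omega) hV
          change _ ≤ st.r x + wavg (st.P x) V.1 + _
          linarith [neg_abs_le (st.r x - M.meanReward x),
            neg_abs_le (wavg (st.P x) (M.starVal j) - wavg (M.p x) (M.starVal j)),
            abs_nonneg (wavg (st.P x) (fun s => M.starVal j s - M.polVal H π j s)
              - wavg (M.p x) (fun s => M.starVal j s - M.polVal H π j s))]
      · exact_mod_cast h1
    have hlow : ∀ x, lowerQ H Shat δ st (j + 1) V x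
        ≤ M.meanReward x + wavg (M.p x) (M.polVal H π j) := by
      intro x
      have h0' : 0 ≤ M.meanReward x + wavg (M.p x) (M.polVal H π j) :=
        add_nonneg (M.meanReward_mem x).1
          (wavg_nonneg (M.p_nonneg x) fun s => (M.polVal_mem H π j s).1)
      refine max_le h0' ((min_le_left _ _).trans ?_)
      change st.r x + wavg (st.P x) V.2 - _ ≤ _
      rcases Nat.eq_zero_or_pos (st.n x) with h0 | h0
      · have := hzero x h0
        have h3 : wavg (st.P x) V.2 ≤ j :=
          wavg_le (hg.P_nonneg x) (hg.P_sum x) fun s => (hmem s).2.2.2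
        have h4 := (hg.r_mem x).2
        linarith
      · have := hg.le_bonus π hS h0 (by omega) hV
        have h2 : wavg (st.P x) V.2 ≤ wavg (st.P x) (M.polVal H π j) :=
          wavg_mono (hg.P_nonneg x) hV.lower_le
        rw [wavg_sub, wavg_sub] at this
        have e1 := le_abs_self (st.r x - M.meanReward x)
        have e2 := le_abs_self (wavg (st.P x) (M.starVal j) - wavg (M.p x) (M.starVal j))
        have e3 := neg_abs_le (wavg (st.P x) (M.starVal j) - wavg (st.P x) (M.polVal H π j)
          - (wavg (M.p x) (M.starVal j) - wavg (M.p x) (M.polVal H π j)))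
        linarith
    have hne : ∀ s, Nonempty {a : A // (s, a) ∈ X} := fun s => ⟨π 0 s⟩
    refine ⟨fun s => (valueBounds_mem π (j + 1) s).2.2.1, fun s => hlow _,
      fun s => (M.polVal_mem H π (j + 1) s).2, fun s => ?_,
      fun s => (valueBounds_mem π (j + 1) s).2.1⟩
    have := hne s
    refine ciSup_le fun a => ?_
    exact (hup _).trans (hπ j (by omega) s a.1 a.2)

end Planning

section Recursion

variable {X : Finset (S × A)} [Fintype S] {M : MDP X} {H Shat : ℕ} {δ : ℝ} {st : Stats X}

lemma clip_sub_clip_le {a b c : ℝ} (h : b ≤ a) : max 0 (min a c) - max 0 (min b c) ≤ a - b := by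
  rcases le_total a c with h1 | h1 <;> rcases le_total b c with h2 | h2 <;>
    simp only [min_eq_left, min_eq_right, h1, h2] <;>
    rcases max_cases 0 a with h3 | h3 <;> rcases max_cases 0 b with h4 | h4 <;>
    rcases max_cases 0 c with h5 | h5 <;> linarith

/-- The arithmetic behind the propagation of the width; `N` is a bound on the number of
successors, `PD` and `pD` are the empirical and the true expected width of the next step. -/
lemma width_arith {φ H N k PD pD r σ' σ'' σ z b : ℝ} (hφ : 0 ≤ φ) (hH : 1 ≤ H) (hN : 1 ≤ N)
    (hk : k ≤ N) (hpD0 : 0 ≤ pD) (hr : r ≤ 1) (h2 : σ' ≤ σ'' + z)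
    (h3 : 8 * φ * z ≤ 1 / H * PD + (8 * φ) ^ 2 / 4 * H * H) (h4 : σ'' ≤ σ + 2.9 * k * H * φ)
    (h5 : PD - pD ≤ 1 / H * pD + (3.52 ^ 2 / 4 * H + 8.25) * (N * H * φ ^ 2))
    (hb : b = 4 * (r + σ') * φ + 53 * N * H ^ 2 * φ ^ 2 + 1 / H * PD) :
    PD + 2 * b ≤ (1 + 7 / H) * pD + 8 * φ + 8 * σ * φ + 191 * (N * H ^ 2 * φ ^ 2) := by
  have hHH : H ≤ H ^ 2 := by nlinarith
  set Y := N * H ^ 2 * φ ^ 2 with hY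
  have hY0 : 0 ≤ Y := by positivity
  have hinv : 1 / H ≤ 1 := by rw [div_le_one (by linarith)]; exact hH
  have hinv0 : 0 ≤ 1 / H := by positivity
  have g0 : N * H * φ ^ 2 ≤ Y :=
    mul_le_mul_of_nonneg_right (mul_le_mul_of_nonneg_left hHH (by linarith)) (sq_nonneg _)
  have g1 : k * H * φ ^ 2 ≤ Y :=
    (mul_le_mul_of_nonneg_right (mul_le_mul_of_nonneg_right hk (by linarith)) (sq_nonneg _)).trans g0
  have g2 : H ^ 2 * φ ^ 2 ≤ Y := by
    rw [hY, mul_assoc]; exact le_mul_of_one_le_left (by positivity) hN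
  have g3 := mul_le_mul_of_nonneg_left h2 (show 0 ≤ 8 * φ by positivity)
  have g4 := mul_le_mul_of_nonneg_left h4 (show 0 ≤ 8 * φ by positivity)
  have e1 : 8 * φ * σ' ≤ 8 * φ * σ + 23.2 * Y + 1 / H * PD + 16 * Y := by
    have q1 : 8 * φ * (σ + 2.9 * k * H * φ) = 8 * φ * σ + 23.2 * (k * H * φ ^ 2) := by ring
    have q2 : (8 * φ) ^ 2 / 4 * H * H = 16 * (H ^ 2 * φ ^ 2) := by ring
    rw [q1] at g4
    rw [q2] at h3
    linarith
  have e2 : PD ≤ (1 + 1 / H) * pD + 11.4 * Y := by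
    have q1 : (3.52 ^ 2 / 4 * H + 8.25) * (N * H * φ ^ 2) = 3.0976 * Y + 8.25 * (N * H * φ ^ 2) := by
      rw [hY]; ring
    rw [q1] at h5
    linarith
  have e3 : PD + 2 * b ≤ (1 + 3 * (1 / H)) * PD + 8 * φ + 8 * σ * φ + 145.2 * Y := by
    have q1 := mul_le_mul_of_nonneg_right hr hφ
    have q2 : 53 * N * H ^ 2 * φ ^ 2 = 53 * Y := by rw [hY]; ring
    rw [hb, q2]
    linarith
  have e4 := mul_le_mul_of_nonneg_left e2 (show 0 ≤ 1 + 3 * (1 / H) by positivity)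
  have e5 : (1 + 3 * (1 / H)) * (1 + 1 / H) * pD ≤ (1 + 7 / H) * pD := by
    refine mul_le_mul_of_nonneg_right ?_ hpD0
    rw [show 7 / H = 7 * (1 / H) by ring]
    nlinarith
  have e6 : (1 + 3 * (1 / H)) * (11.4 * Y) ≤ 4 * (11.4 * Y) :=
    mul_le_mul_of_nonneg_right (by linarith) (by positivity)
  linarith

/-- The width of the bounds propagates along the played policy. -/
theorem GoodStats.width_succ_le (hg : GoodStats M H Shat δ st) (hS : 1 ≤ Shat) {π : Policy X}
    (hπ : IsGreedy H Shat δ st π) {j : ℕ} (hj : j < H) (s : S) {x : X}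
    (hx : π.pair (H - (j + 1)) s = x) (hn : 1 ≤ st.n x) :
    (valueBounds H Shat δ st π (j + 1)).1 s - (valueBounds H Shat δ st π (j + 1)).2 s ≤
      (1 + 7 / H) * wavg (M.p x) (fun s' => (valueBounds H Shat δ st π j).1 s'
        - (valueBounds H Shat δ st π j).2 s')
      + 8 * phi X.card H Shat δ (st.n x)
      + 8 * wsd (M.p x) (M.polVal H π j) * phi X.card H Shat δ (st.n x)
      + 191 * (Shat * H ^ 2 * phi X.card H Shat δ (st.n x) ^ 2) := by
  have hV := hg.validBounds hS hπ j hj.le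
  have hwidth : (valueBounds H Shat δ st π (j + 1)).1 s - (valueBounds H Shat δ st π (j + 1)).2 s
      = upperQ H Shat δ st (j + 1) (valueBounds H Shat δ st π j) x
        - lowerQ H Shat δ st (j + 1) (valueBounds H Shat δ st π j) x := by
    rw [← hx]; rfl
  rw [hwidth]
  set V := valueBounds H Shat δ st π j
  have hle : ∀ s, V.2 s ≤ V.1 s :=
    fun s => (hV.lower_le s).trans ((hV.le_star s).trans (hV.star_le s))
  have hφ := phi_nonneg X.card H Shat δ (st.n x)
  have hb := le_bonus_of_nonneg (H := H) (Shat := Shat) (δ := δ) hg.P_nonneg hle x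
  have hd := hg.dev_P x hn
  set φ := phi X.card H Shat δ (st.n x)
  have hH0 : (1 : ℝ) ≤ H := by exact_mod_cast (show 1 ≤ H by omega)
  have hS' : (1 : ℝ) ≤ Shat := by exact_mod_cast hS
  have hjH : (j : ℝ) ≤ H := by exact_mod_cast hj.le
  have hj0 : (0 : ℝ) ≤ j := Nat.cast_nonneg j
  have hPD : wavg (st.P x) V.1 - wavg (st.P x) V.2 = wavg (st.P x) fun s => V.1 s - V.2 s :=
    (wavg_sub _ _ _).symm
  have hD : ∀ s, 0 ≤ V.1 s - V.2 s ∧ V.1 s - V.2 s ≤ H := fun s =>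
    ⟨by linarith [hle s], by linarith [hV.upper_le s, hV.lower_nonneg s]⟩
  have hPD0 : 0 ≤ wavg (st.P x) fun s => V.1 s - V.2 s :=
    wavg_nonneg (hg.P_nonneg x) fun s => (hD s).1
  have hpD0 : 0 ≤ wavg (M.p x) fun s => V.1 s - V.2 s :=
    wavg_nonneg (M.p_nonneg x) fun s => (hD s).1
  have h1 : upperQ H Shat δ st (j + 1) V x - lowerQ H Shat δ st (j + 1) V x
      ≤ (wavg (st.P x) fun s => V.1 s - V.2 s) + 2 * bonus H Shat δ st V x := by
    refine (clip_sub_clip_le ?_).trans (le_of_eq ?_)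
    · have : 0 ≤ bonus H Shat δ st V x := le_trans (by positivity) hb
      change st.r x + wavg (st.P x) V.2 - _ ≤ st.r x + wavg (st.P x) V.1 + _
      linarith
    · change st.r x + wavg (st.P x) V.1 + _ - (st.r x + wavg (st.P x) V.2 - _) = _
      rw [← hPD]; ring
  have hbe : bonus H Shat δ st V x = 4 * (√(st.r2 x - st.r x ^ 2) + wsd (st.P x) V.1) * φ
      + 53 * Shat * H ^ 2 * φ ^ 2 + 1 / H * wavg (st.P x) (fun s => V.1 s - V.2 s) := rfl
  have hr : √(st.r2 x - st.r x ^ 2) ≤ 1 :=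
    Real.sqrt_le_one.2 (by nlinarith [hg.r2_le x, sq_nonneg (st.r x)])
  have h2 : wsd (st.P x) V.1 ≤ wsd (st.P x) (M.polVal H π j)
      + √(H * wavg (st.P x) fun s => V.1 s - V.2 s) := by
    refine (wsd_le_wsd_add (g := M.polVal H π j) (hg.P_nonneg x) (hg.P_sum x)).trans
      (add_le_add le_rfl (Real.sqrt_le_sqrt ?_))
    refine le_trans (wavg_mono (hg.P_nonneg x) fun s => ?_) (wavg_sq_le (hg.P_nonneg x) hD)
    refine pow_le_pow_left₀ ?_ ?_ 2
    · linarith [hV.le_star s, hV.star_le s]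
    · linarith [hV.lower_le s]
  have h3 := mul_sqrt_le_amgm (t := 8 * φ) (c := H) (by positivity) hPD0 (show (0 : ℝ) < H by linarith)
  have hpol : ∀ s, 0 ≤ M.polVal H π j s ∧ M.polVal H π j s ≤ H := fun s =>
    ⟨(M.polVal_mem H π j s).1, by
      linarith [(M.polVal_mem H π j s).2, (M.starVal_mem π j s).2]⟩
  have h4 := hd.wsd_le (c := 2.9) (by norm_num) (by norm_num) hφ (by positivity) hpol (M.p_sum x)
    (hg.P_sum x) (by norm_num) (by norm_num) (by norm_num)
  have h5 := hd.abs_sub_le_absorb (by norm_num) (by norm_num) hφ (by positivity) hD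
    (show (0 : ℝ) < H by linarith)
  have h5' := (abs_le.1 h5).2
  exact h1.trans (width_arith hφ hH0 hS' (sqrt_le_self_of_one_le hS) hpD0 hr h2 h3 h4 h5' hbe)

end Recursion

section Ville

open scoped ENNReal

variable {Ω : Type w} [mΩ : MeasurableSpace Ω] {μ : Measure Ω}

/-- If the integral of `g` over every `m`-measurable set is at most its measure, then multiplying
an `m`-measurable function by `g` does not increase integrals. -/
lemma lintegral_mul_le_of_setLIntegral_le {m : MeasurableSpace Ω} (hm : m ≤ mΩ) {g f : Ω → ℝ≥0∞}
    (hg : Measurable[mΩ] g) (h : ∀ F, MeasurableSet[m] F → ∫⁻ ω in F, g ω ∂μ ≤ μ F)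
    (hf : Measurable[m] f) : ∫⁻ ω, f ω * g ω ∂μ ≤ ∫⁻ ω, f ω ∂μ := by
  have h1 : (μ.withDensity g).trim hm ≤ μ.trim hm := by
    refine Measure.le_iff.2 fun F hF => ?_
    rw [trim_measurableSet_eq hm hF, trim_measurableSet_eq hm hF,
      withDensity_apply _ (hm _ hF)]
    exact h F hF
  calc ∫⁻ ω, f ω * g ω ∂μ = ∫⁻ ω, f ω ∂(μ.withDensity g) := by
        rw [lintegral_withDensity_eq_lintegral_mul _ hg (hf.mono hm le_rfl)]
        simp only [Pi.mul_apply, mul_comm]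
    _ = ∫⁻ ω, f ω ∂((μ.withDensity g).trim hm) := (lintegral_trim hm hf).symm
    _ ≤ ∫⁻ ω, f ω ∂(μ.trim hm) := lintegral_mono' h1 le_rfl
    _ = ∫⁻ ω, f ω ∂μ := lintegral_trim hm hf

/-- Ville's inequality for products of factors of conditional expectation at most one. -/
theorem measure_exists_le_prod [IsProbabilityMeasure μ] (𝓕 : Filtration ℕ mΩ)
    {g : ℕ → Ω → ℝ≥0∞} (hg : ∀ t, Measurable[𝓕 (t + 1)] (g t))
    (h : ∀ t F, MeasurableSet[𝓕 t] F → ∫⁻ ω in F, g t ω ∂μ ≤ μ F) (c : ℝ≥0∞) :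
    c * μ {ω | ∃ t, c ≤ ∏ i ∈ Finset.range t, g i ω} ≤ 1 := by
  set W : ℕ → Ω → ℝ≥0∞ := fun t ω => ∏ i ∈ Finset.range t, g i ω with hW
  have hWm : ∀ t, Measurable[𝓕 t] (W t) := by
    intro t
    refine Finset.measurable_fun_prod _ fun i hi => ?_
    exact (hg i).mono (𝓕.mono (Finset.mem_range.1 hi)) le_rfl
  set B : ℕ → Set Ω := fun t => {ω | ∃ i ≤ t, c ≤ W i ω} with hB
  have hBm : ∀ t, MeasurableSet[𝓕 t] (B t) := by
    intro t
    have : B t = ⋃ i ∈ Finset.range (t + 1), {ω | c ≤ W i ω} := by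
      ext ω; simp [hB]
    rw [this]
    refine Finset.measurableSet_biUnion _ fun i hi => ?_
    exact 𝓕.mono (Nat.lt_succ_iff.1 (Finset.mem_range.1 hi)) _
      (measurableSet_le measurable_const (hWm i))
  have hmono : Monotone B := fun s t hst ω ⟨i, hi, h⟩ => ⟨i, hi.trans hst, h⟩
  have key : ∀ t, ∫⁻ ω in (B t)ᶜ, W t ω ∂μ + c * μ (B t) ≤ 1 := by
    intro t
    induction t with
    | zero =>
      have h0 : ∀ ω, W 0 ω = 1 := fun ω => by simp [hW]
      have hcB : c * μ (B 0) ≤ μ (B 0) := by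
        by_cases hc : c ≤ 1
        · exact mul_le_of_le_one_left' hc
        · have : B 0 = ∅ := by
            ext ω; simp [hB, h0, hc]
          simp [this]
      simp only [h0, lintegral_one, Measure.restrict_apply_univ]
      calc μ (B 0)ᶜ + c * μ (B 0) ≤ μ (B 0)ᶜ + μ (B 0) := by gcongr
        _ = 1 := by rw [add_comm, measure_add_measure_compl (𝓕.le 0 _ (hBm 0)), measure_univ]
    | succ t ih =>
      have hBt := 𝓕.le t _ (hBm t)
      have hBt1 := 𝓕.le (t + 1) _ (hBm (t + 1))
      have h1 : ∫⁻ ω in (B t)ᶜ, W (t + 1) ω ∂μ ≤ ∫⁻ ω in (B t)ᶜ, W t ω ∂μ := by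
        rw [← lintegral_indicator hBt.compl, ← lintegral_indicator hBt.compl]
        have := lintegral_mul_le_of_setLIntegral_le (μ := μ) (𝓕.le t)
          ((hg t).mono (𝓕.le _) le_rfl) (h t) ((hWm t).indicator (hBm t).compl)
        refine le_trans (lintegral_mono fun ω => ?_) this
        by_cases hω : ω ∈ (B t)ᶜ
        · simp only [Set.indicator_of_mem hω, hW, Finset.prod_range_succ]; exact le_rfl
        · simp [Set.indicator_of_notMem hω]
      have h2 : ∫⁻ ω in (B t)ᶜ, W (t + 1) ω ∂μ
          = ∫⁻ ω in (B t)ᶜ ∩ B (t + 1), W (t + 1) ω ∂μ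
            + ∫⁻ ω in (B (t + 1))ᶜ, W (t + 1) ω ∂μ := by
        rw [← lintegral_inter_add_sdiff _ _ hBt1]
        congr 3
        ext ω
        simp only [Set.mem_sdiff, Set.mem_compl_iff]
        exact ⟨fun h => h.2, fun h => ⟨fun h' => h (hmono (Nat.le_succ t) h'), h⟩⟩
      have h3 : c * μ ((B t)ᶜ ∩ B (t + 1)) ≤ ∫⁻ ω in (B t)ᶜ ∩ B (t + 1), W (t + 1) ω ∂μ := by
        rw [← setLIntegral_const]
        refine setLIntegral_mono' (hBt.compl.inter hBt1) fun ω hω => ?_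
        obtain ⟨i, hi, hc⟩ := hω.2
        rcases hi.lt_or_eq with hlt | rfl
        · exact absurd ⟨i, Nat.lt_succ_iff.1 hlt, hc⟩ hω.1
        · exact hc
      have h4 : μ (B (t + 1)) ≤ μ ((B t)ᶜ ∩ B (t + 1)) + μ (B t) := by
        refine (measure_mono fun ω hω => ?_).trans (measure_union_le _ _)
        by_cases h : ω ∈ B t
        · exact Or.inr h
        · exact Or.inl ⟨h, hω⟩
      calc ∫⁻ ω in (B (t + 1))ᶜ, W (t + 1) ω ∂μ + c * μ (B (t + 1))
          ≤ ∫⁻ ω in (B (t + 1))ᶜ, W (t + 1) ω ∂μ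
            + c * (μ ((B t)ᶜ ∩ B (t + 1)) + μ (B t)) := by gcongr
        _ = (c * μ ((B t)ᶜ ∩ B (t + 1)) + ∫⁻ ω in (B (t + 1))ᶜ, W (t + 1) ω ∂μ)
            + c * μ (B t) := by ring
        _ ≤ ∫⁻ ω in (B t)ᶜ, W (t + 1) ω ∂μ + c * μ (B t) := by rw [h2]; gcongr
        _ ≤ ∫⁻ ω in (B t)ᶜ, W t ω ∂μ + c * μ (B t) := by gcongr
        _ ≤ 1 := ih
  have hU : {ω | ∃ t, c ≤ ∏ i ∈ Finset.range t, g i ω} = ⋃ t, B t := by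
    ext ω
    simp only [Set.mem_ofPred_eq, Set.mem_iUnion, hB]
    exact ⟨fun ⟨t, ht⟩ => ⟨t, t, le_rfl, ht⟩, fun ⟨_, i, _, hi⟩ => ⟨i, hi⟩⟩
  rw [hU, hmono.measure_iUnion, ENNReal.mul_iSup]
  exact iSup_le fun t => le_trans le_add_self (key t)

/-- Exponential form of Ville's inequality. -/
theorem measure_exists_sum_ge_le [IsProbabilityMeasure μ] (𝓕 : Filtration ℕ mΩ)
    {Z : ℕ → Ω → ℝ} (hZ : ∀ t, Measurable[𝓕 (t + 1)] (Z t))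
    (h : ∀ t F, MeasurableSet[𝓕 t] F → ∫⁻ ω in F, ENNReal.ofReal (Real.exp (Z t ω)) ∂μ ≤ μ F)
    (ℓ : ℝ) :
    μ {ω | ∃ t, ℓ ≤ ∑ i ∈ Finset.range t, Z i ω} ≤ ENNReal.ofReal (Real.exp (-ℓ)) := by
  have h1 := measure_exists_le_prod (μ := μ) 𝓕
    (g := fun t ω => ENNReal.ofReal (Real.exp (Z t ω)))
    (fun t => (Real.measurable_exp.comp (hZ t)).ennreal_ofReal) h (ENNReal.ofReal (Real.exp ℓ))
  have h2 : {ω | ∃ t, ENNReal.ofReal (Real.exp ℓ)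
      ≤ ∏ i ∈ Finset.range t, ENNReal.ofReal (Real.exp (Z i ω))}
      = {ω | ∃ t, ℓ ≤ ∑ i ∈ Finset.range t, Z i ω} := by
    ext ω
    simp only [Set.mem_ofPred_eq]
    refine exists_congr fun t => ?_
    rw [← ENNReal.ofReal_prod_of_nonneg (fun i _ => (Real.exp_pos _).le), ← Real.exp_sum,
      ENNReal.ofReal_le_ofReal_iff (Real.exp_pos _).le, Real.exp_le_exp]
  rw [h2, mul_comm] at h1
  rw [Real.exp_neg, ENNReal.ofReal_inv_of_pos (Real.exp_pos _)]
  exact (ENNReal.le_inv_iff_mul_le).2 h1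

end Ville

section Bernstein

/-- The logarithmic factor of `phi`. -/
def logTerm (card H Shat : ℕ) (δ : ℝ) (n : ℕ) : ℝ :=
  1.4 * Real.log (Real.log (max (Real.exp 1) (2 * n)))
    + Real.log (5.2 * card * (4 * Shat + 5 * H + 7) / δ)

/-- Failure probability of a single confidence bound. -/
def failProb (card H Shat : ℕ) (δ : ℝ) : ℝ := δ / (card * (4 * Shat + 5 * H + 7))

lemma phi_eq {c H Shat n : ℕ} {δ : ℝ} (hn : 1 ≤ n) :
    phi c H Shat δ n = min 1 √(0.52 / n * logTerm c H Shat δ n) := by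
  rw [phi, if_neg (by omega), logTerm]

lemma one_le_log_max (n : ℕ) : 1 ≤ Real.log (max (Real.exp 1) (2 * n)) := by
  have h := Real.log_le_log (Real.exp_pos 1) (le_max_left (Real.exp 1) (2 * n : ℝ))
  rwa [Real.log_exp] at h

lemma logTerm_mono {c H Shat : ℕ} {δ : ℝ} {m n : ℕ} (h : m ≤ n) :
    logTerm c H Shat δ m ≤ logTerm c H Shat δ n := by
  have h1 : (m : ℝ) ≤ n := by exact_mod_cast h
  have h2 : max (Real.exp 1) (2 * m : ℝ) ≤ max (Real.exp 1) (2 * n) :=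
    max_le_max le_rfl (by linarith)
  have h3 := Real.log_le_log (lt_max_of_lt_left (Real.exp_pos 1)) h2
  have h4 := Real.log_le_log (by linarith [one_le_log_max m]) h3
  unfold logTerm
  linarith

variable {card H Shat : ℕ} {δ : ℝ}

lemma le_logTerm_arg (hc : 1 ≤ card) (hδ : 0 < δ) (hδ1 : δ ≤ 1) :
    5.2 ≤ 5.2 * card * (4 * Shat + 5 * H + 7) / δ := by
  rw [le_div_iff₀ hδ]
  have h1 : (1 : ℝ) ≤ card := by exact_mod_cast hc
  have h2 : (1 : ℝ) ≤ 4 * Shat + 5 * H + 7 := by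
    have : (0 : ℝ) ≤ Shat := Nat.cast_nonneg _
    have : (0 : ℝ) ≤ H := Nat.cast_nonneg _
    linarith
  have h3 := mul_le_mul h1 h2 zero_le_one (by linarith)
  nlinarith

lemma logTerm_pos (hc : 1 ≤ card) (hδ : 0 < δ) (hδ1 : δ ≤ 1) (n : ℕ) :
    0 < logTerm card H Shat δ n := by
  have h1 := le_logTerm_arg (H := H) (Shat := Shat) hc hδ hδ1
  have h2 : 0 ≤ Real.log (Real.log (max (Real.exp 1) (2 * n))) := Real.log_nonneg (one_le_log_max n)
  have h3 := Real.log_pos (by linarith : 1 < 5.2 * card * (4 * Shat + 5 * H + 7) / δ)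
  unfold logTerm
  linarith

lemma exp_neg_logTerm_le (hc : 1 ≤ card) (hδ : 0 < δ) (hδ1 : δ ≤ 1) (j : ℕ) :
    Real.exp (-(10 / 7 * logTerm card H Shat δ (2 ^ j)))
      ≤ failProb card H Shat δ / (5.2 * Real.log 2 ^ 2) * (1 / ((j + 1 : ℕ) : ℝ) ^ 2) := by
  set K := 5.2 * card * (4 * Shat + 5 * H + 7) / δ with hK
  have hK1 : 5.2 ≤ K := le_logTerm_arg hc hδ hδ1
  have hK0 : 0 < K := by linarith
  set l := Real.log (max (Real.exp 1) (2 * ((2 ^ j : ℕ) : ℝ))) with hl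
  have hl1 : 1 ≤ l := one_le_log_max _
  have hl2 : (j + 1 : ℕ) * Real.log 2 ≤ l := by
    rw [← Real.log_pow]
    refine Real.log_le_log (by positivity) ?_
    push_cast
    rw [pow_succ, mul_comm]
    exact le_max_right _ _
  have h2 : 0 < Real.log 2 := Real.log_pos (by norm_num)
  have hlK : 0 ≤ Real.log K := Real.log_nonneg (by linarith)
  have h1 : -(10 / 7 * logTerm card H Shat δ (2 ^ j)) ≤ -(Real.log (l ^ 2) + Real.log K) := by
    rw [Real.log_pow, logTerm, ← hl, ← hK]
    push_cast
    nlinarith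
  refine (Real.exp_le_exp.2 h1).trans ?_
  rw [Real.exp_neg, Real.exp_add, Real.exp_log (by positivity), Real.exp_log hK0]
  have h3 : failProb card H Shat δ / (5.2 * Real.log 2 ^ 2) * (1 / ((j + 1 : ℕ) : ℝ) ^ 2)
      = ((((j + 1 : ℕ) : ℝ) * Real.log 2) ^ 2 * K)⁻¹ := by
    rw [hK, failProb]
    have : (card : ℝ) ≠ 0 := by
      have : (1 : ℝ) ≤ card := by exact_mod_cast hc
      positivity
    field_simp
  rw [h3]
  gcongr

lemma tsum_exp_neg_logTerm_le (hc : 1 ≤ card) (hδ : 0 < δ) (hδ1 : δ ≤ 1) :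
    ∑' j : ℕ, ENNReal.ofReal (Real.exp (-(10 / 7 * logTerm card H Shat δ (2 ^ j))))
      ≤ ENNReal.ofReal (failProb card H Shat δ) := by
  have hz : HasSum (fun n : ℕ => 1 / ((n + 1 : ℕ) : ℝ) ^ 2) (Real.pi ^ 2 / 6) := by
    have := (hasSum_nat_add_iff' 1).2 hasSum_zeta_two
    simpa using this
  have hF : 0 ≤ failProb card H Shat δ := by unfold failProb; positivity
  have h2 : 0.6931 < Real.log 2 := by linarith [Real.log_two_gt_d9]
  set c := failProb card H Shat δ / (5.2 * Real.log 2 ^ 2)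
  have hc0 : 0 ≤ c := by positivity
  calc _ ≤ ∑' j : ℕ, ENNReal.ofReal (c * (1 / ((j + 1 : ℕ) : ℝ) ^ 2)) :=
        ENNReal.tsum_le_tsum fun j => ENNReal.ofReal_le_ofReal (exp_neg_logTerm_le hc hδ hδ1 j)
    _ = ENNReal.ofReal (∑' j : ℕ, c * (1 / ((j + 1 : ℕ) : ℝ) ^ 2)) :=
        (ENNReal.ofReal_tsum_of_nonneg (fun j => by positivity) (hz.mul_left c).summable).symm
    _ ≤ _ := by
        refine ENNReal.ofReal_le_ofReal ?_
        rw [(hz.mul_left c).tsum_eq]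
        have h3 : Real.pi ^ 2 / 6 ≤ 5.2 * Real.log 2 ^ 2 := by
          nlinarith [Real.pi_lt_d2, Real.pi_pos]
        calc c * (Real.pi ^ 2 / 6) ≤ c * (5.2 * Real.log 2 ^ 2) :=
              mul_le_mul_of_nonneg_left h3 hc0
          _ = _ := div_mul_cancel₀ _ (by positivity)

/-- Choice of the exponential tilt on the range `[N, 2 N]`. -/
lemma exists_tilt {b v ℓ N : ℝ} (hb : 0 < b) (hv : 0 ≤ v) (hℓ : 0 < ℓ) (hN : 0 < N) :
    ∃ t : ℝ, 0 ≤ t ∧ t * b ≤ 1 ∧ ∀ n D : ℝ, N ≤ n → n ≤ 2 * N → t * D - n * (t ^ 2 * v) < ℓ →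
      D ≤ 2.1214 * √v * √(n * ℓ) + 3 * b * ℓ := by
  by_cases h : N * v ≤ b ^ 2 * ℓ
  · refine ⟨1 / b, by positivity, (one_div_mul_cancel hb.ne').le, fun n D h1 h2 h3 => ?_⟩
    have h4 : D ≤ n * v / b + b * ℓ := by
      have h5 : D / b - n * v / b ^ 2 < ℓ := by
        calc _ = 1 / b * D - n * ((1 / b) ^ 2 * v) := by ring
          _ < ℓ := h3
      have h6 := mul_lt_mul_of_pos_left h5 hb
      have h7 : b * (D / b - n * v / b ^ 2) = D - n * v / b := by field_simp
      linarith
    have h5 : n * v / b ≤ 2 * b * ℓ := by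
      rw [div_le_iff₀ hb]
      nlinarith
    have h6 : 0 ≤ 2.1214 * √v * √(n * ℓ) := by positivity
    linarith
  · push Not at h
    have hv0 : 0 < v := by
      rcases hv.lt_or_eq with h' | h'
      · exact h'
      · rw [← h', mul_zero] at h
        have : 0 < b ^ 2 * ℓ := by positivity
        linarith
    have hsv : 0 < √v := Real.sqrt_pos.2 hv0
    have hsN : 0 < √N := Real.sqrt_pos.2 hN
    have hsl : 0 < √ℓ := Real.sqrt_pos.2 hℓ
    have ev := Real.sq_sqrt hv
    have eN := Real.sq_sqrt hN.le
    have el := Real.sq_sqrt hℓ.le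
    refine ⟨√ℓ / (√N * √v), by positivity, ?_, fun n D h1 h2 h3 => ?_⟩
    · rw [div_mul_eq_mul_div, div_le_one (by positivity)]
      refine abs_le_of_sq_le_sq' ?_ (by positivity) |>.2
      rw [mul_pow, mul_pow, ev, eN, el]
      linarith
    · have hn : 0 < n := hN.trans_le h1
      have en := Real.sq_sqrt hn.le
      have hsn : 0 < √n := Real.sqrt_pos.2 hn
      set a := √N
      set d := √n
      set s := √v
      set l := √ℓ
      rw [← ev, ← el, ← en] at h3
      rw [Real.sqrt_mul hn.le]
      change D ≤ 2.1214 * s * (d * l) + _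
      have h4 : D < d ^ 2 * s * l / a + l * s * a := by
        have h6 := mul_lt_mul_of_pos_left h3 (show 0 < a * s / l by positivity)
        have h7 : a * s / l * (l / (a * s) * D - d ^ 2 * ((l / (a * s)) ^ 2 * s ^ 2))
            = D - d ^ 2 * s * l / a := by field_simp
        have h8 : a * s / l * l ^ 2 = l * s * a := by field_simp
        linarith
      have h5 : a ≤ d := Real.sqrt_le_sqrt h1
      have h6 : d ^ 2 ≤ 2 * a ^ 2 := by rw [en, eN]; exact h2
      have h7 : d ^ 2 + a ^ 2 ≤ 2.1214 * (d * a) := by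
        have e1 : d ≤ 1.41422 * a := by
          refine abs_le_of_sq_le_sq' ?_ (by positivity) |>.2
          nlinarith
        have e2 : a * 1.41421 ≤ 1.41421 * d := by linarith
        nlinarith [mul_nonneg (sub_nonneg.2 h5) (sub_nonneg.2 e1)]
      have h8 : d ^ 2 * s * l / a + l * s * a = s * l / a * (d ^ 2 + a ^ 2) := by
        field_simp
      have h9 : s * l / a * (d ^ 2 + a ^ 2) ≤ s * l / a * (2.1214 * (d * a)) :=
        mul_le_mul_of_nonneg_left h7 (by positivity)
      have h10 : s * l / a * (2.1214 * (d * a)) = 2.1214 * s * (d * l) := by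
        field_simp
      have : 0 ≤ 3 * b * ℓ := by positivity
      linarith

/-- The deviation bound in terms of `phi`. -/
lemma deviation_le_phi (hc : 1 ≤ card) (hδ : 0 < δ) (hδ1 : δ ≤ 1) {n m : ℕ} (hn : 1 ≤ n)
    (hm : m ≤ n) {b v D : ℝ} (hb : 0 ≤ b)
    (hphi : phi card H Shat δ n < 1)
    (hD : D ≤ 2.1214 * √v * √(n * (10 / 7 * logTerm card H Shat δ m))
      + 3 * b * (10 / 7 * logTerm card H Shat δ m)) :
    D ≤ n * (3.52 * √v * phi card H Shat δ n + 8.25 * b * phi card H Shat δ n ^ 2) := by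
  have hL := logTerm_pos (H := H) (Shat := Shat) hc hδ hδ1 n
  have hmn := logTerm_mono (c := card) (H := H) (Shat := Shat) (δ := δ) hm
  have hφ0 := phi_nonneg card H Shat δ n
  have hφ : phi card H Shat δ n ^ 2 = 0.52 / n * logTerm card H Shat δ n := by
    rw [phi_eq hn] at hphi ⊢
    rw [min_eq_right (by
      rcases min_lt_iff.1 hphi with h | h
      · exact absurd h (lt_irrefl _)
      · exact h.le), Real.sq_sqrt (by positivity)]
  set φ := phi card H Shat δ n
  set Lm := logTerm card H Shat δ m
  set Ln := logTerm card H Shat δ n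
  have hn0 : (0 : ℝ) < n := by exact_mod_cast hn
  have h1 : Ln = n * φ ^ 2 / 0.52 := by rw [hφ]; field_simp
  have h2 : √(n * (10 / 7 * Lm)) ≤ 1.6576 * (n * φ) := by
    refine Real.sqrt_le_iff.2 ⟨by positivity, ?_⟩
    have : n * (10 / 7 * Lm) ≤ n * (10 / 7 * Ln) :=
      mul_le_mul_of_nonneg_left (by linarith) hn0.le
    refine this.trans ?_
    rw [h1]
    calc (n : ℝ) * (10 / 7 * (n * φ ^ 2 / 0.52)) = 10 / 7 / 0.52 * (n * φ) ^ 2 := by ring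
      _ ≤ 1.6576 ^ 2 * (n * φ) ^ 2 := mul_le_mul_of_nonneg_right (by norm_num) (sq_nonneg _)
      _ = _ := by ring
  have hv : 0 ≤ √v := Real.sqrt_nonneg v
  have h3 := mul_le_mul_of_nonneg_left h2 (show 0 ≤ 2.1214 * √v by positivity)
  have h4 : 3 * b * (10 / 7 * Lm) ≤ 8.25 * (b * (n * φ ^ 2)) := by
    have : b * Lm ≤ b * (n * φ ^ 2 / 0.52) := mul_le_mul_of_nonneg_left (by linarith) hb
    have h5 : 0 ≤ b * (n * φ ^ 2) := by positivity
    have h6 : b * (n * φ ^ 2 / 0.52) = b * (n * φ ^ 2) / 0.52 := by ring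
    rw [h6] at this
    have h7 : b * (n * φ ^ 2) / 0.52 ≤ 1.9231 * (b * (n * φ ^ 2)) := by
      rw [div_le_iff₀ (by norm_num)]; nlinarith
    nlinarith
  have h5 : 0 ≤ √v * (n * φ) := by positivity
  nlinarith

variable {Ω : Type w} [mΩ : MeasurableSpace Ω] {μ : Measure Ω}

open Classical in
/-- Time-uniform Bernstein inequality for the sum of the increments `Z t` over the times `t` at
which the event `O t` occurs. -/
theorem measure_bernstein_fail_le [IsProbabilityMeasure μ] (𝓕 : Filtration ℕ mΩ)
    (hc : 1 ≤ card) (hδ : 0 < δ) (hδ1 : δ ≤ 1) {O : ℕ → Set Ω}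
    (hO : ∀ t, MeasurableSet[𝓕 t] (O t)) {Z : ℕ → Ω → ℝ} (hZ : ∀ t, Measurable[𝓕 (t + 1)] (Z t))
    {b v : ℝ} (hb : 0 < b) (hv : 0 ≤ v)
    (hmgf : ∀ l : ℝ, 0 ≤ l → l * b ≤ 1 → ∀ t F, MeasurableSet[𝓕 t] F → F ⊆ O t →
      ∫⁻ ω in F, ENNReal.ofReal (Real.exp (l * Z t ω - l ^ 2 * v)) ∂μ ≤ μ F) :
    μ {ω | ∃ t n : ℕ, ((Finset.range t).filter fun i => ω ∈ O i).card = n ∧ 1 ≤ n ∧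
        phi card H Shat δ n < 1 ∧
        n * (3.52 * √v * phi card H Shat δ n + 8.25 * b * phi card H Shat δ n ^ 2)
          < ∑ i ∈ Finset.range t, (O i).indicator (Z i) ω}
      ≤ ENNReal.ofReal (failProb card H Shat δ) := by
  have hℓ : ∀ j : ℕ, 0 < 10 / 7 * logTerm card H Shat δ (2 ^ j) := fun j => by
    have := logTerm_pos (H := H) (Shat := Shat) hc hδ hδ1 (2 ^ j); positivity
  choose l hl0 hlb hl using fun j : ℕ => exists_tilt hb hv (hℓ j) (N := (2 : ℝ) ^ j) (by positivity)
  set Y : ℕ → ℕ → Ω → ℝ := fun j t => (O t).indicator fun ω => l j * Z t ω - l j ^ 2 * v with hY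
  set B : ℕ → Set Ω := fun j =>
    {ω | ∃ t, 10 / 7 * logTerm card H Shat δ (2 ^ j) ≤ ∑ i ∈ Finset.range t, Y j i ω} with hB
  have hBm : ∀ j, μ (B j) ≤
      ENNReal.ofReal (Real.exp (-(10 / 7 * logTerm card H Shat δ (2 ^ j)))) := by
    intro j
    refine measure_exists_sum_ge_le 𝓕 (fun t => ?_) (fun t F hF => ?_) _
    · exact (((hZ t).const_mul _).sub_const _).indicator (𝓕.mono (Nat.le_succ t) _ (hO t))
    · have hOm := 𝓕.le t _ (hO t)
      have hFm := 𝓕.le t _ hF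
      rw [← lintegral_inter_add_sdiff _ _ hOm, ← measure_inter_add_sdiff F hOm]
      refine add_le_add ?_ ?_
      · refine le_trans (le_of_eq ?_) (hmgf (l j) (hl0 j) (hlb j) t _ (hF.inter (hO t))
          Set.inter_subset_right)
        refine setLIntegral_congr_fun (hFm.inter hOm) fun ω hω => ?_
        simp only [hY, Set.indicator_of_mem hω.2]
      · refine le_of_eq ?_
        rw [← setLIntegral_one]
        refine setLIntegral_congr_fun (hFm.diff hOm) fun ω hω => ?_
        simp only [hY, Set.indicator_of_notMem hω.2, Real.exp_zero, ENNReal.ofReal_one]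
  refine le_trans (measure_mono (t := ⋃ j, B j) ?_) ((measure_iUnion_le B).trans
    ((ENNReal.tsum_le_tsum hBm).trans (tsum_exp_neg_logTerm_le hc hδ hδ1)))
  rintro ω ⟨t, n, hcard, hn, hphi, hlt⟩
  by_contra hnot
  simp only [Set.mem_iUnion, not_exists] at hnot
  set j := Nat.log 2 n with hj
  have h1 : 2 ^ j ≤ n := Nat.pow_log_le_self 2 (by omega)
  have h2 : n < 2 ^ (j + 1) := Nat.lt_pow_succ_log_self (by norm_num) n
  have h1' : (2 : ℝ) ^ j ≤ n := by exact_mod_cast h1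
  have h2' : (n : ℝ) ≤ 2 * 2 ^ j := by
    have : (n : ℝ) < 2 ^ (j + 1) := by exact_mod_cast h2
    rw [pow_succ] at this
    linarith
  have h3 : ∑ i ∈ Finset.range t, Y j i ω < 10 / 7 * logTerm card H Shat δ (2 ^ j) := by
    by_contra! hle
    exact hnot j ⟨t, hle⟩
  have h4 : ∑ i ∈ Finset.range t, Y j i ω
      = l j * ∑ i ∈ Finset.range t, (O i).indicator (Z i) ω - n * (l j ^ 2 * v) := by
    have : ∀ i, Y j i ω = l j * (O i).indicator (Z i) ω - if ω ∈ O i then l j ^ 2 * v else 0 := by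
      intro i
      by_cases h : ω ∈ O i <;> simp [hY, h]
    rw [Finset.sum_congr rfl fun i _ => this i, Finset.sum_sub_distrib, ← Finset.mul_sum,
      ← Finset.sum_filter, Finset.sum_const, hcard, nsmul_eq_mul]
  rw [h4] at h3
  have h5 := deviation_le_phi hc hδ hδ1 hn h1 hb.le hphi (hl j n _ h1' h2' h3)
  linarith

open Classical in
/-- Two-sided version of the time-uniform Bernstein inequality. -/
theorem measure_bernstein_abs_fail_le [IsProbabilityMeasure μ] (𝓕 : Filtration ℕ mΩ)
    (hc : 1 ≤ card) (hδ : 0 < δ) (hδ1 : δ ≤ 1) {O : ℕ → Set Ω}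
    (hO : ∀ t, MeasurableSet[𝓕 t] (O t)) {Z : ℕ → Ω → ℝ} (hZ : ∀ t, Measurable[𝓕 (t + 1)] (Z t))
    {b v : ℝ} (hb : 0 < b) (hv : 0 ≤ v)
    (hmgf : ∀ l : ℝ, |l| * b ≤ 1 → ∀ t F, MeasurableSet[𝓕 t] F → F ⊆ O t →
      ∫⁻ ω in F, ENNReal.ofReal (Real.exp (l * Z t ω - l ^ 2 * v)) ∂μ ≤ μ F) :
    μ {ω | ∃ t n : ℕ, ((Finset.range t).filter fun i => ω ∈ O i).card = n ∧ 1 ≤ n ∧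
        phi card H Shat δ n < 1 ∧
        n * (3.52 * √v * phi card H Shat δ n + 8.25 * b * phi card H Shat δ n ^ 2)
          < |∑ i ∈ Finset.range t, (O i).indicator (Z i) ω|}
      ≤ 2 * ENNReal.ofReal (failProb card H Shat δ) := by
  have h1 := measure_bernstein_fail_le (μ := μ) (H := H) (Shat := Shat) 𝓕 hc hδ hδ1 hO hZ hb hv
    fun l hl0 hl => hmgf l (by rwa [abs_of_nonneg hl0])
  have h2 := measure_bernstein_fail_le (μ := μ) (H := H) (Shat := Shat) 𝓕 hc hδ hδ1 hO
    (Z := fun t ω => - Z t ω) (fun t => (hZ t).neg) hb hv fun l hl0 hl t F hF hFO => by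
      have := hmgf (-l) (by rwa [abs_neg, abs_of_nonneg hl0]) t F hF hFO
      simpa only [mul_neg, neg_mul, neg_sq] using this
  rw [two_mul]
  refine le_trans (measure_mono ?_) ((measure_union_le _ _).trans (add_le_add h1 h2))
  rintro ω ⟨t, n, hcard, hn, hphi, hlt⟩
  rcases lt_abs.1 hlt with h | h
  · exact Or.inl ⟨t, n, hcard, hn, hphi, h⟩
  · refine Or.inr ⟨t, n, hcard, hn, hphi, h.trans_eq ?_⟩
    rw [← Finset.sum_neg_distrib]
    refine Finset.sum_congr rfl fun i _ => ?_
    by_cases hi : ω ∈ O i <;> simp [hi]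

end Bernstein

lemma Policy.pair_eq_iff {X : Finset (S × A)} (π : Policy X) (h : ℕ) (s : S) (x : X) :
    π.pair h s = x ↔ s = x.1.1 ∧ (π h x.1.1).1 = x.1.2 := by
  rcases x with ⟨⟨s', a⟩, hx⟩
  simp only [Policy.pair, Subtype.mk.injEq, Prod.mk.injEq]
  constructor
  · rintro ⟨rfl, h⟩; exact ⟨rfl, h⟩
  · rintro ⟨rfl, h⟩; exact ⟨rfl, h⟩

/-- Composition of a measurable family with a finitely-valued measurable index. -/
lemma measurable_comp_index {Ω : Type w} {m : MeasurableSpace Ω} {ι : Type*} [Fintype ι] {i : Ω → ι}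
    (hi : ∀ x, MeasurableSet[m] {ω | i ω = x}) {f : ι → Ω → ℝ} (hf : ∀ x, Measurable[m] (f x)) :
    Measurable[m] fun ω => f (i ω) ω := by
  have : (fun ω => f (i ω) ω) = fun ω => ∑ x, {ω | i ω = x}.indicator (f x) ω := by
    ext ω
    rw [Finset.sum_eq_single (i ω)]
    · simp
    · intro s _ hs; simp [Ne.symm hs]
    · simp
  rw [this]
  exact Finset.measurable_fun_sum _ fun x _ => (hf x).indicator (hi x)

namespace Run

open scoped ENNReal

variable {X : Finset (S × A)} [Fintype S] {M : MDP X} {G : Digraph X} {H Shat : ℕ} {δ : ℝ}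
  {s₀ : S} {Ω : Type w} [mΩ : MeasurableSpace Ω] {μ : Measure Ω}

/-- The pair played at the global time `t`, that is, in step `t % H` of episode `t / H`. -/
def play (ρ : Run M G H Shat δ s₀ μ) (t : ℕ) (ω : Ω) : X :=
  (ρ.policy (t / H) ω).pair (t % H) (ρ.state (t / H) (t % H) ω)

/-- The reward observed for `y` at the global time `t`. -/
def rew (ρ : Run M G H Shat δ s₀ μ) (t : ℕ) (y : X) (ω : Ω) : ℝ := ρ.reward (t / H) (t % H) y ω

/-- The successor observed for `y` at the global time `t`. -/
def nxt (ρ : Run M G H Shat δ s₀ μ) (t : ℕ) (y : X) (ω : Ω) : S := ρ.next (t / H) (t % H) y ω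

/-- The event that `y` is observed at time `t`. -/
def obs (ρ : Run M G H Shat δ s₀ μ) (t : ℕ) (y : X) : Set Ω := {ω | Observes G (ρ.play t ω) y}

variable (ρ : Run M G H Shat δ s₀ μ)

lemma policy_pair_meas (k : ℕ) {h : ℕ} (hh : h < H) (s : S) (x : X) :
    MeasurableSet[ρ.𝓕 (k * H)] {ω | (ρ.policy k ω).pair h s = x} := by
  simp only [Policy.pair_eq_iff]
  by_cases hs : s = x.1.1
  · simpa only [hs, true_and] using ρ.policy_meas k h hh _ _
  · simp [hs]

lemma play_meas (hH : 0 < H) (t : ℕ) (x : X) : MeasurableSet[ρ.𝓕 t] {ω | ρ.play t ω = x} := by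
  have hh := Nat.mod_lt t hH
  have ht : t / H * H + t % H = t := Nat.div_add_mod' t H
  have h1 := ρ.state_meas (t / H) (t % H) hh x.1.1
  rw [ht] at h1
  have h2 := ρ.𝓕.mono (Nat.div_mul_le_self t H) _ (ρ.policy_meas (t / H) (t % H) hh x.1.1 x.1.2)
  have : {ω | ρ.play t ω = x} = {ω | ρ.state (t / H) (t % H) ω = x.1.1}
      ∩ {ω | (ρ.policy (t / H) ω (t % H) x.1.1).1 = x.1.2} := by
    ext ω; exact Policy.pair_eq_iff _ _ _ _
  rw [this]
  exact h1.inter h2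

lemma obs_meas (hH : 0 < H) (t : ℕ) (y : X) : MeasurableSet[ρ.𝓕 t] (ρ.obs t y) := by
  have : ρ.obs t y = ⋃ x ∈ {x : X | Observes G x y}, {ω | ρ.play t ω = x} := by
    ext ω; simp [obs]
  rw [this]
  exact MeasurableSet.biUnion (Set.to_countable _) fun x _ => ρ.play_meas hH t x

lemma rew_meas (hH : 0 < H) (t : ℕ) (y : X) : Measurable[ρ.𝓕 (t + 1)] (ρ.rew t y) := by
  have h := ρ.reward_meas (t / H) (t % H) (Nat.mod_lt t hH) y
  rwa [Nat.div_add_mod' t H] at h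

lemma nxt_meas (hH : 0 < H) (t : ℕ) (y : X) (s : S) :
    MeasurableSet[ρ.𝓕 (t + 1)] {ω | ρ.nxt t y ω = s} := by
  have h := ρ.next_meas (t / H) (t % H) (Nat.mod_lt t hH) y s
  rwa [Nat.div_add_mod' t H] at h

lemma rew_law (hH : 0 < H) (t : ℕ) (y : X) {F : Set Ω} (hF : MeasurableSet[ρ.𝓕 t] F)
    (hFO : F ⊆ ρ.obs t y) {B : Set ℝ} (hB : MeasurableSet B) :
    μ (F ∩ ρ.rew t y ⁻¹' B) = μ F * M.PR y B :=
  ρ.reward_law (t / H) (t % H) (Nat.mod_lt t hH) y F (by rwa [Nat.div_add_mod' t H])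
    (fun _ h => hFO h) B hB

lemma nxt_law (hH : 0 < H) (t : ℕ) (y : X) {F : Set Ω} (hF : MeasurableSet[ρ.𝓕 t] F)
    (hFO : F ⊆ ρ.obs t y) (s : S) :
    μ (F ∩ {ω | ρ.nxt t y ω = s}) = μ F * M.P y s :=
  ρ.next_law (t / H) (t % H) (Nat.mod_lt t hH) y F (by rwa [Nat.div_add_mod' t H])
    (fun _ h => hFO h) s

lemma lintegral_rew (hH : 0 < H) (t : ℕ) (y : X) {F : Set Ω} (hF : MeasurableSet[ρ.𝓕 t] F)
    (hFO : F ⊆ ρ.obs t y) {g : ℝ → ℝ≥0∞} (hg : Measurable g) :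
    ∫⁻ ω in F, g (ρ.rew t y ω) ∂μ = μ F * ∫⁻ r, g r ∂(M.PR y) := by
  have hm : Measurable (ρ.rew t y) := (ρ.rew_meas hH t y).mono (ρ.𝓕.le _) le_rfl
  have : (μ.restrict F).map (ρ.rew t y) = μ F • M.PR y := by
    ext B hB
    rw [Measure.map_apply hm hB, Measure.restrict_apply (hm hB), Set.inter_comm,
      ρ.rew_law hH t y hF hFO hB, Measure.smul_apply, smul_eq_mul]
  rw [← lintegral_map hg hm, this, lintegral_smul_measure, smul_eq_mul]

lemma lintegral_nxt_eq (hH : 0 < H) (t : ℕ) (y : X) {F : Set Ω} (hF : MeasurableSet[ρ.𝓕 t] F)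
    (hFO : F ⊆ ρ.obs t y) (s : S) {f : Ω → ℝ≥0∞} (hf : Measurable[ρ.𝓕 t] f) :
    ∫⁻ ω in F ∩ {ω | ρ.nxt t y ω = s}, f ω ∂μ = M.P y s * ∫⁻ ω in F, f ω ∂μ := by
  have hle := ρ.𝓕.le t
  have hN : MeasurableSet {ω | ρ.nxt t y ω = s} := ρ.𝓕.le _ _ (ρ.nxt_meas hH t y s)
  have h1 : (μ.restrict (F ∩ {ω | ρ.nxt t y ω = s})).trim hle
      = M.P y s • (μ.restrict F).trim hle := by
    refine @Measure.ext _ (ρ.𝓕 t) _ _ fun E hE => ?_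
    rw [trim_measurableSet_eq hle hE, Measure.restrict_apply (hle _ hE), Measure.smul_apply,
      trim_measurableSet_eq hle hE, Measure.restrict_apply (hle _ hE), smul_eq_mul,
      ← Set.inter_assoc, ρ.nxt_law hH t y (hE.inter hF) (Set.inter_subset_right.trans hFO), mul_comm]
  rw [← lintegral_trim hle hf, h1, lintegral_smul_measure, lintegral_trim hle hf, smul_eq_mul]

lemma lintegral_nxt (hH : 0 < H) (t : ℕ) (y : X) {F : Set Ω} (hF : MeasurableSet[ρ.𝓕 t] F)
    (hFO : F ⊆ ρ.obs t y) {f : S → Ω → ℝ≥0∞} (hf : ∀ s, Measurable[ρ.𝓕 t] (f s)) :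
    ∫⁻ ω in F, f (ρ.nxt t y ω) ω ∂μ = ∫⁻ ω in F, ∑ s, M.P y s * f s ω ∂μ := by
  have hle := ρ.𝓕.le t
  have hN : ∀ s, MeasurableSet {ω | ρ.nxt t y ω = s} := fun s => ρ.𝓕.le _ _ (ρ.nxt_meas hH t y s)
  have h1 : ∀ ω, f (ρ.nxt t y ω) ω = ∑ s, {ω | ρ.nxt t y ω = s}.indicator (f s) ω := by
    intro ω
    rw [Finset.sum_eq_single (ρ.nxt t y ω)]
    · simp
    · intro s _ hs; simp [Ne.symm hs]
    · simp
  simp only [h1]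
  rw [lintegral_finsetSum _ fun s _ => ((hf s).mono hle le_rfl).indicator (hN s),
    lintegral_finsetSum _ fun s _ => ((hf s).mono hle le_rfl).const_mul _]
  refine Finset.sum_congr rfl fun s _ => ?_
  rw [lintegral_indicator (hN s), Measure.restrict_restrict (hN s), Set.inter_comm,
    ρ.lintegral_nxt_eq hH t y hF hFO s (hf s), lintegral_const_mul _ ((hf s).mono hle le_rfl)]

/-- Integrals over functions of the played pair and its successor. -/
lemma lintegral_play_le (hH : 0 < H) (t : ℕ) {F : Set Ω} (hF : MeasurableSet[ρ.𝓕 t] F)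
    {f : X → S → Ω → ℝ≥0∞} (hf : ∀ x s, Measurable[ρ.𝓕 t] (f x s))
    (h : ∀ x ω, ∑ s, M.P x s * f x s ω ≤ 1) :
    ∫⁻ ω in F, f (ρ.play t ω) (ρ.nxt t (ρ.play t ω) ω) ω ∂μ ≤ μ F := by
  have hle := ρ.𝓕.le t
  have hU : F = ⋃ x ∈ (Finset.univ : Finset X), F ∩ {ω | ρ.play t ω = x} := by
    ext ω; simp
  have hd : (↑(Finset.univ : Finset X) : Set X).PairwiseDisjoint
      fun x => F ∩ {ω | ρ.play t ω = x} := by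
    intro x _ y _ hxy
    refine Set.disjoint_left.2 fun ω h1 h2 => hxy ?_
    exact h1.2.symm.trans h2.2
  have hm : ∀ x, MeasurableSet[ρ.𝓕 t] (F ∩ {ω | ρ.play t ω = x}) :=
    fun x => hF.inter (ρ.play_meas hH t x)
  have e1 : ∫⁻ ω in F, f (ρ.play t ω) (ρ.nxt t (ρ.play t ω) ω) ω ∂μ
      = ∑ x, ∫⁻ ω in F ∩ {ω | ρ.play t ω = x}, f (ρ.play t ω) (ρ.nxt t (ρ.play t ω) ω) ω ∂μ := by
    conv_lhs => rw [hU]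
    exact lintegral_biUnion_finset hd (fun x _ => hle _ (hm x)) _
  have e2 : μ F = ∑ x, μ (F ∩ {ω | ρ.play t ω = x}) := by
    conv_lhs => rw [hU]
    exact measure_biUnion_finset hd fun x _ => hle _ (hm x)
  rw [e1, e2]
  refine Finset.sum_le_sum fun x _ => ?_
  have hsub : F ∩ {ω | ρ.play t ω = x} ⊆ ρ.obs t x := fun ω hω => Or.inl hω.2.symm
  calc ∫⁻ ω in F ∩ {ω | ρ.play t ω = x}, f (ρ.play t ω) (ρ.nxt t (ρ.play t ω) ω) ω ∂μ
      = ∫⁻ ω in F ∩ {ω | ρ.play t ω = x}, f x (ρ.nxt t x ω) ω ∂μ := by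
        refine setLIntegral_congr_fun (hle _ (hm x)) fun ω hω => ?_
        have : ρ.play t ω = x := hω.2
        simp only [this]
    _ = ∫⁻ ω in F ∩ {ω | ρ.play t ω = x}, ∑ s, M.P x s * f x s ω ∂μ :=
        ρ.lintegral_nxt hH t x (hm x) hsub (hf x)
    _ ≤ ∫⁻ _ in F ∩ {ω | ρ.play t ω = x}, 1 ∂μ := lintegral_mono fun ω => h x ω
    _ = _ := setLIntegral_one _

end Run

section Summary

variable {X : Finset (S × A)}

open Classical in
/-- Sum of `Z` over the observations of `y` in the first `t` plays. -/
def obsSum (G : Digraph X) (x : ℕ → X) (y : X) (Z : ℕ → ℝ) (t : ℕ) : ℝ :=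
  ∑ i ∈ (Finset.range t).filter fun i => Observes G (x i) y, Z i

lemma obsSum_sub_const (G : Digraph X) (x : ℕ → X) (y : X) (Z : ℕ → ℝ) (t : ℕ) (c : ℝ) :
    obsSum G x y (fun i => Z i - c) t = obsSum G x y Z t - obsCount G x t y * c := by
  simp [obsSum, obsCount, Finset.sum_sub_distrib]

lemma obsSum_succ_of {G : Digraph X} {x : ℕ → X} {y : X} {t : ℕ} (h : Observes G (x t) y)
    (Z : ℕ → ℝ) : obsSum G x y Z (t + 1) = obsSum G x y Z t + Z t := by
  classical
  rw [obsSum, obsSum, Finset.range_add_one, Finset.filter_insert, if_pos h,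
    Finset.sum_insert (by simp), add_comm]

lemma obsSum_succ_of_not {G : Digraph X} {x : ℕ → X} {y : X} {t : ℕ} (h : ¬ Observes G (x t) y)
    (Z : ℕ → ℝ) : obsSum G x y Z (t + 1) = obsSum G x y Z t := by
  classical
  rw [obsSum, obsSum, Finset.range_add_one, Finset.filter_insert, if_neg h]

lemma obsCount_succ_of {G : Digraph X} {x : ℕ → X} {y : X} {t : ℕ} (h : Observes G (x t) y) :
    obsCount G x (t + 1) y = obsCount G x t y + 1 := by
  classical
  rw [obsCount, obsCount, Finset.range_add_one, Finset.filter_insert, if_pos h,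
    Finset.card_insert_of_notMem (by simp)]

lemma obsCount_succ_of_not {G : Digraph X} {x : ℕ → X} {y : X} {t : ℕ}
    (h : ¬ Observes G (x t) y) : obsCount G x (t + 1) y = obsCount G x t y := by
  classical
  rw [obsCount, obsCount, Finset.range_add_one, Finset.filter_insert, if_neg h]

open Classical in
/-- The model `st` summarizes the observations of the first `t` plays. -/
structure IsSummary (G : Digraph X) (s₀ : S) (x : ℕ → X) (R : ℕ → X → ℝ) (N : ℕ → X → S) (t : ℕ)
    (st : Stats X) : Prop where
  n_eq : ∀ y, st.n y = obsCount G x t y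
  r_eq : ∀ y, st.n y * st.r y = obsSum G x y (fun i => R i y) t
  r2_eq : ∀ y, st.n y * st.r2 y = obsSum G x y (fun i => R i y ^ 2) t
  P_eq : ∀ y s, st.n y * st.P y s = obsSum G x y (fun i => if s = N i y then 1 else 0) t
  zero : ∀ y, st.n y = 0 → st.r y = 0 ∧ st.r2 y = 0 ∧ ∀ s, st.P y s = if s = s₀ then 1 else 0

variable {G : Digraph X} {s₀ : S} {x : ℕ → X} {R : ℕ → X → ℝ} {N : ℕ → X → S} {t : ℕ}
  {st : Stats X}

lemma isSummary_init : IsSummary G s₀ x R N 0 (Stats.init s₀) := by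
  constructor <;> simp [Stats.init, obsCount, obsSum]

lemma mul_runAvg (n : ℕ) (a b : ℝ) : ((n + 1 : ℕ) : ℝ) * runAvg (n + 1) a b = n * a + b := by
  unfold runAvg
  push_cast
  field_simp
  ring

lemma IsSummary.observe (h : IsSummary G s₀ x R N t st) :
    IsSummary G s₀ x R N (t + 1) (st.observe G (x t) (R t) (N t)) := by
  classical
  constructor
  · intro y
    by_cases hy : Observes G (x t) y
    · simp [Stats.observe, hy, obsCount_succ_of, h.n_eq]
    · simp [Stats.observe, hy, obsCount_succ_of_not, h.n_eq]
  · intro y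
    by_cases hy : Observes G (x t) y
    · simp only [Stats.observe, hy, if_true, mul_runAvg, h.r_eq, obsSum_succ_of]
    · simp only [Stats.observe, hy, if_false, h.r_eq, obsSum_succ_of_not, not_false_eq_true]
  · intro y
    by_cases hy : Observes G (x t) y
    · simp only [Stats.observe, hy, if_true, mul_runAvg, h.r2_eq, obsSum_succ_of]
    · simp only [Stats.observe, hy, if_false, h.r2_eq, obsSum_succ_of_not, not_false_eq_true]
  · intro y s
    by_cases hy : Observes G (x t) y
    · simp only [Stats.observe, hy, if_true, mul_runAvg, h.P_eq, obsSum_succ_of]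
    · simp only [Stats.observe, hy, if_false, h.P_eq, obsSum_succ_of_not, not_false_eq_true]
  · intro y
    by_cases hy : Observes G (x t) y
    · simp [Stats.observe, hy]
    · simpa [Stats.observe, hy] using h.zero y

lemma IsSummary.bounded_avg (h : IsSummary G s₀ x R N t st) {y : X} (hn : 1 ≤ st.n y)
    {a b : ℝ} {Z : ℕ → ℝ} (hZ : ∀ i, Observes G (x i) y → 0 ≤ Z i ∧ Z i ≤ b)
    (ha : st.n y * a = obsSum G x y Z t) : 0 ≤ a ∧ a ≤ b := by
  classical
  have hn0 : (0 : ℝ) < st.n y := by exact_mod_cast hn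
  have h1 : 0 ≤ obsSum G x y Z t :=
    Finset.sum_nonneg fun i hi => (hZ i (Finset.mem_filter.1 hi).2).1
  have h2 : obsSum G x y Z t ≤ st.n y * b := by
    rw [h.n_eq, obsCount, ← nsmul_eq_mul]
    exact Finset.sum_le_card_nsmul _ _ _ fun i hi => (hZ i (Finset.mem_filter.1 hi).2).2
  constructor
  · by_contra! hlt
    nlinarith
  · exact le_of_mul_le_mul_left (ha.trans_le h2) hn0

/-- Deviation of an average, from the deviation of the sum if `phi` is not cut off. -/
lemma abs_sub_le_of_sum {card H Shat n : ℕ} {δ a m b v D : ℝ} (hn : 1 ≤ n)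
    (hD : n * a - n * m = D) (hb : |a - m| ≤ b)
    (hdev : phi card H Shat δ n < 1 →
      |D| ≤ n * (3.52 * √v * phi card H Shat δ n + 8.25 * b * phi card H Shat δ n ^ 2)) :
    |a - m| ≤ 3.52 * √v * phi card H Shat δ n + 8.25 * b * phi card H Shat δ n ^ 2 := by
  rcases (phi_le_one card H Shat δ n).lt_or_eq with h | h
  · have hn0 : (0 : ℝ) < n := by exact_mod_cast hn
    have h1 := hdev h
    rw [← hD, ← mul_sub, abs_mul, abs_of_pos hn0] at h1
    exact le_of_mul_le_mul_left h1 hn0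
  · rw [h]
    have h1 : 0 ≤ b := (abs_nonneg _).trans hb
    have h2 := Real.sqrt_nonneg v
    nlinarith

lemma MDP.sq_rewardDev_mem (M : MDP X) (y : X) {r : ℝ} (hr : r ∈ Set.Icc (0 : ℝ) 1) :
    0 ≤ (r - M.meanReward y) ^ 2 ∧ (r - M.meanReward y) ^ 2 ≤ 1 := by
  have h := M.meanReward_mem y
  exact ⟨sq_nonneg _, by nlinarith [hr.1, hr.2, h.1, h.2]⟩

lemma MDP.ae_reward_mem (M : MDP X) (y : X) : ∀ᵐ r ∂(M.PR y), r ∈ Set.Icc (0 : ℝ) 1 := by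
  rw [ae_iff]; exact M.PR_bdd y

lemma MDP.rewardVar_le_one (M : MDP X) (y : X) : M.rewardVar y ≤ 1 := by
  have := M.PR_prob y
  have h1 : Integrable (fun r : ℝ => (r - M.meanReward y) ^ 2) (M.PR y) :=
    Integrable.of_bound (by fun_prop) 1 ((M.ae_reward_mem y).mono fun r hr => by
      rw [Real.norm_eq_abs, abs_of_nonneg (M.sq_rewardDev_mem y hr).1]
      exact (M.sq_rewardDev_mem y hr).2)
  calc M.rewardVar y ≤ ∫ _, (1 : ℝ) ∂(M.PR y) := integral_mono_ae h1 (integrable_const _)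
        ((M.ae_reward_mem y).mono fun r hr => (M.sq_rewardDev_mem y hr).2)
    _ = 1 := by simp

variable [Fintype S] {M : MDP X} {H Shat : ℕ} {δ : ℝ}

/-- The deviation bound for the sum of `Z` over the observations of `y`. -/
def SumDev (G : Digraph X) (H Shat : ℕ) (δ : ℝ) (x : ℕ → X) (y : X) (Z : ℕ → ℝ) (b v : ℝ) : Prop :=
  ∀ t n, obsCount G x t y = n → 1 ≤ n → phi X.card H Shat δ n < 1 → |obsSum G x y Z t| ≤
    n * (3.52 * √v * phi X.card H Shat δ n + 8.25 * b * phi X.card H Shat δ n ^ 2)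

open Classical in
/-- The deviation bounds hold for all the quantities that the algorithm estimates. -/
structure GoodObs (M : MDP X) (G : Digraph X) (H Shat : ℕ) (δ : ℝ) (x : ℕ → X) (R : ℕ → X → ℝ)
    (N : ℕ → X → S) : Prop where
  rew_mem : ∀ i y, Observes G (x i) y → R i y ∈ Set.Icc (0 : ℝ) 1
  nxt_mem : ∀ i y, Observes G (x i) y → M.p y (N i y) ≠ 0
  rew : ∀ y, SumDev G H Shat δ x y (fun i => R i y - M.meanReward y) 1 (M.rewardVar y)
  rew2 : ∀ y, SumDev G H Shat δ x y (fun i => (R i y - M.meanReward y) ^ 2 - M.rewardVar y) 1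
    (M.rewardVar y)
  star : ∀ y, ∀ j < H, 1 ≤ j → SumDev G H Shat δ x y
    (fun i => M.starVal j (N i y) - wavg (M.p y) (M.starVal j)) j (wvar (M.p y) (M.starVal j))
  nxt : ∀ y s, M.p y s ≠ 0 → SumDev G H Shat δ x y
    (fun i => (if s = N i y then 1 else 0) - M.p y s) 1 (M.p y s)

lemma IsSummary.n_mul_wavg (h : IsSummary G s₀ x R N t st) (y : X) (f : S → ℝ) :
    st.n y * wavg (st.P y) f = obsSum G x y (fun i => f (N i y)) t := by
  classical
  simp only [wavg, Finset.mul_sum, ← mul_assoc, h.P_eq, obsSum, Finset.sum_mul]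
  rw [Finset.sum_comm]
  refine Finset.sum_congr rfl fun i _ => ?_
  simp

lemma abs_sub_le_of_mem {a b c : ℝ} (ha : 0 ≤ a ∧ a ≤ c) (hb : 0 ≤ b ∧ b ≤ c) : |a - b| ≤ c :=
  abs_le.2 ⟨by linarith, by linarith⟩

lemma MDP.p_le_one (M : MDP X) (y : X) (s : S) : M.p y s ≤ 1 := by
  rw [← M.p_sum y]
  exact Finset.single_le_sum (fun s _ => M.p_nonneg y s) (Finset.mem_univ s)

/-- The model is good if the deviation bounds hold. -/
theorem GoodObs.goodStats (hg : GoodObs M G H Shat δ x R N) (π : Policy X)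
    (hsupp : ∀ x, (M.P x).support.ncard ≤ Shat) (h : IsSummary G s₀ x R N t st) :
    GoodStats M H Shat δ st := by
  classical
  have hcase : ∀ y, st.n y = 0 ∨ 1 ≤ st.n y := fun y => by omega
  have hr : ∀ y, 1 ≤ st.n y → 0 ≤ st.r y ∧ st.r y ≤ 1 := fun y hn =>
    h.bounded_avg hn (fun i hi => hg.rew_mem i y hi) (h.r_eq y)
  have hr2 : ∀ y, 1 ≤ st.n y → 0 ≤ st.r2 y ∧ st.r2 y ≤ 1 := fun y hn =>
    h.bounded_avg hn (fun i hi => ⟨sq_nonneg _, by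
      have := hg.rew_mem i y hi; nlinarith [this.1, this.2]⟩) (h.r2_eq y)
  have hP : ∀ y, 1 ≤ st.n y → ∀ s, 0 ≤ st.P y s ∧ st.P y s ≤ 1 := fun y hn s =>
    h.bounded_avg hn (fun i _ => by split <;> norm_num) (h.P_eq y s)
  have hw : ∀ y, 1 ≤ st.n y → ∀ (f : S → ℝ) (b : ℝ), (∀ s, 0 ≤ f s ∧ f s ≤ b) →
      0 ≤ wavg (st.P y) f ∧ wavg (st.P y) f ≤ b := fun y hn f b hf =>
    h.bounded_avg hn (fun i _ => hf _) (h.n_mul_wavg y f)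
  refine ⟨fun y s => ?_, fun y => ?_, fun y => ?_, fun y => ?_, fun y hn => ?_, fun y hn => ?_,
    fun y hn => ?_, fun y hn j hj => ?_⟩
  · rcases hcase y with h0 | h0
    · rw [(h.zero y h0).2.2 s]; split <;> norm_num
    · exact (hP y h0 s).1
  · rcases hcase y with h0 | h0
    · simp [(h.zero y h0).2.2]
    · have e := h.n_mul_wavg y fun _ => 1
      simp only [wavg, mul_one, obsSum, Finset.sum_const, nsmul_eq_mul] at e
      rw [h.n_eq] at e h0
      have h1 : (obsCount G x t y : ℝ) ≠ 0 := by
        have : (1 : ℝ) ≤ obsCount G x t y := by exact_mod_cast h0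
        positivity
      refine mul_left_cancel₀ h1 ?_
      rw [mul_one]
      exact e
  · rcases hcase y with h0 | h0
    · rw [(h.zero y h0).1]; norm_num
    · exact hr y h0
  · rcases hcase y with h0 | h0
    · rw [(h.zero y h0).2.1]; norm_num
    · exact (hr2 y h0).2
  · have hoff : ∀ s, M.p y s = 0 → st.P y s = 0 := by
      intro s hs
      have e := h.P_eq y s
      rw [obsSum, Finset.sum_eq_zero] at e
      · rcases mul_eq_zero.1 e with e | e
        · have : st.n y = 0 := by exact_mod_cast e
          omega
        · exact e
      · intro i hi
        refine if_neg fun hsN => hg.nxt_mem i y (Finset.mem_filter.1 hi).2 ?_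
        rw [← hsN]; exact hs
    refine ⟨M.p_nonneg y, fun s => ?_, ?_⟩
    · by_cases hs : M.p y s = 0
      · rw [hoff s hs, hs]
        simp only [sub_zero, abs_zero, Real.sqrt_zero, mul_zero, zero_mul, zero_add]
        positivity
      · have := abs_sub_le_of_sum (b := 1) (v := M.p y s) (m := M.p y s) (a := st.P y s)
          (card := X.card) (H := H) (Shat := Shat) (δ := δ) hn rfl
          (abs_sub_le_of_mem (hP y hn s) ⟨M.p_nonneg y s, M.p_le_one y s⟩) fun hφ => by
            have := hg.nxt y s hs t _ (h.n_eq y).symm hn hφ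
            rwa [obsSum_sub_const, ← h.P_eq, ← h.n_eq] at this
        simpa using this
    · refine le_trans (Set.ncard_le_ncard ?_ (Set.toFinite _)) (hsupp y)
      intro s hs
      rw [PMF.mem_support_iff]
      intro h0
      have : M.p y s = 0 := by simp [MDP.p, h0]
      exact hs ((hoff s this).trans this.symm)
  · have := abs_sub_le_of_sum (b := 1) (v := M.rewardVar y) (m := M.meanReward y) (a := st.r y)
      (card := X.card) (H := H) (Shat := Shat) (δ := δ) hn rfl
      (abs_sub_le_of_mem (hr y hn) (M.meanReward_mem y)) fun hφ => by
        have := hg.rew y t _ (h.n_eq y).symm hn hφ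
        rwa [obsSum_sub_const, ← h.r_eq, ← h.n_eq] at this
    simpa using this
  · have he : st.n y * (st.r2 y - 2 * M.meanReward y * st.r y + M.meanReward y ^ 2)
        = obsSum G x y (fun i => (R i y - M.meanReward y) ^ 2) t := by
      have e : ∀ i, (R i y - M.meanReward y) ^ 2
          = (R i y ^ 2 - 2 * M.meanReward y * R i y) + M.meanReward y ^ 2 := fun i => by ring
      simp only [e, obsSum, Finset.sum_add_distrib, Finset.sum_sub_distrib, ← Finset.mul_sum,
        Finset.sum_const, nsmul_eq_mul]
      have e1 := h.r_eq y
      have e2 := h.r2_eq y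
      have e3 := h.n_eq y
      simp only [obsSum] at e1 e2
      rw [← e1, ← e2]
      simp only [obsCount] at e3
      rw [← e3]
      ring
    have := abs_sub_le_of_sum (b := 1) (v := M.rewardVar y) (m := M.rewardVar y)
      (a := st.r2 y - 2 * M.meanReward y * st.r y + M.meanReward y ^ 2)
      (card := X.card) (H := H) (Shat := Shat) (δ := δ) hn rfl
      (abs_sub_le_of_mem (h.bounded_avg hn (fun i hi => M.sq_rewardDev_mem y
        (hg.rew_mem i y hi)) he) ⟨M.rewardVar_nonneg y, M.rewardVar_le_one y⟩) fun hφ => by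
        have := hg.rew2 y t _ (h.n_eq y).symm hn hφ
        rwa [obsSum_sub_const, ← he, ← h.n_eq] at this
    simpa using this
  · rcases Nat.eq_zero_or_pos j with rfl | hj0
    · have e : M.starVal 0 = fun _ => 0 := by ext s; rfl
      have e1 : wavg (st.P y) (fun _ => 0) = 0 := by simp [wavg]
      have e2 : wavg (M.p y) (fun _ => 0) = 0 := by simp [wavg]
      have := wsd_nonneg (p := M.p y) (f := M.starVal 0)
      have hφ := phi_nonneg X.card H Shat δ (st.n y)
      rw [e, e1, e2, sub_zero, abs_zero, ← e]
      positivity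
    · exact abs_sub_le_of_sum (b := j) (v := wvar (M.p y) (M.starVal j))
        (m := wavg (M.p y) (M.starVal j)) (a := wavg (st.P y) (M.starVal j))
        (card := X.card) (H := H) (Shat := Shat) (δ := δ) hn rfl
        (abs_sub_le_of_mem (hw y hn _ _ (M.starVal_mem π j))
          ⟨wavg_nonneg (M.p_nonneg y) fun s => (M.starVal_mem π j s).1,
            wavg_le (M.p_nonneg y) (M.p_sum y) fun s => (M.starVal_mem π j s).2⟩) fun hφ => by
          have := hg.star y j hj hj0 t _ (h.n_eq y).symm hn hφ
          rwa [obsSum_sub_const, ← h.n_mul_wavg, ← h.n_eq] at this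

end Summary

section Mgf

open scoped ENNReal

variable {X : Finset (S × A)}

lemma exp_le_one_add_add_sq {y : ℝ} (h : |y| ≤ 1) : Real.exp y ≤ 1 + y + y ^ 2 := by
  have := (abs_le.1 (Real.abs_exp_sub_one_sub_id_le h)).2
  linarith

lemma MDP.lintegral_exp_reward_le (M : MDP X) (y : X) {f : ℝ → ℝ} (hf : Measurable f) {b v : ℝ}
    (hfb : ∀ r ∈ Set.Icc (0 : ℝ) 1, 0 ≤ f r ∧ f r ≤ b) {m : ℝ} (hm : m = ∫ r, f r ∂(M.PR y))
    (hv : ∫ r, (f r - m) ^ 2 ∂(M.PR y) ≤ v) {l : ℝ} (hl : |l| * b ≤ 1) :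
    ∫⁻ r, ENNReal.ofReal (Real.exp (l * (f r - m) - l ^ 2 * v)) ∂(M.PR y) ≤ 1 := by
  have := M.PR_prob y
  have hae := M.ae_reward_mem y
  have h1 : Integrable f (M.PR y) := Integrable.of_bound hf.aestronglyMeasurable b
    (hae.mono fun r hr => by rw [Real.norm_eq_abs, abs_of_nonneg (hfb r hr).1]; exact (hfb r hr).2)
  have hm0 : 0 ≤ m := hm ▸ integral_nonneg_of_ae (hae.mono fun r hr => (hfb r hr).1)
  have hmb : m ≤ b := by
    rw [hm]
    calc ∫ r, f r ∂(M.PR y) ≤ ∫ _, b ∂(M.PR y) :=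
          integral_mono_ae h1 (integrable_const _) (hae.mono fun r hr => (hfb r hr).2)
      _ = b := by simp
  have hdev : ∀ r ∈ Set.Icc (0 : ℝ) 1, |f r - m| ≤ b := fun r hr =>
    abs_sub_le_of_mem (hfb r hr) ⟨hm0, hmb⟩
  have h2 : Integrable (fun r => (f r - m) ^ 2) (M.PR y) :=
    Integrable.of_bound (by fun_prop) (b ^ 2) (hae.mono fun r hr => by
      rw [Real.norm_eq_abs, abs_pow]
      exact pow_le_pow_left₀ (abs_nonneg _) (hdev r hr) 2)
  set q : ℝ → ℝ := fun r => 1 + l * (f r - m) + l ^ 2 * (f r - m) ^ 2 with hq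
  have hexp : ∀ r ∈ Set.Icc (0 : ℝ) 1, Real.exp (l * (f r - m)) ≤ q r := fun r hr => by
    have : |l * (f r - m)| ≤ 1 := by
      rw [abs_mul]
      exact (mul_le_mul_of_nonneg_left (hdev r hr) (abs_nonneg l)).trans hl
    have := exp_le_one_add_add_sq this
    simp only [hq]
    rw [← mul_pow]
    linarith
  have hi1 : Integrable (fun r => l * (f r - m)) (M.PR y) :=
    (h1.sub (integrable_const m)).const_mul l
  have hi2 : Integrable (fun r => l ^ 2 * (f r - m) ^ 2) (M.PR y) := h2.const_mul _
  have hi0 : Integrable (fun r => 1 + l * (f r - m)) (M.PR y) := (integrable_const 1).add hi1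
  have hqi : Integrable q (M.PR y) := hi0.add hi2
  have hqint : ∫ r, q r ∂(M.PR y) ≤ Real.exp (l ^ 2 * v) := by
    have : ∫ r, q r ∂(M.PR y) = 1 + l ^ 2 * ∫ r, (f r - m) ^ 2 ∂(M.PR y) := by
      simp only [hq]
      rw [integral_add hi0 hi2, integral_add (integrable_const 1) hi1,
        integral_const_mul, integral_const_mul, integral_sub h1 (integrable_const m), ← hm]
      simp
    rw [this]
    have h3 := mul_le_mul_of_nonneg_left hv (sq_nonneg l)
    linarith [Real.add_one_le_exp (l ^ 2 * v)]
  calc ∫⁻ r, ENNReal.ofReal (Real.exp (l * (f r - m) - l ^ 2 * v)) ∂(M.PR y)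
      ≤ ∫⁻ r, ENNReal.ofReal (q r * Real.exp (-(l ^ 2 * v))) ∂(M.PR y) := by
        refine lintegral_mono_ae (hae.mono fun r hr => ENNReal.ofReal_le_ofReal ?_)
        rw [sub_eq_add_neg, Real.exp_add]
        exact mul_le_mul_of_nonneg_right (hexp r hr) (Real.exp_pos _).le
    _ = ENNReal.ofReal (∫ r, q r * Real.exp (-(l ^ 2 * v)) ∂(M.PR y)) := by
        rw [ofReal_integral_eq_lintegral_ofReal (hqi.mul_const _)]
        exact hae.mono fun r hr => mul_nonneg ((Real.exp_pos _).le.trans (hexp r hr))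
          (Real.exp_pos _).le
    _ ≤ 1 := by
        rw [integral_mul_const, ← ENNReal.ofReal_one]
        refine ENNReal.ofReal_le_ofReal ?_
        rw [Real.exp_neg, ← div_eq_mul_inv, div_le_one (Real.exp_pos _)]
        exact hqint

lemma MDP.integral_sq_rewardDev_le (M : MDP X) (y : X) :
    ∫ r, ((r - M.meanReward y) ^ 2 - M.rewardVar y) ^ 2 ∂(M.PR y) ≤ M.rewardVar y := by
  have := M.PR_prob y
  have hae := M.ae_reward_mem y
  have h1 : Integrable (fun r : ℝ => (r - M.meanReward y) ^ 2) (M.PR y) :=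
    Integrable.of_bound (by fun_prop) 1 (hae.mono fun r hr => by
      rw [Real.norm_eq_abs, abs_of_nonneg (M.sq_rewardDev_mem y hr).1]
      exact (M.sq_rewardDev_mem y hr).2)
  have hv0 := M.rewardVar_nonneg y
  have hv1 := M.rewardVar_le_one y
  have h2 : Integrable (fun r : ℝ => ((r - M.meanReward y) ^ 2 - M.rewardVar y) ^ 2) (M.PR y) :=
    Integrable.of_bound (by fun_prop) 1 (hae.mono fun r hr => by
      have h := M.sq_rewardDev_mem y hr
      rw [Real.norm_eq_abs, abs_of_nonneg (sq_nonneg _)]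
      nlinarith)
  calc ∫ r, ((r - M.meanReward y) ^ 2 - M.rewardVar y) ^ 2 ∂(M.PR y)
      ≤ ∫ r, ((1 - 2 * M.rewardVar y) * (r - M.meanReward y) ^ 2 + M.rewardVar y ^ 2) ∂(M.PR y) := by
        refine integral_mono_ae h2 ((h1.const_mul _).add (integrable_const _)) (hae.mono fun r hr => ?_)
        have h := M.sq_rewardDev_mem y hr
        change _ ≤ _
        nlinarith
    _ = (1 - 2 * M.rewardVar y) * M.rewardVar y + M.rewardVar y ^ 2 := by
        rw [integral_add (h1.const_mul _) (integrable_const _), integral_const_mul]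
        simp [MDP.rewardVar]
    _ ≤ M.rewardVar y := by nlinarith

variable [Fintype S]

lemma MDP.sum_P_ofReal_le (M : MDP X) (y : X) {g : S → ℝ} (hg : ∀ s, 0 ≤ g s)
    (h : wavg (M.p y) g ≤ 1) : ∑ s, M.P y s * ENNReal.ofReal (g s) ≤ 1 := by
  have : ∑ s, M.P y s * ENNReal.ofReal (g s) = ENNReal.ofReal (wavg (M.p y) g) := by
    rw [wavg, ENNReal.ofReal_sum_of_nonneg fun s _ => mul_nonneg (M.p_nonneg y s) (hg s)]
    refine Finset.sum_congr rfl fun s _ => ?_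
    rw [ENNReal.ofReal_mul (M.p_nonneg y s), MDP.p, ENNReal.ofReal_toReal (PMF.apply_ne_top _ _)]
  rw [this, ← ENNReal.ofReal_one]
  exact ENNReal.ofReal_le_ofReal h

/-- Exponential moment of a bounded function under finite weights. -/
lemma wavg_exp_le {p f : S → ℝ} (hp : ∀ s, 0 ≤ p s) (hs : ∑ s, p s = 1) {b v : ℝ}
    (hfb : ∀ s, 0 ≤ f s ∧ f s ≤ b) (hv : wvar p f ≤ v) {l : ℝ} (hl : |l| * b ≤ 1) :
    wavg p (fun s => Real.exp (l * (f s - wavg p f) - l ^ 2 * v)) ≤ 1 := by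
  have hm : 0 ≤ wavg p f ∧ wavg p f ≤ b :=
    ⟨wavg_nonneg hp fun s => (hfb s).1, wavg_le hp hs fun s => (hfb s).2⟩
  have h1 : ∀ s, Real.exp (l * (f s - wavg p f) - l ^ 2 * v)
      ≤ Real.exp (-(l ^ 2 * v)) * (((1 - l * wavg p f) + l * f s)
        + l ^ 2 * (f s - wavg p f) ^ 2) := by
    intro s
    have : |l * (f s - wavg p f)| ≤ 1 := by
      rw [abs_mul]
      exact (mul_le_mul_of_nonneg_left (abs_sub_le_of_mem (hfb s) hm) (abs_nonneg l)).trans hl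
    have := exp_le_one_add_add_sq this
    rw [sub_eq_neg_add, Real.exp_add]
    refine mul_le_mul_of_nonneg_left (this.trans (le_of_eq (by ring))) (Real.exp_pos _).le
  refine (wavg_mono hp h1).trans ?_
  rw [wavg_const_mul, wavg_add, wavg_add, wavg_const hs, wavg_const_mul, wavg_const_mul,
    ← wvar_eq hs, Real.exp_neg, inv_mul_le_iff₀ (Real.exp_pos _), mul_one]
  have h3 := mul_le_mul_of_nonneg_left hv (sq_nonneg l)
  linarith [Real.add_one_le_exp (l ^ 2 * v)]

end Mgf

namespace Run

open scoped ENNReal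

variable {X : Finset (S × A)} [Fintype S] {M : MDP X} {G : Digraph X} {H Shat : ℕ} {δ : ℝ}
  {s₀ : S} {Ω : Type w} [mΩ : MeasurableSpace Ω] {μ : Measure Ω}
  (ρ : Run M G H Shat δ s₀ μ)

lemma measure_not_sumDev_le [IsProbabilityMeasure μ] (hH : 0 < H) (hc : 1 ≤ X.card) (hδ : 0 < δ)
    (hδ1 : δ ≤ 1) (y : X) {Z : ℕ → Ω → ℝ} (hZ : ∀ t, Measurable[ρ.𝓕 (t + 1)] (Z t))
    {b v : ℝ} (hb : 0 < b) (hv : 0 ≤ v)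
    (hmgf : ∀ l : ℝ, |l| * b ≤ 1 → ∀ t F, MeasurableSet[ρ.𝓕 t] F → F ⊆ ρ.obs t y →
      ∫⁻ ω in F, ENNReal.ofReal (Real.exp (l * Z t ω - l ^ 2 * v)) ∂μ ≤ μ F) :
    μ {ω | ¬ SumDev G H Shat δ (fun t => ρ.play t ω) y (fun t => Z t ω) b v}
      ≤ 2 * ENNReal.ofReal (failProb X.card H Shat δ) := by
  classical
  refine le_trans (measure_mono ?_) (measure_bernstein_abs_fail_le (H := H) (Shat := Shat) ρ.𝓕 hc
    hδ hδ1 (fun t => ρ.obs_meas hH t y) hZ hb hv hmgf)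
  intro ω hω
  simp only [SumDev, Set.mem_ofPred_eq, not_forall, not_le] at hω
  obtain ⟨t, n, hn, hn1, hφ, hlt⟩ := hω
  refine ⟨t, n, ?_, hn1, hφ, ?_⟩
  · rw [← hn, obsCount]
    congr 1
  · refine hlt.trans_eq (congrArg abs ?_)
    rw [obsSum, Finset.sum_filter]
    refine Finset.sum_congr rfl fun i _ => ?_
    simp [Set.indicator_apply, obs]

lemma measure_not_sumDev_nxt_le [IsProbabilityMeasure μ] (hH : 0 < H) (hc : 1 ≤ X.card)
    (hδ : 0 < δ) (hδ1 : δ ≤ 1) (y : X) (f : S → ℝ) {b v : ℝ} (hb : 0 < b)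
    (hfb : ∀ s, 0 ≤ f s ∧ f s ≤ b) (hv : wvar (M.p y) f ≤ v) :
    μ {ω | ¬ SumDev G H Shat δ (fun t => ρ.play t ω) y
        (fun t => f (ρ.nxt t y ω) - wavg (M.p y) f) b v}
      ≤ 2 * ENNReal.ofReal (failProb X.card H Shat δ) := by
  refine ρ.measure_not_sumDev_le hH hc hδ hδ1 y (fun t => ?_) hb
    ((wvar_nonneg (M.p_nonneg y) (M.p_sum y)).trans hv) fun l hl t F hF hFO => ?_
  · exact (measurable_comp_index (f := fun s _ => f s) (fun s => ρ.nxt_meas hH t y s)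
      fun s => measurable_const).sub_const _
  · rw [ρ.lintegral_nxt hH t y hF hFO (f := fun s _ => ENNReal.ofReal
      (Real.exp (l * (f s - wavg (M.p y) f) - l ^ 2 * v))) fun s => measurable_const,
      ← setLIntegral_one]
    refine lintegral_mono fun ω => ?_
    exact M.sum_P_ofReal_le y (fun s => (Real.exp_pos _).le)
      (wavg_exp_le (M.p_nonneg y) (M.p_sum y) hfb hv hl)

lemma measure_not_sumDev_rew_le [IsProbabilityMeasure μ] (hH : 0 < H) (hc : 1 ≤ X.card)
    (hδ : 0 < δ) (hδ1 : δ ≤ 1) (y : X) {f : ℝ → ℝ} (hf : Measurable f) {v : ℝ}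
    (hfb : ∀ r ∈ Set.Icc (0 : ℝ) 1, 0 ≤ f r ∧ f r ≤ 1) {m : ℝ} (hm : m = ∫ r, f r ∂(M.PR y))
    (hv : ∫ r, (f r - m) ^ 2 ∂(M.PR y) ≤ v) :
    μ {ω | ¬ SumDev G H Shat δ (fun t => ρ.play t ω) y (fun t => f (ρ.rew t y ω) - m) 1 v}
      ≤ 2 * ENNReal.ofReal (failProb X.card H Shat δ) := by
  refine ρ.measure_not_sumDev_le hH hc hδ hδ1 y (fun t => ?_) one_pos
    ((integral_nonneg fun _ => sq_nonneg _).trans hv) fun l hl t F hF hFO => ?_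
  · exact (hf.comp (ρ.rew_meas hH t y)).sub_const _
  · rw [ρ.lintegral_rew hH t y hF hFO (g := fun r => ENNReal.ofReal
      (Real.exp (l * (f r - m) - l ^ 2 * v))) (by fun_prop)]
    exact mul_le_of_le_one_right' (M.lintegral_exp_reward_le y hf hfb hm hv hl)

lemma measure_rew_notMem (hH : 0 < H) :
    μ {ω | ∃ i y, Observes G (ρ.play i ω) y ∧ ρ.rew i y ω ∉ Set.Icc (0 : ℝ) 1} = 0 := by
  have : {ω | ∃ i y, Observes G (ρ.play i ω) y ∧ ρ.rew i y ω ∉ Set.Icc (0 : ℝ) 1}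
      = ⋃ i, ⋃ y, ρ.obs i y ∩ ρ.rew i y ⁻¹' (Set.Icc 0 1)ᶜ := by
    ext ω; simp [obs]
  rw [this]
  refine measure_iUnion_null fun i => measure_iUnion_null fun y => ?_
  rw [ρ.rew_law hH i y (ρ.obs_meas hH i y) subset_rfl measurableSet_Icc.compl, M.PR_bdd y, mul_zero]

lemma measure_nxt_notMem (hH : 0 < H) :
    μ {ω | ∃ i y, Observes G (ρ.play i ω) y ∧ M.p y (ρ.nxt i y ω) = 0} = 0 := by
  have : {ω | ∃ i y, Observes G (ρ.play i ω) y ∧ M.p y (ρ.nxt i y ω) = 0}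
      = ⋃ i, ⋃ y, ⋃ s ∈ {s | M.p y s = 0}, ρ.obs i y ∩ {ω | ρ.nxt i y ω = s} := by
    ext ω; simp [obs]
  rw [this]
  refine measure_iUnion_null fun i => measure_iUnion_null fun y =>
    (measure_biUnion_null_iff (Set.to_countable _)).2 fun s hs => ?_
  have h0 : M.P y s = 0 := by
    rcases (ENNReal.toReal_eq_zero_iff _).1 hs with h | h
    · exact h
    · exact absurd h (PMF.apply_ne_top _ _)
  rw [ρ.nxt_law hH i y (ρ.obs_meas hH i y) subset_rfl, h0, mul_zero]

/-- The deviation bounds fail with small probability. -/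
theorem measure_not_goodObs_le [IsProbabilityMeasure μ] (hH : 0 < H) (hc : 1 ≤ X.card)
    (hδ : 0 < δ) (hδ1 : δ ≤ 1) (π : Policy X) (hsupp : ∀ x, (M.P x).support.ncard ≤ Shat) :
    μ {ω | ¬ GoodObs M G H Shat δ (fun t => ρ.play t ω) (fun t y => ρ.rew t y ω)
        (fun t y => ρ.nxt t y ω)}
      ≤ X.card * (4 + 2 * H + 2 * Shat) * ENNReal.ofReal (failProb X.card H Shat δ) := by
  classical
  set F := ENNReal.ofReal (failProb X.card H Shat δ)
  set B0 := {ω | ∃ i y, Observes G (ρ.play i ω) y ∧ ρ.rew i y ω ∉ Set.Icc (0 : ℝ) 1}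
  set B1 := {ω | ∃ i y, Observes G (ρ.play i ω) y ∧ M.p y (ρ.nxt i y ω) = 0}
  set B2 : X → Set Ω := fun y => {ω | ¬ SumDev G H Shat δ (fun t => ρ.play t ω) y
    (fun t => ρ.rew t y ω - M.meanReward y) 1 (M.rewardVar y)}
  set B3 : X → Set Ω := fun y => {ω | ¬ SumDev G H Shat δ (fun t => ρ.play t ω) y
    (fun t => (ρ.rew t y ω - M.meanReward y) ^ 2 - M.rewardVar y) 1 (M.rewardVar y)}
  set B4 : X → ℕ → Set Ω := fun y j => {ω | 1 ≤ j ∧ ¬ SumDev G H Shat δ (fun t => ρ.play t ω) y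
    (fun t => M.starVal j (ρ.nxt t y ω) - wavg (M.p y) (M.starVal j)) j
    (wvar (M.p y) (M.starVal j))}
  set B5 : X → S → Set Ω := fun y s => {ω | ¬ SumDev G H Shat δ (fun t => ρ.play t ω) y
    (fun t => (if s = ρ.nxt t y ω then 1 else 0) - M.p y s) 1 (M.p y s)}
  set T : X → Finset S := fun y => Finset.univ.filter fun s => M.p y s ≠ 0
  have h2 : ∀ y, μ (B2 y) ≤ 2 * F := fun y =>
    ρ.measure_not_sumDev_rew_le hH hc hδ hδ1 y (f := fun r => r) measurable_id (fun r hr => hr) rfl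
      le_rfl
  have h3 : ∀ y, μ (B3 y) ≤ 2 * F := fun y =>
    ρ.measure_not_sumDev_rew_le hH hc hδ hδ1 y (f := fun r => (r - M.meanReward y) ^ 2)
      (by fun_prop) (fun r hr => M.sq_rewardDev_mem y hr) rfl (M.integral_sq_rewardDev_le y)
  have h4 : ∀ y j, μ (B4 y j) ≤ 2 * F := fun y j => by
    by_cases hj : 1 ≤ j
    · refine (measure_mono fun ω hω => hω.2).trans (ρ.measure_not_sumDev_nxt_le hH hc hδ hδ1 y
        (M.starVal j) (b := j) (by exact_mod_cast hj) (M.starVal_mem π j) le_rfl)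
    · have : B4 y j = ∅ := by ext ω; simp [B4, hj]
      simp [this]
  have h5 : ∀ y s, μ (B5 y s) ≤ 2 * F := fun y s => by
    have e1 : wavg (M.p y) (fun s' => if s = s' then 1 else 0) = M.p y s := by
      simp [wavg]
    have e2 : wvar (M.p y) (fun s' => if s = s' then 1 else 0) ≤ M.p y s := by
      have : wavg (M.p y) (fun s' => (if s = s' then (1 : ℝ) else 0) ^ 2) = M.p y s := by
        simp [wavg]
      rw [wvar, this]
      nlinarith [sq_nonneg (wavg (M.p y) (fun s' => if s = s' then 1 else 0))]
    have := ρ.measure_not_sumDev_nxt_le hH hc hδ hδ1 y (fun s' => if s = s' then 1 else 0) one_pos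
      (fun s' => by split <;> norm_num) e2
    rwa [e1] at this
  have hT : ∀ y, ((T y).card : ℝ≥0∞) ≤ Shat := fun y => by
    refine Nat.cast_le.2 (le_trans (le_of_eq ?_) (hsupp y))
    rw [← Set.ncard_coe_finset]
    congr 1
    ext s
    simp only [T, Finset.coe_filter, Finset.mem_univ, true_and, Set.mem_ofPred_eq,
      PMF.mem_support_iff, MDP.p, ne_eq, ENNReal.toReal_eq_zero_iff, PMF.apply_ne_top, or_false]
  have hsub : {ω | ¬ GoodObs M G H Shat δ (fun t => ρ.play t ω) (fun t y => ρ.rew t y ω)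
        (fun t y => ρ.nxt t y ω)} ⊆ B0 ∪ (B1 ∪ ⋃ y ∈ (Finset.univ : Finset X),
          (B2 y ∪ (B3 y ∪ ((⋃ j ∈ Finset.range H, B4 y j) ∪ ⋃ s ∈ T y, B5 y s)))) := by
    intro ω hω
    by_contra hnot
    simp only [Set.mem_union, Set.mem_iUnion, not_or, not_exists] at hnot
    obtain ⟨n0, n1, n2⟩ := hnot
    refine hω ⟨fun i y h => ?_, fun i y h h0 => n1 ⟨i, y, h, h0⟩, fun y => ?_, fun y => ?_,
      fun y j hj hj1 => ?_, fun y s hs => ?_⟩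
    · by_contra h'; exact n0 ⟨i, y, h, h'⟩
    · exact not_not.1 (n2 y (Finset.mem_univ y)).1
    · exact not_not.1 (n2 y (Finset.mem_univ y)).2.1
    · by_contra h'; exact (n2 y (Finset.mem_univ y)).2.2.1 j (Finset.mem_range.2 hj) ⟨hj1, h'⟩
    · exact not_not.1 ((n2 y (Finset.mem_univ y)).2.2.2 s (by simpa [T] using hs))
  have hy : ∀ y, μ (B2 y ∪ (B3 y ∪ ((⋃ j ∈ Finset.range H, B4 y j) ∪ ⋃ s ∈ T y, B5 y s)))
      ≤ (4 + 2 * H + 2 * Shat) * F := by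
    intro y
    have e4 : μ (⋃ j ∈ Finset.range H, B4 y j) ≤ H * (2 * F) := by
      refine (measure_biUnion_finset_le _ _).trans ((Finset.sum_le_card_nsmul _ _ _
        fun j _ => h4 y j).trans_eq ?_)
      rw [Finset.card_range, nsmul_eq_mul]
    have e5 : μ (⋃ s ∈ T y, B5 y s) ≤ Shat * (2 * F) := by
      refine (measure_biUnion_finset_le _ _).trans ((Finset.sum_le_card_nsmul _ _ _
        fun s _ => h5 y s).trans ?_)
      rw [nsmul_eq_mul]
      exact mul_le_mul_left (hT y) _
    calc _ ≤ 2 * F + (2 * F + (H * (2 * F) + Shat * (2 * F))) := by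
          refine (measure_union_le _ _).trans (add_le_add (h2 y) ?_)
          refine (measure_union_le _ _).trans (add_le_add (h3 y) ?_)
          exact (measure_union_le _ _).trans (add_le_add e4 e5)
      _ = _ := by ring
  refine (measure_mono hsub).trans ?_
  refine (measure_union_le _ _).trans ?_
  rw [ρ.measure_rew_notMem hH, zero_add]
  refine (measure_union_le _ _).trans ?_
  rw [ρ.measure_nxt_notMem hH, zero_add]
  refine (measure_biUnion_finset_le _ _).trans ((Finset.sum_le_card_nsmul _ _ _
    fun y _ => hy y).trans_eq ?_)
  rw [nsmul_eq_mul, Finset.card_univ, Fintype.card_coe, mul_assoc]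

end Run

section MeasStats

variable {X : Finset (S × A)} {Ω : Type w}

/-- All entries of the random model `f` are measurable. -/
structure MeasStats (m : MeasurableSpace Ω) (f : Ω → Stats X) : Prop where
  n : ∀ y, Measurable[m] fun ω => (f ω).n y
  r : ∀ y, Measurable[m] fun ω => (f ω).r y
  r2 : ∀ y, Measurable[m] fun ω => (f ω).r2 y
  P : ∀ y s, Measurable[m] fun ω => (f ω).P y s

lemma measurable_runAvg {m : MeasurableSpace Ω} {n : Ω → ℕ} {a b : Ω → ℝ} (hn : Measurable[m] n)
    (ha : Measurable[m] a) (hb : Measurable[m] b) :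
    Measurable[m] fun ω => runAvg (n ω) (a ω) (b ω) := by
  have hn' : Measurable[m] fun ω => (n ω : ℝ) := measurable_from_nat.comp hn
  unfold runAvg
  exact (((hn'.sub_const 1).div hn').mul ha).add ((hn'.const_div 1).mul hb)

lemma MeasStats.mono {m m' : MeasurableSpace Ω} (h : m ≤ m') {f : Ω → Stats X}
    (hf : MeasStats m f) : MeasStats m' f :=
  ⟨fun y => (hf.n y).mono h le_rfl, fun y => (hf.r y).mono h le_rfl,
    fun y => (hf.r2 y).mono h le_rfl, fun y s => (hf.P y s).mono h le_rfl⟩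

lemma MeasStats.observe {m : MeasurableSpace Ω} {f : Ω → Stats X} (hf : MeasStats m f)
    {G : Digraph X} {x : Ω → X} {R : X → Ω → ℝ} {N : X → Ω → S}
    (hx : ∀ y, MeasurableSet[m] {ω | Observes G (x ω) y}) (hR : ∀ y, Measurable[m] (R y))
    (hN : ∀ y s, MeasurableSet[m] {ω | N y ω = s}) :
    MeasStats m fun ω => (f ω).observe G (x ω) (fun y => R y ω) fun y => N y ω := by
  classical
  have hn1 : ∀ y, Measurable[m] fun ω => (f ω).n y + 1 := fun y => (hf.n y).add_const 1
  refine ⟨fun y => ?_, fun y => ?_, fun y => ?_, fun y s => ?_⟩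
  · exact Measurable.ite (hx y) (hn1 y) (hf.n y)
  · exact Measurable.ite (hx y) (measurable_runAvg (hn1 y) (hf.r y) (hR y)) (hf.r y)
  · exact Measurable.ite (hx y) (measurable_runAvg (hn1 y) (hf.r2 y) ((hR y).pow_const 2)) (hf.r2 y)
  · refine Measurable.ite (hx y) (measurable_runAvg (hn1 y) (hf.P y s) ?_) (hf.P y s)
    refine Measurable.ite ?_ measurable_const measurable_const
    simpa only [eq_comm] using hN y s

variable [Fintype S]

lemma measurable_wavg {m : MeasurableSpace Ω} {p f : S → Ω → ℝ} (hp : ∀ s, Measurable[m] (p s))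
    (hf : ∀ s, Measurable[m] (f s)) :
    Measurable[m] fun ω => wavg (fun s => p s ω) fun s => f s ω :=
  Finset.measurable_fun_sum _ fun s _ => (hp s).mul (hf s)

lemma measurable_bonus {m : MeasurableSpace Ω} {f : Ω → Stats X} (hf : MeasStats m f)
    {V : Ω → (S → ℝ) × (S → ℝ)} (h1 : ∀ s, Measurable[m] fun ω => (V ω).1 s)
    (h2 : ∀ s, Measurable[m] fun ω => (V ω).2 s) (H Shat : ℕ) (δ : ℝ) (x : X) :
    Measurable[m] fun ω => bonus H Shat δ (f ω) (V ω) x := by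
  have hφ : Measurable[m] fun ω => phi X.card H Shat δ ((f ω).n x) :=
    (measurable_from_nat (f := phi X.card H Shat δ)).comp (hf.n x)
  have e1 := measurable_wavg (fun s => hf.P x s) h1
  have e2 := measurable_wavg (fun s => hf.P x s) fun s => (h1 s).pow_const 2
  have e3 := measurable_wavg (fun s => hf.P x s) fun s => (h1 s).sub (h2 s)
  exact ((((((hf.r2 x).sub ((hf.r x).pow_const 2)).sqrt.add
    (e2.sub (e1.pow_const 2)).sqrt).const_mul 4).mul hφ).add
    ((hφ.pow_const 2).const_mul _)).add (e3.const_mul _)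

lemma measurable_valueBounds {m : MeasurableSpace Ω} {f : Ω → Stats X} (hf : MeasStats m f)
    {π : Ω → Policy X} {H : ℕ}
    (hπ : ∀ h < H, ∀ s x, MeasurableSet[m] {ω | (π ω).pair h s = x}) (Shat : ℕ) (δ : ℝ) (j : ℕ)
    (hj : j ≤ H) (s : S) :
    Measurable[m] (fun ω => (valueBounds H Shat δ (f ω) (π ω) j).1 s) ∧
    Measurable[m] (fun ω => (valueBounds H Shat δ (f ω) (π ω) j).2 s) := by
  induction j generalizing s with
  | zero => exact ⟨measurable_const, measurable_const⟩
  | succ j ih =>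
    have h1 := fun s => (ih (by omega) s).1
    have h2 := fun s => (ih (by omega) s).2
    have hb := measurable_bonus hf h1 h2 H Shat δ
    constructor
    · exact measurable_comp_index (f := fun x ω =>
        upperQ H Shat δ (f ω) (j + 1) (valueBounds H Shat δ (f ω) (π ω) j) x)
        (hπ _ (by omega) s) fun x => measurable_const.max ((((hf.r x).add
          (measurable_wavg (fun s => hf.P x s) h1)).add (hb x)).min measurable_const)
    · exact measurable_comp_index (f := fun x ω =>
        lowerQ H Shat δ (f ω) (j + 1) (valueBounds H Shat δ (f ω) (π ω) j) x)
        (hπ _ (by omega) s) fun x => measurable_const.max ((((hf.r x).add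
          (measurable_wavg (fun s => hf.P x s) h2)).sub (hb x)).min measurable_const)

lemma measurable_polVal (M : MDP X) {m : MeasurableSpace Ω} {π : Ω → Policy X} {H : ℕ}
    (hπ : ∀ h < H, ∀ s x, MeasurableSet[m] {ω | (π ω).pair h s = x}) (j : ℕ) (hj : j ≤ H) (s : S) :
    Measurable[m] fun ω => M.polVal H (π ω) j s := by
  induction j generalizing s with
  | zero => exact measurable_const
  | succ j ih =>
    exact measurable_comp_index (f := fun x ω => M.meanReward x + wavg (M.p x) (M.polVal H (π ω) j))
      (hπ _ (by omega) s) fun x => (measurable_wavg (fun _ => measurable_const)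
        fun s => ih (by omega) s).const_add _

end MeasStats

namespace Run

open scoped ENNReal

variable {X : Finset (S × A)} [Fintype S] {M : MDP X} {G : Digraph X} {H Shat : ℕ} {δ : ℝ}
  {s₀ : S} {Ω : Type w} [mΩ : MeasurableSpace Ω] {μ : Measure Ω}
  (ρ : Run M G H Shat δ s₀ μ)

lemma mul_add_div {k h : ℕ} (hh : h < H) : (k * H + h) / H = k ∧ (k * H + h) % H = h := by
  constructor
  · rw [mul_comm, Nat.mul_add_div (by omega), Nat.div_eq_of_lt hh, add_zero]
  · rw [mul_comm, Nat.mul_add_mod, Nat.mod_eq_of_lt hh]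

lemma play_mul_add (k : ℕ) {h : ℕ} (hh : h < H) (ω : Ω) :
    ρ.play (k * H + h) ω = (ρ.policy k ω).pair h (ρ.state k h ω) := by
  rw [play, (mul_add_div hh).1, (mul_add_div hh).2]

lemma rew_mul_add (k : ℕ) {h : ℕ} (hh : h < H) (y : X) (ω : Ω) :
    ρ.rew (k * H + h) y ω = ρ.reward k h y ω := by
  rw [rew, (mul_add_div hh).1, (mul_add_div hh).2]

lemma nxt_mul_add (k : ℕ) {h : ℕ} (hh : h < H) (y : X) (ω : Ω) :
    ρ.nxt (k * H + h) y ω = ρ.next k h y ω := by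
  rw [nxt, (mul_add_div hh).1, (mul_add_div hh).2]

/-- Induction along the updates of the model. -/
lemma stats_induction {Q : ℕ → (Ω → Stats X) → Prop} (h0 : Q 0 fun _ => Stats.init s₀)
    (hstep : ∀ t f, Q t f → Q (t + 1) fun ω => (f ω).observe G (ρ.play t ω)
      (fun y => ρ.rew t y ω) fun y => ρ.nxt t y ω) (k : ℕ) : Q (k * H) (ρ.stats k) := by
  induction k with
  | zero => rw [zero_mul]; exact h0
  | succ k ih =>
    have key : ∀ h ≤ H, Q (k * H + h) fun ω => (ρ.stats k ω).run G
        (fun h => (ρ.policy k ω).pair h (ρ.state k h ω)) (fun h y => ρ.reward k h y ω)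
        (fun h y => ρ.next k h y ω) h := by
      intro h
      induction h with
      | zero => intro _; exact ih
      | succ h ih' =>
        intro hh
        have := hstep _ _ (ih' (by omega))
        simp only [ρ.play_mul_add k (show h < H by omega), ρ.rew_mul_add k (show h < H by omega),
          ρ.nxt_mul_add k (show h < H by omega)] at this
        exact this
    rw [Nat.succ_mul]
    exact key H le_rfl

lemma isSummary_stats (k : ℕ) (ω : Ω) :
    IsSummary G s₀ (fun t => ρ.play t ω) (fun t y => ρ.rew t y ω) (fun t y => ρ.nxt t y ω) (k * H)
      (ρ.stats k ω) :=
  ρ.stats_induction (Q := fun t f => IsSummary G s₀ (fun t => ρ.play t ω) (fun t y => ρ.rew t y ω)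
    (fun t y => ρ.nxt t y ω) t (f ω)) isSummary_init (fun _ _ h => h.observe) k

lemma measStats_stats (hH : 0 < H) (k : ℕ) : MeasStats (ρ.𝓕 (k * H)) (ρ.stats k) := by
  refine ρ.stats_induction (Q := fun t f => MeasStats (ρ.𝓕 t) f)
    ⟨fun _ => measurable_const, fun _ => measurable_const, fun _ => measurable_const,
      fun _ _ => measurable_const⟩ (fun t f hf => ?_) k
  exact (hf.mono (ρ.𝓕.mono (Nat.le_succ t))).observe
    (fun y => ρ.𝓕.mono (Nat.le_succ t) _ (ρ.obs_meas hH t y)) (ρ.rew_meas hH t) (ρ.nxt_meas hH t)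

/-- Ville's inequality along the played pairs and their successors. -/
theorem measure_exists_play_sum_ge_le [IsProbabilityMeasure μ] (hH : 0 < H)
    {u : ℕ → X → S → Ω → ℝ} (hu : ∀ t x s, Measurable[ρ.𝓕 t] (u t x s))
    (hE : ∀ t x ω, wavg (M.p x) (fun s => Real.exp (u t x s ω)) ≤ 1) (ℓ : ℝ) :
    μ {ω | ∃ T, ℓ ≤ ∑ t ∈ Finset.range T, u t (ρ.play t ω) (ρ.nxt t (ρ.play t ω) ω) ω}
      ≤ ENNReal.ofReal (Real.exp (-ℓ)) := by
  refine measure_exists_sum_ge_le (Z := fun t ω => u t (ρ.play t ω) (ρ.nxt t (ρ.play t ω) ω) ω)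
    ρ.𝓕 (fun t => ?_) (fun t F hF => ?_) ℓ
  · have hle := ρ.𝓕.mono (Nat.le_succ t)
    exact measurable_comp_index (f := fun x ω => u t x (ρ.nxt t x ω) ω)
      (fun x => hle _ (ρ.play_meas hH t x)) fun x => measurable_comp_index (f := fun s ω => u t x s ω)
        (fun s => ρ.nxt_meas hH t x s) fun s => (hu t x s).mono hle le_rfl
  · exact ρ.lintegral_play_le hH t hF (f := fun x s ω => ENNReal.ofReal (Real.exp (u t x s ω)))
      (fun x s => (Real.measurable_exp.comp (hu t x s)).ennreal_ofReal)
      fun x ω => M.sum_P_ofReal_le x (fun s => (Real.exp_pos _).le) (hE t x ω)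

/-- Steps to go after the step played at the global time `t`. -/
def toGo (H t : ℕ) : ℕ := H - (t % H + 1)

/-- Width of the value bounds of episode `k` with `j` steps to go. -/
def width (k j : ℕ) (s : S) (ω : Ω) : ℝ :=
  |(valueBounds H Shat δ (ρ.stats k ω) (ρ.policy k ω) j).1 s
    - (valueBounds H Shat δ (ρ.stats k ω) (ρ.policy k ω) j).2 s|

lemma width_nonneg (k j : ℕ) (s : S) (ω : Ω) : 0 ≤ ρ.width k j s ω := abs_nonneg _

lemma width_le (k j : ℕ) (s : S) (ω : Ω) : ρ.width k j s ω ≤ j := by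
  have h := valueBounds_mem (H := H) (Shat := Shat) (δ := δ) (st := ρ.stats k ω) (ρ.policy k ω) j s
  exact abs_sub_le_of_mem ⟨h.1, h.2.1⟩ h.2.2

lemma width_meas (hH : 0 < H) (k : ℕ) {j : ℕ} (hj : j ≤ H) (s : S) :
    Measurable[ρ.𝓕 (k * H)] (ρ.width k j s) := by
  have h := measurable_valueBounds (ρ.measStats_stats hH k)
    (fun h hh s x => ρ.policy_pair_meas k hh s x) Shat δ j hj s
  exact measurable_abs.comp (h.1.sub h.2)

/-- Weight of step `h` in the sum of the widths. -/
def stepWeight (H h : ℕ) : ℝ := (1 + 16 / (H : ℝ)) ^ h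

lemma one_le_stepWeight (H h : ℕ) : 1 ≤ stepWeight H h :=
  one_le_pow₀ (le_add_of_nonneg_right (by positivity))

lemma stepWeight_le {H h : ℕ} (hH : 0 < H) (hh : h ≤ H) : stepWeight H h ≤ Real.exp 16 := by
  have hH' : (0 : ℝ) < H := by exact_mod_cast hH
  have h1 : (1 : ℝ) + 16 / H ≤ Real.exp (16 / H) := by linarith [Real.add_one_le_exp (16 / (H : ℝ))]
  calc stepWeight H h ≤ (1 + 16 / (H : ℝ)) ^ H :=
        pow_le_pow_right₀ (le_add_of_nonneg_right (by positivity)) hh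
    _ ≤ Real.exp (16 / H) ^ H := pow_le_pow_left₀ (by positivity) h1 H
    _ = Real.exp 16 := by rw [← Real.exp_nat_mul]; congr 1; field_simp

lemma wavg_exp_neg_le {p f : S → ℝ} (hp : ∀ s, 0 ≤ p s) (hs : ∑ s, p s = 1) {θ : ℝ}
    (hθ : θ ≤ 1) (hf : ∀ s, 0 ≤ f s ∧ f s ≤ θ) :
    wavg p (fun s => Real.exp ((1 - θ) * wavg p f - f s)) ≤ 1 := by
  have h1 : ∀ s, Real.exp ((1 - θ) * wavg p f - f s)
      ≤ Real.exp ((1 - θ) * wavg p f) * (1 - (1 - θ) * f s) := by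
    intro s
    have h := hf s
    have h2 := exp_le_one_add_add_sq (y := - f s) (by rw [abs_neg, abs_of_nonneg h.1]; linarith)
    rw [sub_eq_add_neg, Real.exp_add]
    exact mul_le_mul_of_nonneg_left (h2.trans (by nlinarith)) (Real.exp_pos _).le
  refine (wavg_mono hp h1).trans ?_
  rw [wavg_const_mul, wavg_sub, wavg_const hs, wavg_const_mul]
  have h3 := Real.one_sub_le_exp_neg ((1 - θ) * wavg p f)
  calc _ ≤ Real.exp ((1 - θ) * wavg p f) * Real.exp (-((1 - θ) * wavg p f)) :=
        mul_le_mul_of_nonneg_left h3 (Real.exp_pos _).le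
    _ = 1 := by rw [← Real.exp_add, add_neg_cancel, Real.exp_zero]

/-- Scaling of the widths in the exponential supermartingale. -/
def scale (H : ℕ) : ℝ := 1 / (2 * Real.exp 16 * (H : ℝ) ^ 2)

/-- The expected widths are controlled by the widths met on the trajectory. -/
theorem measure_width_fail_le [IsProbabilityMeasure μ] (hH : 0 < H) (ℓ : ℝ) :
    μ {ω | ∃ T, ℓ ≤ ∑ t ∈ Finset.range T,
      ((1 - 1 / (2 * (H : ℝ))) * wavg (M.p (ρ.play t ω)) (fun s =>
          scale H * stepWeight H (t % H + 1) * ρ.width (t / H) (toGo H t) s ω)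
        - scale H * stepWeight H (t % H + 1)
          * ρ.width (t / H) (toGo H t) (ρ.nxt t (ρ.play t ω) ω) ω)}
      ≤ ENNReal.ofReal (Real.exp (-ℓ)) := by
  have hH' : (1 : ℝ) ≤ H := by exact_mod_cast hH
  refine ρ.measure_exists_play_sum_ge_le hH (u := fun t x s ω =>
      (1 - 1 / (2 * (H : ℝ))) * wavg (M.p x) (fun s =>
          scale H * stepWeight H (t % H + 1) * ρ.width (t / H) (toGo H t) s ω)
        - scale H * stepWeight H (t % H + 1) * ρ.width (t / H) (toGo H t) s ω)
    (fun t x s => ?_) (fun t x ω => ?_) ℓ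
  · have hw : ∀ s, Measurable[ρ.𝓕 t] fun ω =>
        scale H * stepWeight H (t % H + 1) * ρ.width (t / H) (toGo H t) s ω := fun s =>
      ((ρ.width_meas hH (t / H) (Nat.sub_le _ _) s).mono
        (ρ.𝓕.mono (Nat.div_mul_le_self t H)) le_rfl).const_mul _
    exact ((measurable_wavg (fun _ => measurable_const) hw).const_mul _).sub (hw s)
  · refine wavg_exp_neg_le (M.p_nonneg x) (M.p_sum x) ?_ fun s => ⟨?_, ?_⟩
    · rw [div_le_one (by positivity)]; linarith
    · have := one_le_stepWeight H (t % H + 1)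
      have := ρ.width_nonneg (t / H) (toGo H t) s ω
      unfold scale
      positivity
    · have h1 : stepWeight H (t % H + 1) ≤ Real.exp 16 := stepWeight_le hH (Nat.mod_lt t hH)
      have h2 : ρ.width (t / H) (toGo H t) s ω ≤ H :=
        (ρ.width_le _ _ s ω).trans (by exact_mod_cast Nat.sub_le _ _)
      have h3 := mul_le_mul h1 h2 (ρ.width_nonneg _ _ s ω) (Real.exp_pos _).le
      calc _ = scale H * (stepWeight H (t % H + 1) * ρ.width (t / H) (toGo H t) s ω) := by ring
        _ ≤ scale H * (Real.exp 16 * H) :=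
          mul_le_mul_of_nonneg_left h3 (by unfold scale; positivity)
        _ = 1 / (2 * (H : ℝ)) := by
          unfold scale
          have := Real.exp_pos 16
          field_simp

lemma wvar_sq_le {p f : S → ℝ} (hp : ∀ s, 0 ≤ p s) (hs : ∑ s, p s = 1) {B : ℝ}
    (hf : ∀ s, 0 ≤ f s ∧ f s ≤ B) :
    wvar p (fun s => f s ^ 2) ≤ 4 * B ^ 2 * wvar p f := by
  have hm : 0 ≤ wavg p f ∧ wavg p f ≤ B :=
    ⟨wavg_nonneg hp fun s => (hf s).1, wavg_le hp hs fun s => (hf s).2⟩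
  refine (wvar_le_wavg_sq_sub hs (wavg p f ^ 2)).trans ?_
  rw [wvar_eq hs, ← wavg_const_mul]
  refine wavg_mono hp fun s => ?_
  have h := hf s
  have h1 : (f s + wavg p f) ^ 2 ≤ 4 * B ^ 2 := by nlinarith
  calc (f s ^ 2 - wavg p f ^ 2) ^ 2 = (f s + wavg p f) ^ 2 * (f s - wavg p f) ^ 2 := by ring
    _ ≤ _ := mul_le_mul_of_nonneg_right h1 (sq_nonneg _)

/-- Concentration of the squared values along the trajectory. -/
theorem measure_sqValue_fail_le [IsProbabilityMeasure μ] (hH : 0 < H) (ℓ : ℝ) :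
    μ {ω | ∃ T, ℓ ≤ ∑ t ∈ Finset.range T,
      (-(1 / (8 * (H : ℝ) ^ 2)) * (M.polVal H (ρ.policy (t / H) ω) (toGo H t)
          (ρ.nxt t (ρ.play t ω) ω) ^ 2
        - wavg (M.p (ρ.play t ω)) (fun s => M.polVal H (ρ.policy (t / H) ω) (toGo H t) s ^ 2))
        - (-(1 / (8 * (H : ℝ) ^ 2))) ^ 2 * (4 * (H : ℝ) ^ 2
          * wvar (M.p (ρ.play t ω)) (M.polVal H (ρ.policy (t / H) ω) (toGo H t))))}
      ≤ ENNReal.ofReal (Real.exp (-ℓ)) := by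
  have hH' : (1 : ℝ) ≤ H := by exact_mod_cast hH
  refine ρ.measure_exists_play_sum_ge_le hH (u := fun t x s ω =>
      (-(1 / (8 * (H : ℝ) ^ 2)) * (M.polVal H (ρ.policy (t / H) ω) (toGo H t) s ^ 2
        - wavg (M.p x) (fun s => M.polVal H (ρ.policy (t / H) ω) (toGo H t) s ^ 2))
        - (-(1 / (8 * (H : ℝ) ^ 2))) ^ 2 * (4 * (H : ℝ) ^ 2
          * wvar (M.p x) (M.polVal H (ρ.policy (t / H) ω) (toGo H t)))))
    (fun t x s => ?_) (fun t x ω => ?_) ℓ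
  · have hw : ∀ s, Measurable[ρ.𝓕 t] fun ω => M.polVal H (ρ.policy (t / H) ω) (toGo H t) s :=
      fun s => (measurable_polVal M (fun h hh s x => ρ.policy_pair_meas (t / H) hh s x) _
        (Nat.sub_le _ _) s).mono (ρ.𝓕.mono (Nat.div_mul_le_self t H)) le_rfl
    have e1 := measurable_wavg (p := fun s _ => M.p x s) (fun _ => measurable_const) hw
    have e2 := measurable_wavg (p := fun s _ => M.p x s) (fun _ => measurable_const)
      fun s => (hw s).pow_const 2
    exact ((((hw s).pow_const 2).sub e2).const_mul _).sub
      (((e2.sub (e1.pow_const 2)).const_mul _).const_mul _)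
  · have hf : ∀ s, 0 ≤ M.polVal H (ρ.policy (t / H) ω) (toGo H t) s ∧
        M.polVal H (ρ.policy (t / H) ω) (toGo H t) s ≤ H := fun s => by
      have h1 := M.polVal_mem H (ρ.policy (t / H) ω) (toGo H t) s
      have h2 := (M.starVal_mem (ρ.policy (t / H) ω) (toGo H t) s).2
      have h3 : ((toGo H t : ℕ) : ℝ) ≤ H := by exact_mod_cast Nat.sub_le _ _
      exact ⟨h1.1, by linarith [h1.2]⟩
    refine wavg_exp_le (M.p_nonneg x) (M.p_sum x) (b := (H : ℝ) ^ 2)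
      (fun s => ⟨sq_nonneg _, pow_le_pow_left₀ (hf s).1 (hf s).2 2⟩)
      (wvar_sq_le (M.p_nonneg x) (M.p_sum x) hf) ?_
    rw [abs_neg, abs_of_nonneg (by positivity)]
    field_simp
    norm_num

end Run

lemma sum_range_mul_eq (f : ℕ → ℝ) (T H : ℕ) :
    ∑ t ∈ Finset.range (T * H), f t
      = ∑ k ∈ Finset.range T, ∑ h ∈ Finset.range H, f (k * H + h) := by
  induction T with
  | zero => simp
  | succ T ih => rw [Nat.succ_mul, Finset.sum_range_add, ih, Finset.sum_range_succ]

lemma failProb_pos {card H Shat : ℕ} {δ : ℝ} (hc : 1 ≤ card) (hδ : 0 < δ) : 0 < failProb card H Shat δ := by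
  have : (1 : ℝ) ≤ card := by exact_mod_cast hc
  unfold failProb
  positivity

namespace Run

variable {X : Finset (S × A)} [Fintype S] {M : MDP X} {G : Digraph X} {H Shat : ℕ} {δ : ℝ}
  {s₀ : S} {Ω : Type w} [mΩ : MeasurableSpace Ω] {μ : Measure Ω}
  (ρ : Run M G H Shat δ s₀ μ)

/-- The outcomes on which all deviation bounds hold. -/
structure GoodRun (ω : Ω) (ℓ : ℝ) : Prop where
  obs : GoodObs M G H Shat δ (fun t => ρ.play t ω) (fun t y => ρ.rew t y ω)
    (fun t y => ρ.nxt t y ω)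
  width : ∀ T, ∑ t ∈ Finset.range T,
      ((1 - 1 / (2 * (H : ℝ))) * wavg (M.p (ρ.play t ω)) (fun s =>
          scale H * stepWeight H (t % H + 1) * ρ.width (t / H) (toGo H t) s ω)
        - scale H * stepWeight H (t % H + 1)
          * ρ.width (t / H) (toGo H t) (ρ.nxt t (ρ.play t ω) ω) ω) < ℓ
  sqValue : ∀ T, ∑ t ∈ Finset.range T,
      (-(1 / (8 * (H : ℝ) ^ 2)) * (M.polVal H (ρ.policy (t / H) ω) (toGo H t)
          (ρ.nxt t (ρ.play t ω) ω) ^ 2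
        - wavg (M.p (ρ.play t ω)) (fun s => M.polVal H (ρ.policy (t / H) ω) (toGo H t) s ^ 2))
        - (-(1 / (8 * (H : ℝ) ^ 2))) ^ 2 * (4 * (H : ℝ) ^ 2
          * wvar (M.p (ρ.play t ω)) (M.polVal H (ρ.policy (t / H) ω) (toGo H t)))) < ℓ

open scoped ENNReal in
theorem measure_not_goodRun_le [IsProbabilityMeasure μ] (hH : 0 < H) (hc : 1 ≤ X.card)
    (hδ : 0 < δ) (hδ1 : δ ≤ 1) (π : Policy X) (hsupp : ∀ x, (M.P x).support.ncard ≤ Shat) :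
    μ {ω | ¬ ρ.GoodRun ω (-Real.log (failProb X.card H Shat δ))} ≤ ENNReal.ofReal δ := by
  have hF := failProb_pos (H := H) (Shat := Shat) hc hδ
  have h1 := ρ.measure_not_goodObs_le hH hc hδ hδ1 π hsupp
  have h2 := ρ.measure_width_fail_le hH (-Real.log (failProb X.card H Shat δ))
  have h3 := ρ.measure_sqValue_fail_le hH (-Real.log (failProb X.card H Shat δ))
  rw [neg_neg, Real.exp_log hF] at h2 h3
  refine le_trans (measure_mono ?_) ((measure_union_le _ _).trans (add_le_add h1
    ((measure_union_le _ _).trans (add_le_add h2 h3)))) |>.trans ?_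
  · intro ω hω
    by_contra hnot
    simp only [Set.mem_union, not_or, Set.mem_ofPred_eq, not_exists, not_le, not_not] at hnot
    exact hω ⟨hnot.1, hnot.2.1, hnot.2.2⟩
  · have hc' : (1 : ℝ) ≤ X.card := by exact_mod_cast hc
    have e : (X.card : ℝ≥0∞) * (4 + 2 * H + 2 * Shat) * ENNReal.ofReal (failProb X.card H Shat δ)
        + (ENNReal.ofReal (failProb X.card H Shat δ) + ENNReal.ofReal (failProb X.card H Shat δ))
        = ENNReal.ofReal ((X.card * (4 + 2 * H + 2 * Shat) + 2) * failProb X.card H Shat δ) := by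
      rw [ENNReal.ofReal_mul (by positivity), ENNReal.ofReal_add (by positivity) (by positivity),
        ENNReal.ofReal_mul (by positivity), ENNReal.ofReal_add (by positivity) (by positivity),
        ENNReal.ofReal_add (by positivity) (by positivity), ENNReal.ofReal_mul (by positivity),
        ENNReal.ofReal_mul (by positivity)]
      simp only [ENNReal.ofReal_natCast, ENNReal.ofReal_ofNat]
      ring
    rw [e]
    refine ENNReal.ofReal_le_ofReal ?_
    have hS0 : (0 : ℝ) ≤ Shat := Nat.cast_nonneg _
    have hH0 : (0 : ℝ) ≤ H := Nat.cast_nonneg _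
    rw [failProb, mul_div_assoc', div_le_iff₀ (by positivity)]
    rw [mul_comm]
    refine mul_le_mul_of_nonneg_left ?_ hδ.le
    nlinarith

variable {ρ} {ω : Ω} {ℓ : ℝ}

lemma GoodRun.goodStats (hg : ρ.GoodRun ω ℓ) (hsupp : ∀ x, (M.P x).support.ncard ≤ Shat) (k : ℕ) :
    GoodStats M H Shat δ (ρ.stats k ω) :=
  hg.obs.goodStats (ρ.policy 0 ω) hsupp (ρ.isSummary_stats k ω)

lemma GoodRun.validBounds (hg : ρ.GoodRun ω ℓ) (hsupp : ∀ x, (M.P x).support.ncard ≤ Shat)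
    (hS : 1 ≤ Shat) (k : ℕ) {j : ℕ} (hj : j ≤ H) :
    ValidBounds M j (M.polVal H (ρ.policy k ω) j)
      (valueBounds H Shat δ (ρ.stats k ω) (ρ.policy k ω) j) :=
  (hg.goodStats hsupp k).validBounds hS (ρ.greedy k ω) j hj

lemma GoodRun.width_eq (hg : ρ.GoodRun ω ℓ) (hsupp : ∀ x, (M.P x).support.ncard ≤ Shat)
    (hS : 1 ≤ Shat) (k : ℕ) {j : ℕ} (hj : j ≤ H) (s : S) :
    ρ.width k j s ω = (valueBounds H Shat δ (ρ.stats k ω) (ρ.policy k ω) j).1 s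
      - (valueBounds H Shat δ (ρ.stats k ω) (ρ.policy k ω) j).2 s := by
  have h := hg.validBounds hsupp hS k hj
  refine abs_of_nonneg ?_
  linarith [h.lower_le s, h.le_star s, h.star_le s]

variable (ρ) in
/-- Number of observations, at the start of the episode, of the pair played at time `t`. -/
def startCount (ω : Ω) (t : ℕ) : ℕ := (ρ.stats (t / H) ω).n (ρ.play t ω)

variable (ρ) in
/-- Width of the confidence bounds of the pair played at time `t`. -/
def playPhi (ω : Ω) (t : ℕ) : ℝ := phi X.card H Shat δ (ρ.startCount ω t)

variable (ρ) in
/-- Conditional variance of the value of the next state at time `t`. -/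
def playVar (ω : Ω) (t : ℕ) : ℝ :=
  wvar (M.p (ρ.play t ω)) (M.polVal H (ρ.policy (t / H) ω) (toGo H t))

variable (ρ) in
/-- Contribution of the step at time `t` to the widths. -/
def stepCost (ω : Ω) (t : ℕ) : ℝ :=
  if ρ.startCount ω t < H then (H : ℝ)
  else 8 * ρ.playPhi ω t + 8 * √(ρ.playVar ω t) * ρ.playPhi ω t
    + 191 * (Shat * H ^ 2 * ρ.playPhi ω t ^ 2)

lemma stepCost_nonneg (t : ℕ) : 0 ≤ ρ.stepCost ω t := by
  have h := phi_nonneg X.card H Shat δ (ρ.startCount ω t)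
  have h2 := Real.sqrt_nonneg (ρ.playVar ω t)
  unfold stepCost playPhi
  split <;> positivity

lemma GoodRun.width_step (hg : ρ.GoodRun ω ℓ) (hsupp : ∀ x, (M.P x).support.ncard ≤ Shat)
    (hS : 1 ≤ Shat) (k : ℕ) {h : ℕ} (hh : h < H) :
    ρ.width k (H - h) (ρ.state k h ω) ω ≤ (1 + 7 / H) * wavg (M.p (ρ.play (k * H + h) ω))
      (fun s => ρ.width k (H - (h + 1)) s ω) + ρ.stepCost ω (k * H + h) := by
  have hk := (mul_add_div (k := k) hh).1
  have hm := (mul_add_div (k := k) hh).2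
  have hplay := ρ.play_mul_add k hh ω
  have hw0 : 0 ≤ wavg (M.p (ρ.play (k * H + h) ω)) (fun s => ρ.width k (H - (h + 1)) s ω) :=
    wavg_nonneg (M.p_nonneg _) fun s => ρ.width_nonneg _ _ s ω
  by_cases hn : ρ.startCount ω (k * H + h) < H
  · rw [stepCost, if_pos hn]
    have h1 := ρ.width_le k (H - h) (ρ.state k h ω) ω
    have h2 : ((H - h : ℕ) : ℝ) ≤ H := by exact_mod_cast Nat.sub_le _ _
    have h3 : 0 ≤ (1 + 7 / (H : ℝ)) * wavg (M.p (ρ.play (k * H + h) ω))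
      (fun s => ρ.width k (H - (h + 1)) s ω) := by positivity
    linarith
  · rw [stepCost, if_neg hn]
    have hn' : 1 ≤ (ρ.stats k ω).n (ρ.play (k * H + h) ω) := by
      rw [startCount, hk] at hn; omega
    have hj : H - (h + 1) < H := by omega
    have hj1 : H - (h + 1) + 1 = H - h := by omega
    have hj2 : H - (H - (h + 1) + 1) = h := by omega
    have key := (hg.goodStats hsupp k).width_succ_le hS (ρ.greedy k ω) hj (ρ.state k h ω)
      (x := ρ.play (k * H + h) ω) (by rw [hj2, hplay]) hn'
    simp only [← hg.width_eq hsupp hS k hj.le] at key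
    rw [hj1, ← hg.width_eq hsupp hS k (Nat.sub_le _ _)] at key
    rw [playPhi, playVar, startCount, hk, toGo, hm]
    unfold wsd at key
    linarith

lemma stepWeight_succ_ge (hH : 0 < H) (h : ℕ) :
    stepWeight H h * (1 + 7 / H) ≤ stepWeight H (h + 1) * (1 - 1 / (2 * (H : ℝ))) := by
  have hw := one_le_stepWeight H h
  have hH' : (1 : ℝ) ≤ H := by exact_mod_cast hH
  have h1 : 0 < 1 / (H : ℝ) := by positivity
  have h2 : 1 / (H : ℝ) ≤ 1 := by rw [div_le_one (by linarith)]; exact hH'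
  rw [stepWeight, stepWeight, pow_succ, mul_assoc]
  refine mul_le_mul_of_nonneg_left ?_ (by positivity)
  rw [show (7 : ℝ) / H = 7 * (1 / H) by ring, show (16 : ℝ) / H = 16 * (1 / H) by ring,
    show 1 / (2 * (H : ℝ)) = 1 / 2 * (1 / H) by field_simp]
  nlinarith

/-- The sum of the initial widths is bounded by the costs of the steps. -/
lemma GoodRun.sum_width_le (hg : ρ.GoodRun ω ℓ) (hsupp : ∀ x, (M.P x).support.ncard ≤ Shat)
    (hS : 1 ≤ Shat) (hH : 0 < H) (T : ℕ) :
    ∑ k ∈ Finset.range T, ρ.width k H (ρ.state k 0 ω) ω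
      ≤ 2 * Real.exp 16 * H ^ 2 * ℓ
        + Real.exp 16 * ∑ t ∈ Finset.range (T * H), ρ.stepCost ω t := by
  have hH' : (1 : ℝ) ≤ H := by exact_mod_cast hH
  have he := Real.exp_pos 16
  have hs : 0 < scale H := by unfold scale; positivity
  set g : ℕ → ℕ → ℝ := fun k h =>
    if h < H then stepWeight H h * ρ.width k (H - h) (ρ.state k h ω) ω else 0 with hgdef
  have hgS : ∀ k, ∀ h < H, g k (h + 1) = stepWeight H (h + 1) *
      ρ.width k (H - (h + 1)) (ρ.nxt (k * H + h) (ρ.play (k * H + h) ω) ω) ω := by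
    intro k h hh
    by_cases h1 : h + 1 < H
    · simp only [hgdef, if_pos h1]
      rw [ρ.state_succ k h h1 ω, ρ.nxt_mul_add k hh, ρ.play_mul_add k hh]
    · simp only [hgdef, if_neg h1]
      have : H - (h + 1) = 0 := by omega
      rw [this]
      have h0 := ρ.width_le k 0 (ρ.nxt (k * H + h) (ρ.play (k * H + h) ω) ω) ω
      have h0' := ρ.width_nonneg k 0 (ρ.nxt (k * H + h) (ρ.play (k * H + h) ω) ω) ω
      have : ρ.width k 0 (ρ.nxt (k * H + h) (ρ.play (k * H + h) ω) ω) ω = 0 :=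
        le_antisymm (by simpa using h0) h0'
      rw [this, mul_zero]
  have hstep : ∀ k, ∀ h < H, g k h - g k (h + 1) ≤
      (stepWeight H (h + 1) * (1 - 1 / (2 * (H : ℝ))) * wavg (M.p (ρ.play (k * H + h) ω))
        (fun s => ρ.width k (H - (h + 1)) s ω) - stepWeight H (h + 1) *
        ρ.width k (H - (h + 1)) (ρ.nxt (k * H + h) (ρ.play (k * H + h) ω) ω) ω)
      + Real.exp 16 * ρ.stepCost ω (k * H + h) := by
    intro k h hh
    rw [hgS k h hh]
    simp only [hgdef, if_pos hh]
    have hw0 : 0 ≤ wavg (M.p (ρ.play (k * H + h) ω)) (fun s => ρ.width k (H - (h + 1)) s ω) :=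
      wavg_nonneg (M.p_nonneg _) fun s => ρ.width_nonneg _ _ s ω
    have h1 := mul_le_mul_of_nonneg_left (hg.width_step hsupp hS k hh)
      (zero_le_one.trans (one_le_stepWeight H h))
    have h2 := mul_le_mul_of_nonneg_right (stepWeight_succ_ge hH h) hw0
    have h3 := mul_le_mul_of_nonneg_right (stepWeight_le hH hh.le)
      (stepCost_nonneg (ρ := ρ) (ω := ω) (k * H + h))
    nlinarith
  have hwid := hg.width (T * H)
  rw [sum_range_mul_eq] at hwid
  have hsum : scale H * ∑ k ∈ Finset.range T, ∑ h ∈ Finset.range H,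
      (stepWeight H (h + 1) * (1 - 1 / (2 * (H : ℝ))) * wavg (M.p (ρ.play (k * H + h) ω))
        (fun s => ρ.width k (H - (h + 1)) s ω) - stepWeight H (h + 1) *
        ρ.width k (H - (h + 1)) (ρ.nxt (k * H + h) (ρ.play (k * H + h) ω) ω) ω) < ℓ := by
    refine lt_of_eq_of_lt ?_ hwid
    rw [Finset.mul_sum]
    refine Finset.sum_congr rfl fun k _ => ?_
    rw [Finset.mul_sum]
    refine Finset.sum_congr rfl fun h hh => ?_
    have hh' := Finset.mem_range.1 hh
    rw [toGo, (mul_add_div hh').1, (mul_add_div hh').2, wavg_const_mul]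
    ring
  have htel : ∑ k ∈ Finset.range T, ρ.width k H (ρ.state k 0 ω) ω
      = ∑ k ∈ Finset.range T, ∑ h ∈ Finset.range H, (g k h - g k (h + 1)) := by
    refine Finset.sum_congr rfl fun k _ => ?_
    rw [Finset.sum_range_sub']
    simp [hgdef, hH, stepWeight]
  rw [htel]
  set B := ∑ k ∈ Finset.range T, ∑ h ∈ Finset.range H,
      (stepWeight H (h + 1) * (1 - 1 / (2 * (H : ℝ))) * wavg (M.p (ρ.play (k * H + h) ω))
        (fun s => ρ.width k (H - (h + 1)) s ω) - stepWeight H (h + 1) *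
        ρ.width k (H - (h + 1)) (ρ.nxt (k * H + h) (ρ.play (k * H + h) ω) ω) ω) with hB
  have hle : ∑ k ∈ Finset.range T, ∑ h ∈ Finset.range H, (g k h - g k (h + 1))
      ≤ B + Real.exp 16 * ∑ t ∈ Finset.range (T * H), ρ.stepCost ω t := by
    rw [sum_range_mul_eq, hB, Finset.mul_sum, ← Finset.sum_add_distrib]
    refine Finset.sum_le_sum fun k _ => ?_
    rw [Finset.mul_sum, ← Finset.sum_add_distrib]
    exact Finset.sum_le_sum fun h hh => hstep k h (Finset.mem_range.1 hh)
  have hBl : B ≤ 2 * Real.exp 16 * H ^ 2 * ℓ := by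
    have h1 : scale H * (2 * Real.exp 16 * (H : ℝ) ^ 2) = 1 := by
      unfold scale; field_simp
    have h2 : B = (2 * Real.exp 16 * (H : ℝ) ^ 2) * (scale H * B) := by
      rw [← mul_assoc, mul_comm _ (scale H), h1, one_mul]
    rw [h2]
    exact mul_le_mul_of_nonneg_left hsum.le (by positivity)
  linarith

/-- The conditional variances sum up to at most order `H² T`. -/
lemma GoodRun.sum_playVar_le (hg : ρ.GoodRun ω ℓ) (hH : 0 < H) (T : ℕ) :
    ∑ t ∈ Finset.range (T * H), ρ.playVar ω t ≤ 16 * H ^ 2 * ℓ + 4 * H ^ 2 * T := by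
  have hH' : (1 : ℝ) ≤ H := by exact_mod_cast hH
  set g : ℕ → ℕ → ℝ := fun k h =>
    if h < H then M.polVal H (ρ.policy k ω) (H - h) (ρ.state k h ω) ^ 2 else 0 with hgdef
  set a : ℕ → ℝ := fun t => wavg (M.p (ρ.play t ω)) (fun s =>
    M.polVal H (ρ.policy (t / H) ω) (toGo H t) s ^ 2) with ha
  set b : ℕ → ℝ := fun t => M.polVal H (ρ.policy (t / H) ω) (toGo H t)
    (ρ.nxt t (ρ.play t ω) ω) ^ 2 with hb
  have hsq := hg.sqValue (T * H)
  have e1 : ∀ t, (-(1 / (8 * (H : ℝ) ^ 2)) * (b t - a t)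
        - (-(1 / (8 * (H : ℝ) ^ 2))) ^ 2 * (4 * (H : ℝ) ^ 2 * ρ.playVar ω t))
      = 1 / (8 * (H : ℝ) ^ 2) * ((a t - b t) - 1 / 2 * ρ.playVar ω t) := fun t => by
    field_simp; ring
  have hsq' : ∑ t ∈ Finset.range (T * H), (1 / (8 * (H : ℝ) ^ 2) *
      ((a t - b t) - 1 / 2 * ρ.playVar ω t)) < ℓ := by
    refine lt_of_eq_of_lt (Finset.sum_congr rfl fun t _ => (e1 t).symm) hsq
  rw [← Finset.mul_sum, Finset.sum_sub_distrib, ← Finset.mul_sum, one_div,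
    inv_mul_lt_iff₀ (by positivity)] at hsq'
  have hgS : ∀ k, ∀ h < H, g k (h + 1) = b (k * H + h) := by
    intro k h hh
    simp only [hb, toGo, (mul_add_div (k := k) hh).1, (mul_add_div (k := k) hh).2]
    by_cases h1 : h + 1 < H
    · simp only [hgdef, if_pos h1]
      rw [ρ.state_succ k h h1 ω, ρ.nxt_mul_add k hh, ρ.play_mul_add k hh]
    · simp only [hgdef, if_neg h1]
      have : H - (h + 1) = 0 := by omega
      rw [this]
      simp [MDP.polVal]
  have hstep : ∀ k, ∀ h < H, ρ.playVar ω (k * H + h)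
      ≤ (a (k * H + h) - b (k * H + h)) - (g k h - g k (h + 1)) + 2 * H := by
    intro k h hh
    rw [hgS k h hh]
    have hv : M.polVal H (ρ.policy k ω) (H - h) (ρ.state k h ω)
        = M.meanReward (ρ.play (k * H + h) ω)
          + wavg (M.p (ρ.play (k * H + h) ω)) (M.polVal H (ρ.policy k ω) (H - (h + 1))) := by
      have hj1 : H - h = H - (h + 1) + 1 := by omega
      have hj2 : H - (H - (h + 1) + 1) = h := by omega
      rw [hj1, MDP.polVal, hj2, ρ.play_mul_add k hh]
    have hle : M.polVal H (ρ.policy k ω) (H - h) (ρ.state k h ω) ≤ H := by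
      have h1 := (M.polVal_mem H (ρ.policy k ω) (H - h) (ρ.state k h ω)).2
      have h2 := (M.starVal_mem (ρ.policy k ω) (H - h) (ρ.state k h ω)).2
      have h3 : ((H - h : ℕ) : ℝ) ≤ H := by exact_mod_cast Nat.sub_le _ _
      linarith
    have h0 := (M.polVal_mem H (ρ.policy k ω) (H - h) (ρ.state k h ω)).1
    have hr := M.meanReward_mem (ρ.play (k * H + h) ω)
    simp only [hgdef, if_pos hh, ha, playVar, wvar, toGo, (mul_add_div (k := k) hh).1,
      (mul_add_div (k := k) hh).2]
    set v := M.polVal H (ρ.policy k ω) (H - h) (ρ.state k h ω)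
    set r := M.meanReward (ρ.play (k * H + h) ω)
    set q := wavg (M.p (ρ.play (k * H + h) ω)) (M.polVal H (ρ.policy k ω) (H - (h + 1)))
    have hq : q = v - r := by linarith
    rw [hq]
    nlinarith [mul_le_mul hr.2 hle h0 zero_le_one]
  have hsum : ∑ t ∈ Finset.range (T * H), ρ.playVar ω t
      ≤ ∑ t ∈ Finset.range (T * H), (a t - b t) + 2 * H ^ 2 * T := by
    have h1 : ∑ k ∈ Finset.range T, ∑ h ∈ Finset.range H, (g k h - g k (h + 1)) ≥ 0 := by
      refine Finset.sum_nonneg fun k _ => ?_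
      rw [Finset.sum_range_sub']
      simp only [hgdef, if_pos hH, lt_irrefl, if_false, sub_zero]
      exact sq_nonneg _
    have h2 : ∑ k ∈ Finset.range T, ∑ h ∈ Finset.range H, ρ.playVar ω (k * H + h)
        ≤ ∑ k ∈ Finset.range T, ∑ h ∈ Finset.range H,
          ((a (k * H + h) - b (k * H + h)) - (g k h - g k (h + 1)) + 2 * H) :=
      Finset.sum_le_sum fun k _ => Finset.sum_le_sum fun h hh => hstep k h (Finset.mem_range.1 hh)
    rw [sum_range_mul_eq, sum_range_mul_eq]
    simp only [Finset.sum_add_distrib, Finset.sum_sub_distrib, Finset.sum_const,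
      Finset.card_range, nsmul_eq_mul] at h1 h2 ⊢
    nlinarith
  nlinarith

end Run

lemma phi_sq_le {card H Shat n : ℕ} {δ : ℝ} (hc : 1 ≤ card) (hδ : 0 < δ) (hδ1 : δ ≤ 1)
    (hn : 1 ≤ n) : phi card H Shat δ n ^ 2 ≤ 0.52 / n * logTerm card H Shat δ n := by
  have hL := logTerm_pos (H := H) (Shat := Shat) hc hδ hδ1 n
  rw [phi_eq hn]
  exact (pow_le_pow_left₀ (le_min zero_le_one (Real.sqrt_nonneg _)) (min_le_right _ _) 2).trans_eq
    (Real.sq_sqrt (by positivity))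

namespace Run

variable {X : Finset (S × A)} [Fintype S] {M : MDP X} {G : Digraph X} {H Shat : ℕ} {δ : ℝ}
  {s₀ : S} {Ω : Type w} [mΩ : MeasurableSpace Ω] {μ : Measure Ω}
  {ρ : Run M G H Shat δ s₀ μ} {ω : Ω} {ℓ : ℝ}

lemma startCount_eq (t : ℕ) :
    ρ.startCount ω t = obsCount G (fun t => ρ.play t ω) (t / H * H) (ρ.play t ω) :=
  (ρ.isSummary_stats (t / H) ω).n_eq _

lemma obsCount_le_startCount_add (hH : 0 < H) (t : ℕ) :
    obsCount G (fun t => ρ.play t ω) t (ρ.play t ω) ≤ ρ.startCount ω t + H := by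
  rw [startCount_eq]
  have h1 := obsCount_add_le G (fun t => ρ.play t ω) (ρ.play t ω) (t / H * H) (t % H)
  rw [Nat.div_add_mod' t H] at h1
  have := Nat.mod_lt t hH
  omega

/-- Few steps concern pairs with fewer than `H` observations. -/
lemma card_startCount_lt (hG : ∀ x, ¬ G.Adj x x) (hH : 0 < H) (n : ℕ) :
    ((Finset.range n).filter fun t => ρ.startCount ω t < H).card ≤ 2 * H * masNumber G := by
  refine le_trans (Finset.card_le_card ?_) (card_obsCount_lt G hG (fun t => ρ.play t ω) (2 * H) n)
  intro t ht
  rw [Finset.mem_filter] at ht ⊢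
  have := obsCount_le_startCount_add (ρ := ρ) (ω := ω) hH t
  exact ⟨ht.1, by omega⟩

/-- The squared confidence widths sum up to a logarithmic multiple of the mas-number. -/
lemma sum_playPhi_sq_le (hG : ∀ x, ¬ G.Adj x x) (hH : 0 < H) (hc : 1 ≤ X.card) (hδ : 0 < δ)
    (hδ1 : δ ≤ 1) (n : ℕ) :
    ∑ t ∈ (Finset.range n).filter (fun t => ¬ ρ.startCount ω t < H), ρ.playPhi ω t ^ 2
      ≤ 1.56 * logTerm X.card H Shat δ n * (masNumber G * Real.log (n + 1) + 1) := by
  have hL := logTerm_pos (H := H) (Shat := Shat) hc hδ hδ1 n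
  refine le_trans ?_ (mul_le_mul_of_nonneg_left
    (sum_inv_obsCount_le G hG (fun t => ρ.play t ω) n) (by positivity))
  rw [Finset.mul_sum]
  refine le_trans (Finset.sum_le_sum fun t ht => ?_) (Finset.sum_le_sum_of_subset_of_nonneg
    (Finset.filter_subset _ _) fun t _ _ => by positivity)
  rw [Finset.mem_filter, Finset.mem_range] at ht
  have hn : 1 ≤ ρ.startCount ω t := by omega
  have hn0 : (1 : ℝ) ≤ ρ.startCount ω t := by exact_mod_cast hn
  have hle : ρ.startCount ω t ≤ n := by
    rw [startCount_eq]
    exact (obsCount_le _ _ _ _).trans ((Nat.div_mul_le_self t H).trans ht.1.le)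
  have h1 := phi_sq_le (H := H) (Shat := Shat) hc hδ hδ1 hn
  have h2 := logTerm_mono (c := X.card) (H := H) (Shat := Shat) (δ := δ) hle
  have h3 : (obsCount G (fun t => ρ.play t ω) t (ρ.play t ω) : ℝ) + 1
      ≤ 3 * ρ.startCount ω t := by
    have := obsCount_le_startCount_add (ρ := ρ) (ω := ω) hH t
    exact_mod_cast (show _ + 1 ≤ 3 * ρ.startCount ω t by omega)
  have h4 : 1 / (ρ.startCount ω t : ℝ)
      ≤ 3 * (1 / ((obsCount G (fun t => ρ.play t ω) t (ρ.play t ω) : ℝ) + 1)) := by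
    rw [mul_one_div, div_le_div_iff₀ (by positivity) (by positivity)]
    linarith
  calc ρ.playPhi ω t ^ 2 ≤ 0.52 / (ρ.startCount ω t : ℝ)
        * logTerm X.card H Shat δ (ρ.startCount ω t) := h1
    _ ≤ 0.52 / (ρ.startCount ω t : ℝ) * logTerm X.card H Shat δ n :=
        mul_le_mul_of_nonneg_left h2 (by positivity)
    _ = 0.52 * logTerm X.card H Shat δ n * (1 / (ρ.startCount ω t : ℝ)) := by ring
    _ ≤ 0.52 * logTerm X.card H Shat δ n
        * (3 * (1 / ((obsCount G (fun t => ρ.play t ω) t (ρ.play t ω) : ℝ) + 1))) :=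
        mul_le_mul_of_nonneg_left h4 (by positivity)
    _ = _ := by ring

lemma playVar_nonneg (t : ℕ) : 0 ≤ ρ.playVar ω t := wvar_nonneg (M.p_nonneg _) (M.p_sum _)

lemma sum_stepCost_le (hG : ∀ x, ¬ G.Adj x x) (hH : 0 < H) (n : ℕ) {Φ Q : ℝ}
    (hΦ : ∑ t ∈ (Finset.range n).filter (fun t => ¬ ρ.startCount ω t < H), ρ.playPhi ω t ^ 2 ≤ Φ)
    (hQ : ∑ t ∈ Finset.range n, ρ.playVar ω t ≤ Q) :
    ∑ t ∈ Finset.range n, ρ.stepCost ω t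
      ≤ 2 * masNumber G * H ^ 2 + 8 * (√n * √Φ) + 8 * (√Q * √Φ) + 191 * (Shat * H ^ 2 * Φ) := by
  set J := (Finset.range n).filter (fun t => ¬ ρ.startCount ω t < H) with hJ
  have e1 : ∑ t ∈ Finset.range n, ρ.stepCost ω t
      = ∑ t ∈ (Finset.range n).filter (fun t => ρ.startCount ω t < H), ρ.stepCost ω t
        + ∑ t ∈ J, ρ.stepCost ω t := (Finset.sum_filter_add_sum_filter_not _ _ _).symm
  have e2 : ∑ t ∈ (Finset.range n).filter (fun t => ρ.startCount ω t < H), ρ.stepCost ω t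
      ≤ 2 * masNumber G * H ^ 2 := by
    have h1 : ∀ t ∈ (Finset.range n).filter (fun t => ρ.startCount ω t < H),
        ρ.stepCost ω t = H := fun t ht => by
      rw [stepCost, if_pos (Finset.mem_filter.1 ht).2]
    rw [Finset.sum_congr rfl h1, Finset.sum_const, nsmul_eq_mul]
    have h2 : (((Finset.range n).filter fun t => ρ.startCount ω t < H).card : ℝ)
        ≤ 2 * H * masNumber G := by exact_mod_cast card_startCount_lt (ρ := ρ) (ω := ω) hG hH n
    calc _ ≤ (2 * H * masNumber G : ℝ) * H := mul_le_mul_of_nonneg_right h2 (Nat.cast_nonneg _)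
      _ = _ := by ring
  have e3 : ∑ t ∈ J, ρ.stepCost ω t = 8 * ∑ t ∈ J, 1 * ρ.playPhi ω t
      + 8 * ∑ t ∈ J, √(ρ.playVar ω t) * ρ.playPhi ω t
      + 191 * (Shat * H ^ 2 * ∑ t ∈ J, ρ.playPhi ω t ^ 2) := by
    simp only [Finset.mul_sum]
    rw [← Finset.sum_add_distrib, ← Finset.sum_add_distrib]
    refine Finset.sum_congr rfl fun t ht => ?_
    rw [stepCost, if_neg (Finset.mem_filter.1 ht).2]
    ring
  have hs : √(∑ t ∈ J, ρ.playPhi ω t ^ 2) ≤ √Φ := Real.sqrt_le_sqrt hΦ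
  have e4 : ∑ t ∈ J, 1 * ρ.playPhi ω t ≤ √n * √Φ := by
    refine (Real.sum_mul_le_sqrt_mul_sqrt J (fun _ => 1) _).trans ?_
    refine mul_le_mul (Real.sqrt_le_sqrt ?_) hs (Real.sqrt_nonneg _) (Real.sqrt_nonneg _)
    simp only [one_pow, Finset.sum_const, nsmul_eq_mul, mul_one]
    exact_mod_cast (Finset.card_filter_le _ _).trans_eq (Finset.card_range n)
  have e5 : ∑ t ∈ J, √(ρ.playVar ω t) * ρ.playPhi ω t ≤ √Q * √Φ := by
    refine (Real.sum_mul_le_sqrt_mul_sqrt J _ _).trans ?_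
    refine mul_le_mul (Real.sqrt_le_sqrt ?_) hs (Real.sqrt_nonneg _) (Real.sqrt_nonneg _)
    simp only [Real.sq_sqrt (playVar_nonneg _)]
    exact (Finset.sum_le_sum_of_subset_of_nonneg (Finset.filter_subset _ _)
      fun t _ _ => playVar_nonneg t).trans hQ
  have e6 : (Shat * H ^ 2 : ℝ) * ∑ t ∈ J, ρ.playPhi ω t ^ 2 ≤ Shat * H ^ 2 * Φ :=
    mul_le_mul_of_nonneg_left hΦ (by positivity)
  rw [e1, e3]
  linarith

end Run

/-- Comparison of the logarithms of the confidence bounds with that of the rate. -/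
lemma log_bounds {card H Shat T : ℕ} {δ : ℝ} (hc : 1 ≤ card) (hH : 1 ≤ H) (hT : 1 ≤ T)
    (hSc : Shat ≤ card) (hδ : 0 < δ) (hδ1 : δ ≤ 1) :
    1 ≤ Real.log (Real.exp 1 * card * H * T / δ) ∧
    -Real.log (failProb card H Shat δ) ≤ 3 * Real.log (Real.exp 1 * card * H * T / δ) ∧
    logTerm card H Shat δ (T * H) ≤ 7 * Real.log (Real.exp 1 * card * H * T / δ) ∧
    Real.log ((T * H : ℕ) + 1) ≤ Real.log (Real.exp 1 * card * H * T / δ) := by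
  have hc' : (1 : ℝ) ≤ card := by exact_mod_cast hc
  have hH' : (1 : ℝ) ≤ H := by exact_mod_cast hH
  have hT' : (1 : ℝ) ≤ T := by exact_mod_cast hT
  have hS' : (Shat : ℝ) ≤ card := by exact_mod_cast hSc
  have he : (2.7 : ℝ) ≤ Real.exp 1 := by linarith [Real.exp_one_gt_d9]
  have hlc : 0 ≤ Real.log card := Real.log_nonneg hc'
  have hlH : 0 ≤ Real.log H := Real.log_nonneg hH'
  have hlT : 0 ≤ Real.log T := Real.log_nonneg hT'
  have hld : 0 ≤ -Real.log δ := by linarith [Real.log_nonpos hδ.le hδ1]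
  have hy : Real.log (Real.exp 1 * card * H * T / δ)
      = 1 + Real.log card + Real.log H + Real.log T - Real.log δ := by
    rw [Real.log_div (by positivity) hδ.ne', Real.log_mul (by positivity) (by positivity),
      Real.log_mul (by positivity) (by positivity), Real.log_mul (by positivity) (by positivity),
      Real.log_exp]
  have hl2 : Real.log 2 < 0.6932 := by linarith [Real.log_two_lt_d9]
  have hl16 : Real.log 16 ≤ 2.8 := by
    rw [show (16 : ℝ) = 2 ^ 4 by norm_num, Real.log_pow]; push_cast; linarith
  have hl8 : Real.log 5.2 ≤ 2.1 := by
    have : Real.log 5.2 ≤ Real.log (2 ^ 3) := Real.log_le_log (by norm_num) (by norm_num)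
    rw [Real.log_pow] at this; push_cast at this; linarith
  have hcH : (4 * Shat + 5 * H + 7 : ℝ) ≤ 16 * (card * H) := by nlinarith
  have hpos : (0 : ℝ) < 4 * Shat + 5 * H + 7 := by positivity
  have hf : -Real.log (failProb card H Shat δ)
      ≤ 2.8 + 2 * Real.log card + Real.log H - Real.log δ := by
    rw [failProb, Real.log_div hδ.ne' (by positivity), Real.log_mul (by positivity) hpos.ne']
    have := Real.log_le_log hpos hcH
    rw [Real.log_mul (by norm_num) (by positivity), Real.log_mul (by positivity) (by positivity)]
      at this
    linarith
  have hm : Real.log (max (Real.exp 1) (2 * (T * H : ℕ))) ≤ 1 + Real.log T + Real.log H := by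
    have h1 : max (Real.exp 1) (2 * ((T * H : ℕ) : ℝ)) ≤ Real.exp 1 * (T * H) := by
      have h2 : (1 : ℝ) ≤ T * H := by nlinarith
      push_cast
      exact max_le (by nlinarith) (by nlinarith)
    have := Real.log_le_log (lt_max_of_lt_left (Real.exp_pos 1)) h1
    rw [Real.log_mul (by positivity) (by positivity), Real.log_exp,
      Real.log_mul (by positivity) (by positivity)] at this
    linarith
  refine ⟨by rw [hy]; linarith, by rw [hy]; linarith, ?_, ?_⟩
  · have h1 := Real.log_le_sub_one_of_pos
      (show 0 < Real.log (max (Real.exp 1) (2 * (T * H : ℕ))) by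
        linarith [one_le_log_max (T * H)])
    have h2 : Real.log (5.2 * card * (4 * Shat + 5 * H + 7) / δ)
        = Real.log 5.2 + -Real.log (failProb card H Shat δ) := by
      rw [failProb, ← Real.log_inv, ← Real.log_mul (by norm_num) (by positivity)]
      congr 1
      rw [inv_div]
      ring
    rw [logTerm, h2, hy]
    linarith
  · rw [hy]
    have h2 : (1 : ℝ) ≤ T * H := by nlinarith
    have : Real.log ((T * H : ℕ) + 1) ≤ Real.log (Real.exp 1 * (T * H)) := by
      refine Real.log_le_log (by positivity) ?_
      push_cast
      nlinarith
    rw [Real.log_mul (by positivity) (by positivity), Real.log_exp,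
      Real.log_mul (by positivity) (by positivity)] at this
    linarith

/-- The arithmetic behind the final rate. -/
lemma rate_arith {m N H T y ℓ L lt E : ℝ} (hm : 1 ≤ m) (hN : 1 ≤ N) (hH : 1 ≤ H) (hT : 1 ≤ T)
    (hy : 1 ≤ y) (hℓ : ℓ ≤ 3 * y) (hL0 : 0 ≤ L) (hL : L ≤ 7 * y) (hlt0 : 0 ≤ lt) (hlt : lt ≤ y)
    (hE : 0 ≤ E) :
    2 * E * H ^ 2 * ℓ + E * (2 * m * H ^ 2 + 8 * (√(T * H) * √(1.56 * L * (m * lt + 1)))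
        + 8 * (√(16 * H ^ 2 * ℓ + 4 * H ^ 2 * T) * √(1.56 * L * (m * lt + 1)))
        + 191 * (N * H ^ 2 * (1.56 * L * (m * lt + 1))))
      ≤ 5000 * E * (√(m * H ^ 2 * T) * y + m * N * H ^ 2 * y ^ 3) := by
  have hmy : 1 ≤ m * y := by nlinarith
  have hΦ : 1.56 * L * (m * lt + 1) ≤ 22 * (m * y ^ 2) := by
    have h1 : m * lt + 1 ≤ 2 * (m * y) := by nlinarith
    have h2 : 1.56 * L ≤ 11 * y := by linarith
    calc 1.56 * L * (m * lt + 1) ≤ (11 * y) * (2 * (m * y)) :=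
          mul_le_mul h2 h1 (by positivity) (by positivity)
      _ = _ := by ring
  set Φ := 1.56 * L * (m * lt + 1)
  have hΦ0 : 0 ≤ Φ := by positivity
  set Z := √(m * H ^ 2 * T) with hZ
  have hZ2 : Z ^ 2 = m * H ^ 2 * T := Real.sq_sqrt (by positivity)
  have hZ0 : 0 ≤ Z := Real.sqrt_nonneg _
  have hHH : H ≤ H ^ 2 := by nlinarith
  set K := m * N * H ^ 2 * y ^ 3 with hK
  have hy2 : y ^ 2 ≤ y ^ 3 := pow_le_pow_right₀ hy (by norm_num)
  have hy1 : y ≤ y ^ 3 := by simpa using pow_le_pow_right₀ hy (show 1 ≤ 3 by norm_num)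
  have hy3 : 1 ≤ y ^ 3 := hy.trans hy1
  have hmN : m ≤ m * N := by nlinarith
  have hmN1 : 1 ≤ m * N := hm.trans hmN
  have k1 : H ^ 2 * y ≤ K := by
    calc H ^ 2 * y = 1 * H ^ 2 * y := by ring
      _ ≤ m * N * H ^ 2 * y ^ 3 := by gcongr
  have k2 : m * H ^ 2 ≤ K := by
    calc m * H ^ 2 = m * H ^ 2 * 1 := by ring
      _ ≤ m * N * H ^ 2 * y ^ 3 := by gcongr
  have k3 : m * H ^ 2 * y ^ 3 ≤ K := by rw [hK]; gcongr
  have k4 : N * H ^ 2 * Φ ≤ 22 * K := by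
    calc N * H ^ 2 * Φ ≤ N * H ^ 2 * (22 * (m * y ^ 3)) := by
          refine mul_le_mul_of_nonneg_left (hΦ.trans ?_) (by positivity)
          gcongr
      _ = _ := by rw [hK]; ring
  have r1 : √(T * H) * √Φ ≤ 5 * (Z * y) := by
    rw [← Real.sqrt_mul (by positivity)]
    refine Real.sqrt_le_iff.2 ⟨by positivity, ?_⟩
    calc T * H * Φ ≤ T * H ^ 2 * (22 * (m * y ^ 2)) := by gcongr
      _ = 22 * (Z ^ 2 * y ^ 2) := by rw [hZ2]; ring
      _ ≤ 25 * (Z ^ 2 * y ^ 2) := by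
        have : 0 ≤ Z ^ 2 * y ^ 2 := by positivity
        linarith
      _ = _ := by ring
  have r2 : √(16 * H ^ 2 * ℓ + 4 * H ^ 2 * T) * √Φ ≤ 10 * (Z * y) + 33 * K := by
    have hin : 16 * H ^ 2 * ℓ + 4 * H ^ 2 * T ≤ 48 * (H ^ 2 * y) + 4 * (H ^ 2 * T) := by
      nlinarith [mul_le_mul_of_nonneg_left hℓ (sq_nonneg H)]
    have hin0 : 0 ≤ 48 * (H ^ 2 * y) + 4 * (H ^ 2 * T) := by positivity
    have hK1 : m * H ^ 2 * y ^ 3 ≤ (m * H ^ 2 * y ^ 3) ^ 2 := by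
      have : 1 ≤ m * H ^ 2 * y ^ 3 := by
        have h1 : 1 ≤ H ^ 2 := by nlinarith
        have h2 : 1 ≤ m * H ^ 2 := by nlinarith
        nlinarith
      nlinarith
    refine (mul_le_mul_of_nonneg_right (Real.sqrt_le_sqrt hin) (Real.sqrt_nonneg _)).trans ?_
    rw [← Real.sqrt_mul hin0]
    refine Real.sqrt_le_iff.2 ⟨by positivity, ?_⟩
    have h5 : (m * H ^ 2 * y ^ 3) ^ 2 ≤ K ^ 2 := pow_le_pow_left₀ (by positivity) k3 2
    calc (48 * (H ^ 2 * y) + 4 * (H ^ 2 * T)) * Φ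
        ≤ (48 * (H ^ 2 * y) + 4 * (H ^ 2 * T)) * (22 * (m * y ^ 2)) :=
          mul_le_mul_of_nonneg_left hΦ hin0
      _ = 1056 * (m * H ^ 2 * y ^ 3) + 88 * (Z ^ 2 * y ^ 2) := by rw [hZ2]; ring
      _ ≤ 1089 * K ^ 2 + 100 * (Z ^ 2 * y ^ 2) := by
        have : 0 ≤ Z ^ 2 * y ^ 2 := by positivity
        have : 0 ≤ K ^ 2 := sq_nonneg _
        linarith
      _ ≤ (10 * (Z * y) + 33 * K) ^ 2 := by
        have : 0 ≤ Z * y * K := by positivity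
        nlinarith
  have h1 : H ^ 2 * ℓ ≤ 3 * K := by
    have := mul_le_mul_of_nonneg_left hℓ (sq_nonneg H)
    linarith
  have hZy : 0 ≤ Z * y := by positivity
  have hK0 : 0 ≤ K := by positivity
  have hin : 2 * (H ^ 2 * ℓ) + (2 * m * H ^ 2 + 8 * (√(T * H) * √Φ)
        + 8 * (√(16 * H ^ 2 * ℓ + 4 * H ^ 2 * T) * √Φ) + 191 * (N * H ^ 2 * Φ))
      ≤ 5000 * (Z * y + K) := by linarith
  calc _ = E * (2 * (H ^ 2 * ℓ) + (2 * m * H ^ 2 + 8 * (√(T * H) * √Φ)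
        + 8 * (√(16 * H ^ 2 * ℓ + 4 * H ^ 2 * T) * √Φ) + 191 * (N * H ^ 2 * Φ))) := by ring
    _ ≤ E * (5000 * (Z * y + K)) := mul_le_mul_of_nonneg_left hin hE
    _ = _ := by ring

namespace Run

variable {X : Finset (S × A)} [Fintype S] {M : MDP X} {G : Digraph X} {H Shat : ℕ} {δ : ℝ}
  {s₀ : S} {Ω : Type w} [mΩ : MeasurableSpace Ω] {μ : Measure Ω}
  {ρ : Run M G H Shat δ s₀ μ} {ω : Ω} {ℓ : ℝ}

lemma GoodRun.certificate (hg : ρ.GoodRun ω ℓ) (hsupp : ∀ x, (M.P x).support.ncard ≤ Shat)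
    (hS : 1 ≤ Shat) (k : ℕ) :
    ρ.lower k ω ≤ ρ.playedValue k ω ∧ ρ.playedValue k ω ≤ ρ.bestValue k ω ∧
      ρ.bestValue k ω ≤ ρ.upper k ω := by
  have h := hg.validBounds hsupp hS k le_rfl
  refine ⟨?_, M.value_le_optValue H _ _, ?_⟩
  · rw [playedValue, M.value_eq_polVal]
    exact h.lower_le _
  · exact (M.optValue_le_starVal H (ρ.policy k ω) _).trans (h.star_le _)

/-- On good outcomes the cumulative certificate size obeys the rate. -/
theorem GoodRun.certSize_le (hg : ρ.GoodRun ω (-Real.log (failProb X.card H Shat δ)))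
    (hsupp : ∀ x, (M.P x).support.ncard ≤ Shat) (hS : 1 ≤ Shat) (hG : ∀ x, ¬ G.Adj x x)
    (hH : 1 ≤ H) (hSc : Shat ≤ X.card) (hδ : 0 < δ) (hδ1 : δ ≤ 1) (T : ℕ) :
    ρ.certSize T ω ≤ 5000 * Real.exp 16 * boundRate (masNumber G) X.card H Shat δ T := by
  rcases Nat.eq_zero_or_pos T with rfl | hT
  · simp [certSize, boundRate]
  have hc : 1 ≤ X.card := hS.trans hSc
  obtain ⟨hy, hℓ, hL, hlt⟩ := log_bounds hc hH hT hSc hδ hδ1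
  have h1 : ρ.certSize T ω = ∑ k ∈ Finset.range T, ρ.width k H (ρ.state k 0 ω) ω :=
    Finset.sum_congr rfl fun k _ => (hg.width_eq hsupp hS k le_rfl _).symm
  have h2 := hg.sum_width_le hsupp hS hH T
  have h3 := sum_stepCost_le (ρ := ρ) (ω := ω) hG hH (T * H)
    (sum_playPhi_sq_le hG hH hc hδ hδ1 (T * H)) (hg.sum_playVar_le hH T)
  have h4 := mul_le_mul_of_nonneg_left h3 (Real.exp_pos 16).le
  have hmas : 1 ≤ masNumber G := one_le_masNumber G hG (ρ.play 0 ω)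
  have h5 := rate_arith (m := masNumber G) (N := Shat) (H := H) (T := T) (E := Real.exp 16)
    (by exact_mod_cast hmas) (by exact_mod_cast hS) (by exact_mod_cast hH) (by exact_mod_cast hT)
    hy hℓ (logTerm_pos hc hδ hδ1 _).le hL (Real.log_nonneg (by
      have : (0 : ℝ) ≤ (T * H : ℕ) := Nat.cast_nonneg _
      linarith)) hlt (Real.exp_pos 16).le
  rw [boundRate, h1]
  refine (h2.trans (add_le_add le_rfl h4)).trans (le_trans (le_of_eq ?_) h5)
  push_cast
  rfl

end Run

end FeedbackRL

end

theorem theorem1 :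
    ∃ C : ℝ, 0 < C ∧
      ∀ (S : Type*) (A : Type*) [Fintype S] (X : Finset (S × A)),
        (∀ s : S, ∃ a : A, (s, a) ∈ X) →
      ∀ (M : FeedbackRL.MDP X) (G : Digraph X), (∀ x, ¬ G.Adj x x) →
      ∀ H : ℕ, 1 ≤ H →
      ∀ Shat : ℕ, (∀ x, (M.P x).support.ncard ≤ Shat) → Shat ≤ Fintype.card S →
      ∀ δ : ℝ, 0 < δ → δ ≤ 1 →
      ∀ (s₀ : S) (Ω : Type*) [MeasurableSpace Ω] (μ : MeasureTheory.Measure Ω)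
        [MeasureTheory.IsProbabilityMeasure μ]
        (ρ : FeedbackRL.Run M G H Shat δ s₀ μ),
        ENNReal.ofReal (1 - δ) ≤ μ {ω |
          (∀ k, ρ.lower k ω ≤ ρ.playedValue k ω ∧ ρ.playedValue k ω ≤ ρ.bestValue k ω ∧
            ρ.bestValue k ω ≤ ρ.upper k ω) ∧
          ∀ T : ℕ,
            ρ.certSize T ω ≤
              C * FeedbackRL.boundRate (FeedbackRL.masNumber G) X.card H Shat δ T ∧
            ρ.regret T ω ≤
              C * FeedbackRL.boundRate (FeedbackRL.masNumber G) X.card H Shat δ T} := by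
  refine ⟨5000 * Real.exp 16, by positivity, ?_⟩
  intro S A _ X hX M G hG H hH Shat hsupp hShat δ hδ hδ1 s₀ Ω _ μ _ ρ
  obtain ⟨a₀, ha₀⟩ := hX s₀
  have hS : 1 ≤ Shat := by
    refine le_trans ?_ (hsupp ⟨(s₀, a₀), ha₀⟩)
    exact (Set.ncard_pos (Set.toFinite _)).2 (PMF.support_nonempty _)
  have hSc : Shat ≤ X.card := by
    choose a ha using hX
    refine hShat.trans ?_
    rw [← Fintype.card_coe]
    refine Fintype.card_le_of_injective (fun s => (⟨(s, a s), ha s⟩ : X)) fun s s' h => ?_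
    exact congrArg (fun x : X => x.1.1) h
  have hc : 1 ≤ X.card := hS.trans hSc
  obtain ⟨ω₀⟩ : Nonempty Ω := nonempty_of_isProbabilityMeasure μ
  have hbad := ρ.measure_not_goodRun_le hH hc hδ hδ1 (ρ.policy 0 ω₀) hsupp
  have hgood : ENNReal.ofReal (1 - δ)
      ≤ μ {ω | ρ.GoodRun ω (-Real.log (FeedbackRL.failProb X.card H Shat δ))} := by
    rw [ENNReal.ofReal_sub _ hδ.le, ENNReal.ofReal_one, tsub_le_iff_right]
    calc (1 : ENNReal) = μ Set.univ := measure_univ.symm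
      _ ≤ μ ({ω | ρ.GoodRun ω (-Real.log (FeedbackRL.failProb X.card H Shat δ))}
          ∪ {ω | ¬ ρ.GoodRun ω (-Real.log (FeedbackRL.failProb X.card H Shat δ))}) :=
        measure_mono fun ω _ => em _
      _ ≤ _ := (measure_union_le _ _).trans (add_le_add le_rfl hbad)
  refine hgood.trans (measure_mono fun ω hω => ?_)
  have hcert := fun k => FeedbackRL.Run.GoodRun.certificate hω hsupp hS k
  have hsize := FeedbackRL.Run.GoodRun.certSize_le hω hsupp hS hG hH hSc hδ hδ1
  refine ⟨hcert, fun T => ⟨hsize T, le_trans ?_ (hsize T)⟩⟩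
  exact Finset.sum_le_sum fun k _ => by
    obtain ⟨h1, -, h3⟩ := hcert k
    linarith
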